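/- **Conventions.** Algorithms are deterministic; running time is measured as the worst-case number of steps in a standard model (here: while-programs on binary trees, where each pointer operation costs one step; this model is polynomially equivalent to Turing machines). 3-SAT with $m$ clauses has at most $3m$ variables. An instance of $\mathsf{LIN\text{-}2\text{-}MOD}_M(n)$ consists of at most $n$ linear equations over $\mathbb F_2$ in $x_1,\dots,x_n\in\{0,1\}$ and one constraint $\sum_j a_jx_j\equiv a_0 \pmod M$; one has to decide whether some $x\in\{0,1\}^n$ satisfies all of them. A multilinear polynomial $p$ with integer coefficients *represents $\mathsf{OR}_d \bmod M$ over $\{-1,1\}^d$* if, for $z\in\{-1,1\}^d$, $p(z)\equiv 0\pmod M$ if and only if $z=(1,\dots,1)$. $\mathsf{ETH}$ is the hypothesis that for some $\varepsilon>0$ there is no algorithm deciding 3-SAT with $m$ clauses in time $O(2^{\varepsilon m})$. "Requires time at least $B(n)$" means that, for every algorithm, its worst-case running time $T(n)$ satisfies $T(n)\ge B(n)$ for infinitely many $n$. **(0) Reduction.** Let $M$ be odd, let $p$ be a polynomial of degree $\Delta$ that represents $\mathsf{OR}_m\bmod M$ over $\{-1,1\}^m$, and let $\varphi=C_1\wedge\dots\wedge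 C_m$ be a 3-CNF formula on $3m$ variables, where $C_i(y)\in\{-1,1\}$ is $1$ iff the assignment $y\in\mathbb F_2^{3m}$ satisfies the $i$-th clause. Then there are $N\le\sum_{i\le 3\Delta}\binom{3m}{i}$, an instance of $\mathsf{LIN\text{-}2\text{-}MOD}_M(N)$ with weights $a_1,\dots,a_N$, and a linear map $u:\mathbb F_2^{3m}\to\mathbb F_2^N$ whose image is exactly the solution set of the linear equations of the instance, such that $\sum_j a_j(1-2u(y)_j)\equiv p(C_1(y),\dots,C_m(y)) \pmod M$ for all $y$; the instance is satisfiable if and only if $\varphi$ is. Assume $\mathsf{ETH}$. **(1) Proposition.** There are absolute constants $\delta,C>0$ such that for every $k$ there is an $a$ with the following property. Let $M$ be odd and let $f$ be a function such that for every $d$ some polynomial of degree $f(d)$ represents $\mathsf{OR}_d\bmod M$ over $\{-1,1\}^d$, and one algorithm, given $d$, writes down these polynomials (coefficients modulo $M$) in time $O(s^k)$, $s=\sum_{i\le f(d)}\binom di$. Then there is a constant $K$ (depending on $M$, $f$ and that algorithm) such that for every algorithm solving $\mathsf{LIN\text{-}2\text{-}MOD}_M(n)$ in time $T(n)$ there are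 infinitely many $m$ for which some $n\ge m$ satisfies $$\log n\le C f(m)\log\frac{e\,m}{f(m)}\qquad\text{and}\qquad T(n)\ge 2^{\delta m}-K n^a .$$ **(2) Corollary.** There are absolute constants $0<c<1$ and $\delta>0$ such that solving $\mathsf{LIN\text{-}2\text{-}MOD}_M(n)$ requires time at least $n^{\delta M/\log M}$, both for every fixed odd $M\ge3$ and for every growing modulus $M=M(n)\to\infty$ with $M(n)\ge 3$ odd, $M(n)\le cn$ and $M(n+1)\le 2M(n)$ for all large $n$, and $M(n)$ computable in time polynomial in $n$. **(3) Corollary.** Let $M\ge 2$ have exactly $r\ge1$ distinct odd prime factors ($M$ may be even). There is $\delta_M>0$ depending only on $M$ such that solving $\mathsf{LIN\text{-}2\text{-}MOD}_M(n)$ requires time at least $\exp\!\big(\delta_M(\log n/\log\log n)^r\big)$. If $\mathsf{ETH}$ is replaced by the hypothesis that no algorithm decides 3-SAT with $m$ clauses in time $2^{o(m)}$, then (1), (2) for growing moduli, and (3) remain true with a constant $\delta>0$ which may depend on the algorithm considered for $\mathsf{LIN\text{-}2\text{-}MOD}$ (for (1) and (3), also on $M$; for (1), also on $f$; for (2), also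 on the function $M(\cdot)$). -/

import Mathlib

open Filter Asymptotics

noncomputable section

namespace ModCSP

/-! ## The machine model

Deterministic while-programs over binary trees (as in Jones, "Computability and Complexity from a
programming perspective").  A store holds one tree in each variable.  Every constructor of an
evaluated expression costs one step (`cons`, `hd`, `tl` are pointer operations), so a program
performs a bounded amount of work per step.  The model is polynomially equivalent to multi-tape
Turing machines. -/

/-- Binary trees with unlabelled leaves. -/
inductive Data : Type
  | nil : Data
  | cons : Data → Data → Data

/-- Left subtree (`nil` for a leaf). -/
def Data.hd : Data → Data
  | .nil => .nil
  | .cons a _ => a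

/-- Right subtree (`nil` for a leaf). -/
def Data.tl : Data → Data
  | .nil => .nil
  | .cons _ b => b

/-- A store: the content of each program variable. -/
abbrev Store : Type := ℕ → Data

/-- Expressions. -/
inductive Tm : Type
  | nil : Tm
  | var : ℕ → Tm
  | cons : Tm → Tm → Tm
  | hd : Tm → Tm
  | tl : Tm → Tm

/-- Value of an expression. -/
def Tm.eval (s : Store) : Tm → Data
  | .nil => .nil
  | .var x => s x
  | .cons a b => .cons (a.eval s) (b.eval s)
  | .hd a => (a.eval s).hd
  | .tl a => (a.eval s).tl

/-- Number of steps for the evaluation of an expression: its number of nodes. -/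
def Tm.cost : Tm → ℕ
  | .nil => 1
  | .var _ => 1
  | .cons a b => a.cost + b.cost + 1
  | .hd a => a.cost + 1
  | .tl a => a.cost + 1

/-- Programs: assignment, sequence, conditional, while-loop (a test succeeds if it is not `nil`). -/
inductive Prog : Type
  | assign : ℕ → Tm → Prog
  | seq : Prog → Prog → Prog
  | cond : Tm → Prog → Prog → Prog
  | loop : Tm → Prog → Prog

/-- `Exec p s t s'`: started in the store `s`, the program `p` halts after exactly `t` steps in the
store `s'`. -/
inductive Exec : Prog → Store → ℕ → Store → Prop
  | assign (x : ℕ) (e : Tm) (s : Store) :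
      Exec (.assign x e) s e.cost (Function.update s x (e.eval s))
  | seq {p q : Prog} {s s' s'' : Store} {t u : ℕ} :
      Exec p s t s' → Exec q s' u s'' → Exec (.seq p q) s (t + u) s''
  | cond_true {e : Tm} {p q : Prog} {s s' : Store} {t : ℕ} :
      e.eval s ≠ .nil → Exec p s t s' → Exec (.cond e p q) s (e.cost + t) s'
  | cond_false {e : Tm} {p q : Prog} {s s' : Store} {t : ℕ} :
      e.eval s = .nil → Exec q s t s' → Exec (.cond e p q) s (e.cost + t) s'
  | loop_stop {e : Tm} {p : Prog} {s : Store} :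
      e.eval s = .nil → Exec (.loop e p) s e.cost s
  | loop_step {e : Tm} {p : Prog} {s s' s'' : Store} {t u : ℕ} :
      e.eval s ≠ .nil → Exec p s t s' → Exec (.loop e p) s' u s'' →
        Exec (.loop e p) s (e.cost + t + u) s''

/-- On input `i` (stored in variable `0`, all other variables being `nil`), the program `p` halts
within `B` steps with output `o` (the content of variable `0`). -/
def OutputsWithin (p : Prog) (i : Data) (B : ℕ) (o : Data) : Prop :=
  ∃ t ≤ B, ∃ s : Store, Exec p (Function.update (fun _ => Data.nil) 0 i) t s ∧ s 0 = o

/-- On input `i`, the program `p` halts within `B` steps and accepts (output different from `nil`)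
if and only if `A` holds. -/
def DecidesWithin (p : Prog) (i : Data) (B : ℕ) (A : Prop) : Prop :=
  ∃ o : Data, OutputsWithin p i B o ∧ (o ≠ Data.nil ↔ A)

/-! ## Encodings -/

/-- Lists are encoded as right combs. -/
def encList : List Data → Data
  | [] => .nil
  | a :: l => .cons a (encList l)

/-- Natural numbers are encoded in unary. -/
def encNat : ℕ → Data
  | 0 => .nil
  | k + 1 => .cons .nil (encNat k)

/-- Booleans. -/
def encBool : Bool → Data
  | false => .nil
  | true => .cons .nil .nil

/-! ## 3-SAT and the exponential time hypothesis -/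

/-- A 3-CNF formula with `m` clauses of three literals (possibly repeated) each.  It mentions at
most `3 * m` variables, which are numbered by `Fin (3 * m)`; `(v, true)` is the literal `v` and
`(v, false)` its negation. -/
abbrev ThreeCNF (m : ℕ) : Type := Fin m → Fin 3 → Fin (3 * m) × Bool

namespace ThreeCNF

/-- The assignment `x` satisfies the `i`-th clause. -/
def ClauseSat {m : ℕ} (φ : ThreeCNF m) (x : Fin (3 * m) → Bool) (i : Fin m) : Prop :=
  ∃ j : Fin 3, x (φ i j).1 = (φ i j).2

/-- The formula is satisfiable. -/
def Satisfiable {m : ℕ} (φ : ThreeCNF m) : Prop :=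
  ∃ x : Fin (3 * m) → Bool, ∀ i, φ.ClauseSat x i

open Classical in
/-- The value of the `i`-th clause in `{-1, 1}`: `1` if it is satisfied and `-1` if it is not. -/
def clauseValue {m : ℕ} (φ : ThreeCNF m) (x : Fin (3 * m) → Bool) (i : Fin m) : ℤ :=
  if φ.ClauseSat x i then 1 else -1

/-- The input tree for a formula: the list of its clauses, each a list of literals. -/
def enc {m : ℕ} (φ : ThreeCNF m) : Data :=
  encList (List.ofFn fun i => encList (List.ofFn fun j =>
    Data.cons (encNat ((φ i j).1 : ℕ)) (encBool (φ i j).2)))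

end ThreeCNF

/-- `Q` decides 3-SAT, in at most `S m` steps on formulas with `m` clauses. -/
def SolvesThreeSat (Q : Prog) (S : ℕ → ℕ) : Prop :=
  ∀ (m : ℕ) (φ : ThreeCNF m), DecidesWithin Q φ.enc (S m) φ.Satisfiable

/-- The exponential time hypothesis: for some `ε > 0`, no algorithm decides 3-SAT with `m` clauses
in time `O(2 ^ (ε m))`. -/
def ETH : Prop :=
  ∃ ε : ℝ, 0 < ε ∧ ¬ ∃ (Q : Prog) (S : ℕ → ℕ) (K : ℝ), SolvesThreeSat Q S ∧
    ∀ m : ℕ, (S m : ℝ) ≤ K * (2 : ℝ) ^ (ε * (m : ℝ))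

/-- The exponential time hypothesis in its little-o form: no algorithm decides 3-SAT with `m`
clauses in time `2 ^ o(m)`. -/
def ETHLittleO : Prop :=
  ¬ ∃ (Q : Prog) (S : ℕ → ℕ), SolvesThreeSat Q S ∧
    (fun m : ℕ => Real.log (S m)) =o[atTop] (fun m : ℕ => (m : ℝ))

/-! ## LIN-2-MOD -/

/-- An instance of LIN-2-MOD with modulus `M` on `n` variables: at most `n` linear equations
`∑ j, mat e j * x j = rhs e` over `ℤ/2` (more equations are redundant, up to one that makes the
system inconsistent) and one modular constraint `∑ j, wt j * x j = target` over `ℤ/M`. -/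
structure Lin2Mod (M n : ℕ) where
  numEq : ℕ
  numEq_le : numEq ≤ n
  mat : Fin numEq → Fin n → ZMod 2
  rhs : Fin numEq → ZMod 2
  wt : Fin n → ZMod M
  target : ZMod M

namespace Lin2Mod

/-- The affine subspace of solutions of the linear equations. -/
def solutions {M n : ℕ} (I : Lin2Mod M n) : Set (Fin n → ZMod 2) :=
  {x | ∀ e, ∑ j, I.mat e j * x j = I.rhs e}

/-- Some `0/1` vector satisfies the linear equations modulo `2` and the constraint modulo `M`. -/
def Satisfiable {M n : ℕ} (I : Lin2Mod M n) : Prop :=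
  ∃ x ∈ I.solutions, ∑ j, I.wt j * ((x j).val : ZMod M) = I.target

/-- The input tree for an instance: modulus, number of variables, equations (coefficient list and
right-hand side), weights, target. -/
def enc {M n : ℕ} (I : Lin2Mod M n) : Data :=
  .cons (encNat M) (.cons (encNat n) (.cons
    (encList (List.ofFn fun e =>
      Data.cons (encList (List.ofFn fun j => encNat (I.mat e j).val)) (encNat (I.rhs e).val)))
    (.cons (encList (List.ofFn fun j => encNat (I.wt j).val)) (encNat I.target.val))))

end Lin2Mod

/-- `P` decides LIN-2-MOD with modulus `μ n` on instances with `n` variables, in at most `T n`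
steps. -/
def SolvesLin2Mod (P : Prog) (μ : ℕ → ℕ) (T : ℕ → ℕ) : Prop :=
  ∀ (n : ℕ) (I : Lin2Mod (μ n) n), DecidesWithin P I.enc (T n) I.Satisfiable

/-! ## Polynomials representing OR modulo `M` over the basis `{-1, 1}` -/

/-- The multilinear integer polynomial `p` represents `OR_d` modulo `M` over `{-1, 1}^d`: its value
is divisible by `M` at the all-ones vector and at no other point. -/
def RepresentsOR (M d : ℕ) (p : MvPolynomial (Fin d) ℤ) : Prop :=
  (∀ i, p.degreeOf i ≤ 1) ∧
  ∀ z : Fin d → ℤˣ, (M : ℤ) ∣ MvPolynomial.eval (fun i => (z i : ℤ)) p ↔ z = 1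

/-- The tree for a multilinear polynomial with coefficients read modulo `M`, its monomials being
listed in the order `L`: a list of pairs (list of the variables of the monomial, coefficient). -/
def encPoly (M : ℕ) {d : ℕ} (p : MvPolynomial (Fin d) ℤ) (L : List (Fin d →₀ ℕ)) : Data :=
  encList (L.map fun μ =>
    Data.cons (encList ((μ.support.sort (· ≤ ·)).map fun i => encNat (i : ℕ)))
      (encNat (p.coeff μ % (M : ℤ)).toNat))

/-- For every `d` there is a polynomial of degree `f d` which represents `OR_d` modulo `M`, and
one program writes down these polynomials in time `O(s ^ k)`, where `s = ∑ i ≤ f d, (d choose i)`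
is the number of multilinear monomials of degree at most `f d`. -/
def EfficientOR (M : ℕ) (f : ℕ → ℕ) (k : ℕ) : Prop :=
  ∃ (p : ∀ d : ℕ, MvPolynomial (Fin d) ℤ) (G : Prog) (K : ℕ), ∀ d : ℕ,
    RepresentsOR M d (p d) ∧ (p d).totalDegree = f d ∧
    ∃ L : List (Fin d →₀ ℕ), (L : Multiset (Fin d →₀ ℕ)) = (p d).support.val ∧
      OutputsWithin G (encNat d) (K * (∑ i ∈ Finset.range (f d + 1), d.choose i) ^ k)
        (encPoly M (p d) L)

/-- The function `μ` is computable in time polynomial in its argument. -/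
def PolyTimeNat (μ : ℕ → ℕ) : Prop :=
  ∃ (G : Prog) (K k : ℕ), ∀ n : ℕ, OutputsWithin G (encNat n) (K * (n + 1) ^ k) (encNat (μ n))

/-- A growing modulus: `μ n` is odd, at least `3`, tends to infinity with `n`, is computable in
polynomial time, and eventually satisfies `μ n ≤ c n` and `μ (n + 1) ≤ 2 μ n`. -/
structure GrowingModulus (c : ℝ) (μ : ℕ → ℕ) : Prop where
  odd : ∀ n, Odd (μ n)
  three_le : ∀ n, 3 ≤ μ n
  tendsto : Tendsto μ atTop atTop
  polyTime : PolyTimeNat μ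
  le_mul : ∀ᶠ n : ℕ in atTop, (μ n : ℝ) ≤ c * (n : ℝ)
  doubling : ∀ᶠ n : ℕ in atTop, μ (n + 1) ≤ 2 * μ n

end ModCSP

end

open ModCSP

namespace ModCSP

/-! ## Executions -/

/-! All lower bounds come from reductions that turn a 3-SAT formula with m clauses into one
LIN-2-MOD instance whose number n of variables is small compared with 2^m. The common mechanism is
linearisation. Suppose that a function of the assignment y with values in ℤ/M is a combination of
parities (-1)^(∑ y v). Each parity becomes a new variable x, tied to y by a linear equation over 𝔽₂,
and since (-1)^x = 1 - 2x, the vanishing of the combination is one constraint modulo M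
(`lin2Mod_satisfiable_iff`). An algorithm for LIN-2-MOD then decides 3-SAT in the time of the
reduction plus T(n), and the hypothesis makes this exceed 2^(εm) infinitely often. What remains is
to find a function that detects satisfaction and has few parities.

For a literal on v, one of 1 ± (-1)^(y v) is 2 where the literal is false and 0 where it is true.
Hence 1 + κ ∏ (1 ± (-1)^(y v)) is 1 on a true clause and 1 + 8κ on a false one. Taking 8κ = -2 gives
the value in {-1, 1}, taking 8κ = -1 gives the indicator of truth. Each clause in a product
multiplies the number of terms by 1 + 2³ = 9.

Three functions are used. A polynomial representing OR is evaluated at the clause values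
(`exists_polyReduction`). For the bound in terms of M / log M, the clauses are split into M - 1
blocks and the indicators of the blocks are added: the sum lies between 0 and M - 1, so it is -1
modulo M only if every block is satisfied (`BlockInput.tval_terms`). For r odd primes, a binomial
coefficient modulo each prime p tests by Lucas whether a power q of p divides the number of false
clauses. The powers are about m^(1/r), and together they exceed m, so only the number 0 passes all
tests (`tval_primeTerms`).

Unconditionally, T(n) ≥ n, because a run of t steps sees only t levels of its input
(`SolvesLin2Mod.le_time`). This covers r = 1, and those fixed moduli for which the block bound does
not dominate the polynomial time of the reduction.

The running times of the reductions are proved in a small calculus. `PTime b x y` says that one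
program maps x i to y i for all indices i, in time polynomial in a measure b i that need not be the
input length; the index type carries whatever is known about the inputs, and the rules for folds and
searches build everything else. Statement (0) has no running time and is proved separately: parities
of at most k variables span a multiplicative filtration, and p of the clause values lies in its
level 3Δ. -/

theorem Exec.det {p : Prog} {s : Store} {t : ℕ} {s' : Store} (h : Exec p s t s') :
    ∀ {u : ℕ} {s'' : Store}, Exec p s u s'' → t = u ∧ s' = s'' := by
  induction h with
  | assign x e s => intro u s'' h; cases h; exact ⟨rfl, rfl⟩
  | seq _ _ ih1 ih2 =>
    intro u s'' h
    cases h with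
    | seq h1 h2 =>
      obtain ⟨rfl, rfl⟩ := ih1 h1
      obtain ⟨rfl, rfl⟩ := ih2 h2
      exact ⟨rfl, rfl⟩
  | cond_true he _ ih =>
    intro u s'' h
    cases h with
    | cond_true _ h1 => obtain ⟨rfl, rfl⟩ := ih h1; exact ⟨rfl, rfl⟩
    | cond_false he' _ => exact absurd he' he
  | cond_false he _ ih =>
    intro u s'' h
    cases h with
    | cond_true he' _ => exact absurd he he'
    | cond_false _ h1 => obtain ⟨rfl, rfl⟩ := ih h1; exact ⟨rfl, rfl⟩
  | loop_stop he =>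
    intro u s'' h
    cases h with
    | loop_stop _ => exact ⟨rfl, rfl⟩
    | loop_step he' _ _ => exact absurd he he'
  | loop_step he _ _ ih1 ih2 =>
    intro u s'' h
    cases h with
    | loop_stop he' => exact absurd he' he
    | loop_step _ h1 h2 =>
      obtain ⟨rfl, rfl⟩ := ih1 h1
      obtain ⟨rfl, rfl⟩ := ih2 h2
      exact ⟨rfl, rfl⟩

/-- A strict bound for the variables of an expression. -/
def Tm.varBound : Tm → ℕ
  | .nil => 0
  | .var x => x + 1
  | .cons a b => max a.varBound b.varBound
  | .hd a => a.varBound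
  | .tl a => a.varBound

/-- A strict bound for the variables of a program. -/
def Prog.varBound : Prog → ℕ
  | .assign x e => max (x + 1) e.varBound
  | .seq p q => max p.varBound q.varBound
  | .cond e p q => max e.varBound (max p.varBound q.varBound)
  | .loop e p => max e.varBound p.varBound

theorem Tm.eval_congr {N : ℕ} {s s' : Store} (h : ∀ v < N, s' v = s v) :
    ∀ e : Tm, e.varBound ≤ N → e.eval s' = e.eval s
  | .nil, _ => rfl
  | .var x, hx => h x hx
  | .cons a b, hb => by
    simp only [Tm.varBound, max_le_iff] at hb
    simp only [Tm.eval, Tm.eval_congr h a hb.1, Tm.eval_congr h b hb.2]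
  | .hd a, hb => by simp only [Tm.eval, Tm.eval_congr h a hb]
  | .tl a, hb => by simp only [Tm.eval, Tm.eval_congr h a hb]

/-- An execution only depends on, and only changes, the variables of the program. -/
theorem Exec.congr {N : ℕ} {p : Prog} {s : Store} {t : ℕ} {s' : Store} (h : Exec p s t s') :
    p.varBound ≤ N → ∀ r : Store, (∀ v < N, r v = s v) →
      ∃ r' : Store, Exec p r t r' ∧ (∀ v < N, r' v = s' v) ∧ ∀ v, N ≤ v → r' v = r v := by
  induction h with
  | assign x e s =>
    intro hN r hr
    simp only [Prog.varBound, max_le_iff] at hN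
    refine ⟨_, Exec.assign x e r, fun v hv => ?_, fun v hv => ?_⟩
    · by_cases hvx : v = x
      · subst hvx; simp [Tm.eval_congr hr e hN.2]
      · simp [hvx, hr v hv]
    · rw [Function.update_of_ne (by omega)]
  | seq _ _ ih1 ih2 =>
    intro hN r hr
    simp only [Prog.varBound, max_le_iff] at hN
    obtain ⟨r1, e1, a1, b1⟩ := ih1 hN.1 r hr
    obtain ⟨r2, e2, a2, b2⟩ := ih2 hN.2 r1 a1
    exact ⟨r2, .seq e1 e2, a2, fun v hv => (b2 v hv).trans (b1 v hv)⟩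
  | cond_true he _ ih =>
    intro hN r hr
    simp only [Prog.varBound, max_le_iff] at hN
    obtain ⟨r1, e1, a1, b1⟩ := ih hN.2.1 r hr
    exact ⟨r1, .cond_true (by rwa [Tm.eval_congr hr _ hN.1]) e1, a1, b1⟩
  | cond_false he _ ih =>
    intro hN r hr
    simp only [Prog.varBound, max_le_iff] at hN
    obtain ⟨r1, e1, a1, b1⟩ := ih hN.2.2 r hr
    exact ⟨r1, .cond_false (by rwa [Tm.eval_congr hr _ hN.1]) e1, a1, b1⟩
  | loop_stop he =>
    intro hN r hr
    simp only [Prog.varBound, max_le_iff] at hN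
    exact ⟨r, Exec.loop_stop (by rwa [Tm.eval_congr hr _ hN.1]), hr, fun _ _ => rfl⟩
  | loop_step he _ _ ih1 ih2 =>
    intro hN r hr
    have hN' := hN
    simp only [Prog.varBound, max_le_iff] at hN'
    obtain ⟨r1, e1, a1, b1⟩ := ih1 hN'.2 r hr
    obtain ⟨r2, e2, a2, b2⟩ := ih2 hN r1 a1
    exact ⟨r2, .loop_step (by rwa [Tm.eval_congr hr _ hN'.1]) e1 e2, a2,
      fun v hv => (b2 v hv).trans (b1 v hv)⟩

/-- Two trees agree down to depth `d`. -/
def Data.Agree : ℕ → Data → Data → Prop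
  | 0, _, _ => True
  | _ + 1, .nil, .nil => True
  | d + 1, .cons a b, .cons a' b' => Agree d a a' ∧ Agree d b b'
  | _ + 1, .nil, .cons _ _ => False
  | _ + 1, .cons _ _, .nil => False

namespace Data.Agree

theorem rfl : ∀ {d : ℕ} {a : Data}, Agree d a a
  | 0, _ => trivial
  | _ + 1, .nil => trivial
  | _ + 1, .cons _ _ => ⟨rfl, rfl⟩

theorem pred : ∀ {d : ℕ} {a b : Data}, Agree (d + 1) a b → Agree d a b
  | 0, _, _, _ => trivial
  | _ + 1, .nil, .nil, _ => trivial
  | _ + 1, .cons _ _, .cons _ _, h => ⟨h.1.pred, h.2.pred⟩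
  | _ + 1, .nil, .cons _ _, h => h.elim
  | _ + 1, .cons _ _, .nil, h => h.elim

theorem mono {d e : ℕ} (hde : d ≤ e) {a b : Data} (h : Agree e a b) : Agree d a b := by
  induction hde with
  | refl => exact h
  | step _ ih => exact ih h.pred

theorem hd : ∀ {d : ℕ} {a b : Data}, Agree (d + 1) a b → Agree d a.hd b.hd
  | _, .nil, .nil, _ => rfl
  | _, .cons _ _, .cons _ _, h => h.1
  | _, .nil, .cons _ _, h => h.elim
  | _, .cons _ _, .nil, h => h.elim

theorem tl : ∀ {d : ℕ} {a b : Data}, Agree (d + 1) a b → Agree d a.tl b.tl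
  | _, .nil, .nil, _ => rfl
  | _, .cons _ _, .cons _ _, h => h.2
  | _, .nil, .cons _ _, h => h.elim
  | _, .cons _ _, .nil, h => h.elim

theorem eq_nil_iff : ∀ {d : ℕ} {a b : Data}, Agree (d + 1) a b → (a = .nil ↔ b = .nil)
  | _, .nil, .nil, _ => Iff.rfl
  | _, .cons _ _, .cons _ _, _ => by simp
  | _, .nil, .cons _ _, h => h.elim
  | _, .cons _ _, .nil, h => h.elim

end Data.Agree

/-- Each `hd` or `tl` uses up one level and costs one step. A variable costs one step and uses up
none, which leaves the spare level in the conclusion: even for d = 0 the values agree about being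
`nil`, so tests come out equal. -/
theorem Tm.eval_agree {s s' : Store} : ∀ (e : Tm) {d : ℕ},
    (∀ v, Data.Agree (d + e.cost) (s v) (s' v)) → Data.Agree (d + 1) (e.eval s) (e.eval s')
  | .nil, _, _ => Data.Agree.rfl
  | .var x, _, h => h x
  | .cons a b, d, h =>
    ⟨(a.eval_agree fun v => (h v).mono (by simp only [Tm.cost]; omega)).pred,
      (b.eval_agree fun v => (h v).mono (by simp only [Tm.cost]; omega)).pred⟩
  | .hd a, d, h =>
    (a.eval_agree (d := d + 1) fun v => (h v).mono (by simp only [Tm.cost]; omega)).hd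
  | .tl a, d, h =>
    (a.eval_agree (d := d + 1) fun v => (h v).mono (by simp only [Tm.cost]; omega)).tl

/-- A run of `t` steps does not see more than `t` levels of the store. -/
theorem Exec.agree {p : Prog} {s : Store} {t : ℕ} {s' : Store} (h : Exec p s t s') :
    ∀ {d : ℕ} {r : Store}, (∀ v, Data.Agree (d + t) (s v) (r v)) →
      ∃ r' : Store, Exec p r t r' ∧ ∀ v, Data.Agree d (s' v) (r' v) := by
  induction h with
  | assign x e s =>
    intro d r hr
    refine ⟨_, .assign x e r, fun v => ?_⟩
    by_cases hvx : v = x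
    · subst hvx; simpa using (e.eval_agree hr).pred
    · simpa [hvx] using (hr v).mono (by omega)
  | @seq p q s s' s'' t u _ _ ih1 ih2 =>
    intro d r hr
    obtain ⟨r1, e1, a1⟩ := ih1 (d := d + u) fun v => (hr v).mono (by omega)
    obtain ⟨r2, e2, a2⟩ := ih2 a1
    exact ⟨r2, .seq e1 e2, a2⟩
  | @cond_true e _ _ _ _ t he _ ih =>
    intro d r hr
    have := (e.eval_agree (d := d + t) fun v => (hr v).mono (by omega)).eq_nil_iff
    obtain ⟨r1, e1, a1⟩ := ih (d := d) fun v => (hr v).mono (by omega)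
    exact ⟨r1, .cond_true (fun h => he (this.2 h)) e1, a1⟩
  | @cond_false e _ _ _ _ t he _ ih =>
    intro d r hr
    have := (e.eval_agree (d := d + t) fun v => (hr v).mono (by omega)).eq_nil_iff
    obtain ⟨r1, e1, a1⟩ := ih (d := d) fun v => (hr v).mono (by omega)
    exact ⟨r1, .cond_false (this.1 he) e1, a1⟩
  | loop_stop he =>
    rename_i e _ _
    intro d r hr
    have := (e.eval_agree (d := d) hr).eq_nil_iff
    exact ⟨r, Exec.loop_stop (this.1 he), fun v => (hr v).mono (by omega)⟩
  | @loop_step e _ _ _ _ t u he _ _ ih1 ih2 =>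
    intro d r hr
    have := (e.eval_agree (d := d + t + u) fun v => (hr v).mono (by omega)).eq_nil_iff
    obtain ⟨r1, e1, a1⟩ := ih1 (d := d + u) fun v => (hr v).mono (by omega)
    obtain ⟨r2, e2, a2⟩ := ih2 a1
    exact ⟨r2, .loop_step (fun h => he (this.2 h)) e1 e2, a2⟩

/-- The run on `i` can be replayed on `i'` with one level of agreement left at the end, enough to
compare the outputs with `nil`. Determinism identifies the replay with the given run on `i'`. -/
theorem DecidesWithin.iff_of_agree {p : Prog} {i i' : Data} {B B' : ℕ} {A A' : Prop}
    (h : DecidesWithin p i B A) (h' : DecidesWithin p i' B' A') (hi : Data.Agree (B + 1) i i') :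
    A ↔ A' := by
  obtain ⟨o, ⟨t, ht, s, hs, rfl⟩, ho⟩ := h
  obtain ⟨o', ⟨t', _, s', hs', rfl⟩, ho'⟩ := h'
  obtain ⟨r, hr, ha⟩ := hs.agree (d := 1)
    (r := Function.update (fun _ => Data.nil) 0 i') (fun v => by
      by_cases hv : v = 0
      · subst hv; simpa using hi.mono (by omega)
      · simpa [hv] using Data.Agree.rfl)
  obtain ⟨-, rfl⟩ := hr.det hs'
  rw [← ho, ← ho', not_iff_not]
  exact (ha 0).eq_nil_iff

/-- Instances with a single modular constraint `c * x_(n-1) = 1`. -/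
def lastWeight (M n : ℕ) (c : ZMod M) : Lin2Mod M n where
  numEq := 0
  numEq_le := Nat.zero_le _
  mat := Fin.elim0
  rhs := Fin.elim0
  wt j := if (j : ℕ) + 1 = n then c else 0
  target := 1

/-- Entry j of a right comb hangs at depth j + 1, so later entries are invisible down to depth d. -/
theorem encList_agree {d : ℕ} : ∀ {l l' : List Data}, l.length = l'.length →
    (∀ (j : ℕ) (h : j < l.length) (h' : j < l'.length), j + 1 < d → l[j] = l'[j]) →
      Data.Agree d (encList l) (encList l') := by
  induction d with
  | zero => intros; trivial
  | succ d ih =>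
    intro l l' hl h
    match l, l', hl with
    | [], [], _ => trivial
    | a :: l, a' :: l', hl =>
      simp only [List.length_cons, add_left_inj] at hl
      refine ⟨?_, ih hl fun j h1 h2 hj => ?_⟩
      · rcases Nat.eq_zero_or_pos d with rfl | hd
        · trivial
        · have := h 0 (by simp) (by simp) (by omega)
          simp only [List.getElem_cons_zero] at this
          rw [this]; exact Data.Agree.rfl
      · exact h (j + 1) (by simpa using h1) (by simpa using h2) (by omega)

/-- Every algorithm for LIN-2-MOD has to read its whole input. -/
theorem SolvesLin2Mod.le_time {P : Prog} {μ T : ℕ → ℕ} (h : SolvesLin2Mod P μ T) {n : ℕ}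
    (hn : 0 < n) (hμ : 2 ≤ μ n) : n ≤ T n := by
  by_contra hlt
  push Not at hlt
  have h0 := h n (lastWeight (μ n) n 0)
  have h1 := h n (lastWeight (μ n) n 1)
  have : Fact (1 < μ n) := ⟨hμ⟩
  have key := h0.iff_of_agree h1 (by
    refine Data.Agree.mono (show T n + 1 ≤ n by omega) ?_
    -- The weight list sits four levels below the root. Within it only the last entry differs, and
    -- that entry has depth n.
    refine Data.Agree.mono (show n ≤ n + 4 by omega) ?_
    refine ⟨Data.Agree.rfl, Data.Agree.rfl, Data.Agree.rfl, ?_, Data.Agree.rfl⟩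
    refine encList_agree (by simp) fun j hj hj' hjn => ?_
    simp only [List.length_ofFn] at hj
    simp only [List.getElem_ofFn, lastWeight]
    rw [if_neg (by omega), if_neg (by omega)])
  have hf : ¬ (lastWeight (μ n) n 0).Satisfiable := by
    rintro ⟨x, -, hx⟩
    simp [lastWeight] at hx
  have ht : (lastWeight (μ n) n 1).Satisfiable := by
    refine ⟨fun _ => 1, fun e => Fin.elim0 e, ?_⟩
    have h2 : (1 : ZMod 2).val = 1 := rfl
    simp only [lastWeight, h2, Nat.cast_one, mul_one]
    rw [Finset.sum_eq_single (⟨n - 1, by omega⟩ : Fin n)]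
    · rw [if_pos]; simp only; omega
    · intro b _ hb
      rw [if_neg]
      intro hb'
      exact hb (Fin.ext (by simp only; omega))
    · simp
  exact hf (key.2 ht)

/-! ## Programs with time bounds -/

/-- Started in any store with `i` in variable `0`, the program `p` halts within `B` steps with `o`
in variable `0`, and it leaves the variables from `N` on unchanged. -/
def Runs (p : Prog) (N : ℕ) (i : Data) (B : ℕ) (o : Data) : Prop :=
  ∀ s : Store, s 0 = i → ∃ t s', t ≤ B ∧ Exec p s t s' ∧ s' 0 = o ∧ ∀ v, N ≤ v → s' v = s v

theorem Runs.mono {p : Prog} {N N' : ℕ} {i o : Data} {B B' : ℕ} (h : Runs p N i B o)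
    (hN : N ≤ N') (hB : B ≤ B') : Runs p N' i B' o := fun s hs => by
  obtain ⟨t, s', ht, he, ho, hf⟩ := h s hs
  exact ⟨t, s', ht.trans hB, he, ho, fun v hv => hf v (hN.trans hv)⟩

theorem Runs.seq {p q : Prog} {N : ℕ} {i o r : Data} {B C : ℕ} (h : Runs p N i B o)
    (h' : Runs q N o C r) : Runs (.seq p q) N i (B + C) r := fun s hs => by
  obtain ⟨t, s', ht, he, ho, hf⟩ := h s hs
  obtain ⟨t', s'', ht', he', ho', hf'⟩ := h' s' ho
  exact ⟨_, s'', Nat.add_le_add ht ht', .seq he he', ho', fun v hv => (hf' v hv).trans (hf v hv)⟩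

theorem Runs.expr (e : Tm) (he : e.varBound ≤ 1) (i : Data) :
    Runs (.assign 0 e) 1 i e.cost (e.eval fun _ => i) := fun s hs => by
  refine ⟨_, _, le_rfl, .assign 0 e s, ?_, fun v hv => ?_⟩
  · rw [Function.update_self]
    refine Tm.eval_congr (N := 1) (fun v hv => ?_) e he
    obtain rfl : v = 0 := by omega
    exact hs
  · rw [Function.update_of_ne (by omega)]

/-- Variables N and N + 1 hold the input and the first result; the frame condition in `Runs` keeps
both programs from touching them. -/
theorem Runs.pair {p q : Prog} {N : ℕ} {i o r : Data} {B C : ℕ} (hN : 0 < N) (h : Runs p N i B o)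
    (h' : Runs q N i C r) :
    Runs (.seq (.assign N (.var 0)) (.seq p (.seq (.assign (N + 1) (.var 0))
      (.seq (.assign 0 (.var N)) (.seq q (.assign 0 (.cons (.var (N + 1)) (.var 0)))))))) (N + 2) i
      (B + C + 6) (.cons o r) := fun s hs => by
  obtain ⟨t, s1, ht, he, ho, hf⟩ := h (Function.update s N i) (by
    rw [Function.update_of_ne (by omega), hs])
  obtain ⟨t', s2, ht', he', ho', hf'⟩ := h'
    (Function.update (Function.update s1 (N + 1) o) 0 i) (by simp)
  have e0 := Exec.assign N (.var 0) s
  have e1 := Exec.assign (N + 1) (.var 0) s1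
  have e2 := Exec.assign 0 (.var N) (Function.update s1 (N + 1) o)
  have e3 := Exec.assign 0 (.cons (.var (N + 1)) (.var 0)) s2
  simp only [Tm.eval, Tm.cost] at e0 e1 e2 e3
  rw [hs] at e0
  rw [ho] at e1
  have hN1 : Function.update s1 (N + 1) o N = i := by
    rw [Function.update_of_ne (by omega), hf N le_rfl, Function.update_self]
  rw [hN1] at e2
  have hN2 : s2 (N + 1) = o := by
    rw [hf' _ (by omega), Function.update_of_ne (by omega), Function.update_self]
  rw [hN2, ho'] at e3
  refine ⟨_, _, ?_, .seq e0 (.seq he (.seq e1 (.seq e2 (.seq he' e3)))), by simp, fun v hv => ?_⟩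
  · omega
  · rw [Function.update_of_ne (by omega), hf' v (by omega), Function.update_of_ne (by omega),
      Function.update_of_ne (by omega), hf v (by omega), Function.update_of_ne (by omega)]

theorem Runs.ite {c p q : Prog} {N : ℕ} {i f o r u : Data} {A B C : ℕ} (hN : 0 < N)
    (hc : Runs c N i A f) (h : Runs p N i B o) (h' : Runs q N i C r) (h1 : f = .nil → r = u)
    (h2 : f ≠ .nil → o = u) :
    Runs (.seq (.assign N (.var 0)) (.seq c (.cond (.var 0) (.seq (.assign 0 (.var N)) p)
      (.seq (.assign 0 (.var N)) q)))) (N + 1) i (A + B + C + 3) u := fun s hs => by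
  obtain ⟨t, s1, ht, he, ho, hf⟩ := hc (Function.update s N i) (by
    rw [Function.update_of_ne (by omega), hs])
  have e0 := Exec.assign N (.var 0) s
  simp only [Tm.eval, Tm.cost] at e0
  rw [hs] at e0
  have e2 := Exec.assign 0 (.var N) s1
  have hN1 : s1 N = i := by rw [hf N le_rfl, Function.update_self]
  simp only [Tm.eval, Tm.cost] at e2
  rw [hN1] at e2
  by_cases hfn : f = .nil
  · rw [← h1 hfn]
    obtain ⟨t', s2, ht', he', ho', hf'⟩ := h' (Function.update s1 0 i) (by simp)
    refine ⟨_, _, ?_, .seq e0 (.seq he (.cond_false (ho.trans hfn) (.seq e2 he'))), ho',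
      fun v hv => ?_⟩
    · simp only [Tm.cost]; omega
    · rw [hf' v (by omega), Function.update_of_ne (by omega), hf v (by omega),
        Function.update_of_ne (by omega)]
  · rw [← h2 hfn]
    obtain ⟨t', s2, ht', he', ho', hf'⟩ := h (Function.update s1 0 i) (by simp)
    refine ⟨_, _, ?_, .seq e0 (.seq he (.cond_true (by simpa [Tm.eval, ho] using hfn)
      (.seq e2 he'))), ho', fun v hv => ?_⟩
    · simp only [Tm.cost]; omega
    · rw [hf' v (by omega), Function.update_of_ne (by omega), hf v (by omega),
        Function.update_of_ne (by omega)]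

theorem Runs.loop {p : Prog} {N B : ℕ} (n : ℕ) : ∀ (st : ℕ → Data),
    (∀ j < n, (st j).hd ≠ .nil) → (st n).hd = .nil → (∀ j < n, Runs p N (st j) B (st (j + 1))) →
      Runs (.loop (.hd (.var 0)) p) N (st 0) (n * (B + 2) + 2) (st n) := by
  induction n with
  | zero =>
    intro st _ hn _ s hs
    exact ⟨_, s, by simp [Tm.cost], Exec.loop_stop (by simpa [Tm.eval, hs] using hn), hs,
      fun _ _ => rfl⟩
  | succ n ih =>
    intro st h1 h2 h3 s hs
    obtain ⟨t, s1, ht, he, ho, hf⟩ := h3 0 (by omega) s hs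
    obtain ⟨t', s2, ht', he', ho', hf'⟩ := ih (fun j => st (j + 1)) (fun j hj => h1 _ (by omega))
      h2 (fun j hj => h3 _ (by omega)) s1 ho
    refine ⟨_, s2, ?_, .loop_step (by simpa [Tm.eval, hs] using h1 0 (by omega)) he he', ho',
      fun v hv => (hf' v hv).trans (hf v hv)⟩
    simp only [Tm.cost]
    rw [Nat.succ_mul]
    omega

/-- Reset the variables `1, …, n`. -/
def clearVars : ℕ → Prog
  | 0 => .assign 0 (.var 0)
  | n + 1 => .seq (clearVars n) (.assign (n + 1) .nil)

theorem exec_clearVars (n : ℕ) (s : Store) :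
    Exec (clearVars n) s (n + 1) (fun v => if 1 ≤ v ∧ v ≤ n then .nil else s v) := by
  induction n with
  | zero =>
    have h : (fun v => if 1 ≤ v ∧ v ≤ 0 then .nil else s v) =
        Function.update s 0 ((Tm.var 0).eval s) := by
      funext v
      simp only [Tm.eval, Function.update_eq_self]
      rw [if_neg (by omega)]
    rw [h]
    exact .assign 0 (.var 0) s
  | succ n ih =>
    have h : (fun v => if 1 ≤ v ∧ v ≤ n + 1 then .nil else s v) =
        Function.update (fun v => if 1 ≤ v ∧ v ≤ n then .nil else s v) (n + 1)
          (Tm.nil.eval fun v => if 1 ≤ v ∧ v ≤ n then .nil else s v) := by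
      funext v
      simp only [Tm.eval]
      by_cases hv : v = n + 1
      · subst hv; simp
      · rw [Function.update_of_ne hv]
        exact if_congr (by omega) rfl rfl
    rw [h]
    exact .seq ih (.assign (n + 1) .nil _)

/-- A program can be made independent of the garbage in its work variables. -/
theorem exists_runs_of_outputsWithin (G : Prog) : ∃ (p : Prog) (N K : ℕ), 0 < N ∧
    ∀ (i : Data) (B : ℕ) (o : Data), OutputsWithin G i B o → Runs p N i (B + K) o := by
  refine ⟨.seq (clearVars (G.varBound + 1)) G, G.varBound + 2, G.varBound + 2, by omega,
    fun i B o ⟨t, ht, s', he, ho⟩ s hs => ?_⟩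
  obtain ⟨r', h1, h2, h3⟩ := he.congr (N := G.varBound + 1) (by omega)
    (fun v => if 1 ≤ v ∧ v ≤ G.varBound + 1 then .nil else s v) (fun v hv => by
      rcases Nat.eq_zero_or_pos v with rfl | hv0
      · simp [hs]
      · rw [Function.update_of_ne (by omega), if_pos (by omega)])
  refine ⟨_, r', ?_, .seq (exec_clearVars _ s) h1, (h2 0 (by omega)).trans ho, fun v hv => ?_⟩
  · omega
  · rw [h3 v (by omega), if_neg (by omega)]

/-- A program can be made to clean up its work variables. -/
theorem exists_exec_of_runs (p : Prog) (N : ℕ) : ∃ (R : Prog) (K : ℕ),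
    ∀ (i : Data) (B : ℕ) (o : Data), Runs p N i B o → ∃ t ≤ B + K,
      Exec R (Function.update (fun _ => .nil) 0 i) t (Function.update (fun _ => .nil) 0 o) := by
  refine ⟨.seq p (clearVars N), N + 1, fun i B o h => ?_⟩
  obtain ⟨t, s', ht, he, ho, hf⟩ := h (Function.update (fun _ => .nil) 0 i) (by simp)
  refine ⟨t + (N + 1), by omega, ?_⟩
  convert Exec.seq he (exec_clearVars N s') using 1
  funext v
  rcases Nat.eq_zero_or_pos v with rfl | hv
  · simp [ho]
  · rw [Function.update_of_ne (by omega)]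
    split_ifs with h
    · rfl
    · rw [hf v (by omega), Function.update_of_ne (by omega)]

/-! ## Encodings as a type class -/

/-- Types whose elements are represented by trees. -/
class Enc (α : Type) where
  enc : α → Data

open ModCSP.Enc (enc)

instance : Enc Unit := ⟨fun _ => .nil⟩
instance : Enc ℕ := ⟨encNat⟩
instance : Enc Bool := ⟨encBool⟩
instance {α β : Type} [Enc α] [Enc β] : Enc (α × β) := ⟨fun a => .cons (enc a.1) (enc a.2)⟩
instance {α : Type} [Enc α] : Enc (List α) := ⟨fun l => encList (l.map enc)⟩

/-- A unary number and a list of units are the same tree, so loops over numbers are folds over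
lists. -/
theorem encNat_eq_encList (n : ℕ) : encNat n = encList ((List.replicate n ()).map enc) := by
  induction n with
  | zero => rfl
  | succ n ih => simp only [encNat, ih, List.replicate_succ, List.map_cons]; rfl

/-! ## Polynomial growth and polynomial time -/

variable {ι κ α β γ δ : Type}

/-- The function `f` is polynomially bounded in terms of `b`. -/
def PolyBdd (b f : ι → ℕ) : Prop := ∃ K k : ℕ, ∀ i, f i ≤ K * (b i + 1) ^ k

namespace PolyBdd

variable {b f g : ι → ℕ}

theorem of_le (hg : PolyBdd b g) (h : ∀ i, f i ≤ g i) : PolyBdd b f := by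
  obtain ⟨K, k, hK⟩ := hg
  exact ⟨K, k, fun i => (h i).trans (hK i)⟩

theorem self : PolyBdd b b := ⟨1, 1, fun i => by simp⟩

theorem const (c : ℕ) : PolyBdd b (fun _ => c) := ⟨c, 0, fun i => by simp⟩

theorem add (hf : PolyBdd b f) (hg : PolyBdd b g) : PolyBdd b (fun i => f i + g i) := by
  obtain ⟨K, k, hK⟩ := hf
  obtain ⟨L, l, hL⟩ := hg
  refine ⟨K + L, k + l, fun i => (Nat.add_le_add (hK i) (hL i)).trans ?_⟩
  rw [add_mul]
  gcongr <;> omega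

theorem mul (hf : PolyBdd b f) (hg : PolyBdd b g) : PolyBdd b (fun i => f i * g i) := by
  obtain ⟨K, k, hK⟩ := hf
  obtain ⟨L, l, hL⟩ := hg
  refine ⟨K * L, k + l, fun i => (Nat.mul_le_mul (hK i) (hL i)).trans (le_of_eq ?_)⟩
  rw [pow_add]; ring

theorem comp {r : κ → ι} (h : PolyBdd b f) : PolyBdd (fun j => b (r j)) (fun j => f (r j)) := by
  obtain ⟨K, k, hK⟩ := h
  exact ⟨K, k, fun i => hK _⟩

theorem trans {c : ι → ℕ} (h : PolyBdd b f) (hb : PolyBdd c b) : PolyBdd c f := by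
  obtain ⟨K, k, hK⟩ := h
  obtain ⟨L, l, hL⟩ := hb
  refine ⟨K * (L + 1) ^ k, l * k, fun i => (hK i).trans ?_⟩
  rw [pow_mul, mul_assoc, ← mul_pow, add_mul, one_mul]
  gcongr
  · exact hL i
  · exact Nat.one_le_pow _ _ (by omega)

theorem succ (hf : PolyBdd b f) : PolyBdd b (fun i => f i + 1) := hf.add (const 1)

theorem pow (hf : PolyBdd b f) : ∀ k : ℕ, PolyBdd b (fun i => f i ^ k)
  | 0 => (const 1).of_le fun i => by simp
  | k + 1 => ((hf.pow k).mul hf).of_le fun i => (pow_succ _ _).le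

end PolyBdd

/-- The map `x i ↦ y i` is computed in time `O((b i + 1) ^ k)`. -/
def PTimeE (k : ℕ) [Enc α] [Enc β] (b : ι → ℕ) (x : ι → α) (y : ι → β) : Prop :=
  ∃ (p : Prog) (N K : ℕ), 0 < N ∧ ∀ i, Runs p N (enc (x i)) (K * (b i + 1) ^ k) (enc (y i))

/-- The map `x i ↦ y i` is computed in time polynomial in `b i`. -/
def PTime [Enc α] [Enc β] (b : ι → ℕ) (x : ι → α) (y : ι → β) : Prop := ∃ k, PTimeE k b x y

/-- The positions in a family of lists. -/
structure ListPos (l : ι → List β) where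
  i : ι
  pre : List β
  a : β
  post : List β
  eq : l i = pre ++ a :: post

theorem ListPos.mem {l : ι → List β} (j : ListPos l) : j.a ∈ l j.i := by rw [j.eq]; simp

section

variable [Enc α] [Enc β] [Enc γ] [Enc δ] {b : ι → ℕ} {x : ι → α} {y : ι → β} {z : ι → γ} {k : ℕ}

theorem le_mul_pow_succ (c n k : ℕ) : c ≤ c * (n + 1) ^ k :=
  Nat.le_mul_of_pos_right _ (Nat.pow_pos (Nat.succ_pos n))

theorem PTimeE.mono {l : ℕ} (h : PTimeE k b x y) (hkl : k ≤ l) : PTimeE l b x y := by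
  obtain ⟨p, N, K, hN, h⟩ := h
  exact ⟨p, N, K, hN, fun i => (h i).mono le_rfl (by gcongr; omega)⟩

theorem PTimeE.reindex (h : PTimeE k b x y) (r : κ → ι) :
    PTimeE k (fun j => b (r j)) (fun j => x (r j)) (fun j => y (r j)) := by
  obtain ⟨p, N, K, hN, h⟩ := h
  exact ⟨p, N, K, hN, fun i => h _⟩

theorem PTimeE.comp (h : PTimeE k b x y) (h' : PTimeE k b y z) : PTimeE k b x z := by
  obtain ⟨p, N, K, hN, h⟩ := h
  obtain ⟨p', N', K', _, h'⟩ := h'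
  exact ⟨.seq p p', max N N', K + K', by omega, fun i => add_mul K K' _ ▸
    ((h i).mono (le_max_left _ _) le_rfl).seq ((h' i).mono (le_max_right _ _) le_rfl)⟩

theorem PTimeE.pair (h : PTimeE k b x y) (h' : PTimeE k b x z) :
    PTimeE k b x (fun i => (y i, z i)) := by
  obtain ⟨p, N, K, hN, h⟩ := h
  obtain ⟨p', N', K', _, h'⟩ := h'
  refine ⟨_, _, K + K' + 6, by omega, fun i => (Runs.pair (N := max N N') (by omega)
    ((h i).mono (le_max_left _ _) le_rfl) ((h' i).mono (le_max_right _ _) le_rfl)).mono le_rfl ?_⟩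
  have := le_mul_pow_succ 6 (b i) k
  rw [add_mul, add_mul]
  omega

theorem PTimeE.expr (e : Tm) (he : e.varBound ≤ 1)
    (h : ∀ i, e.eval (fun _ => enc (x i)) = enc (y i)) : PTimeE k b x y :=
  ⟨.assign 0 e, 1, e.cost, one_pos, fun i => h i ▸
    (Runs.expr e he _).mono le_rfl (le_mul_pow_succ _ _ _)⟩

theorem PTimeE.id : PTimeE k b x x := .expr (.var 0) (by simp [Tm.varBound]) fun _ => rfl

theorem PTimeE.fst (h : PTimeE k b x (fun i => (y i, z i))) : PTimeE k b x y :=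
  h.comp (.expr (.hd (.var 0)) (by simp [Tm.varBound]) fun _ => rfl)

theorem PTimeE.snd (h : PTimeE k b x (fun i => (y i, z i))) : PTimeE k b x z :=
  h.comp (.expr (.tl (.var 0)) (by simp [Tm.varBound]) fun _ => rfl)

/-- The expression denoting a given tree. -/
def Data.toTm : Data → Tm
  | .nil => .nil
  | .cons a b => .cons a.toTm b.toTm

theorem Data.varBound_toTm : ∀ d : Data, d.toTm.varBound = 0
  | .nil => rfl
  | .cons a b => by simp [Data.toTm, Tm.varBound, a.varBound_toTm, b.varBound_toTm]

theorem Data.eval_toTm (s : Store) : ∀ d : Data, d.toTm.eval s = d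
  | .nil => rfl
  | .cons a b => by simp [Data.toTm, Tm.eval, a.eval_toTm, b.eval_toTm]

theorem PTimeE.const (c : β) : PTimeE k b x (fun _ => c) :=
  .expr (enc c).toTm (by simp [Data.varBound_toTm]) fun i => Data.eval_toTm _ _

namespace PTime

theorem reindex (h : PTime b x y) (r : κ → ι) :
    PTime (fun j => b (r j)) (fun j => x (r j)) (fun j => y (r j)) :=
  ⟨_, h.choose_spec.reindex r⟩

theorem comp (h : PTime b x y) (h' : PTime b y z) : PTime b x z := by
  obtain ⟨k, h⟩ := h
  obtain ⟨l, h'⟩ := h'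
  exact ⟨max k l, (h.mono (le_max_left _ _)).comp (h'.mono (le_max_right _ _))⟩

theorem pair (h : PTime b x y) (h' : PTime b x z) : PTime b x (fun i => (y i, z i)) := by
  obtain ⟨k, h⟩ := h
  obtain ⟨l, h'⟩ := h'
  exact ⟨max k l, (h.mono (le_max_left _ _)).pair (h'.mono (le_max_right _ _))⟩

theorem id : PTime b x x := ⟨0, .id⟩

theorem const (c : β) : PTime b x (fun _ => c) := ⟨0, .const c⟩

theorem expr (e : Tm) (he : e.varBound ≤ 1)
    (h : ∀ i, e.eval (fun _ => enc (x i)) = enc (y i)) : PTime b x y := ⟨0, .expr e he h⟩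

theorem fst (h : PTime b x (fun i => (y i, z i))) : PTime b x y := ⟨_, h.choose_spec.fst⟩

theorem snd (h : PTime b x (fun i => (y i, z i))) : PTime b x z := ⟨_, h.choose_spec.snd⟩

theorem proj_fst {p : ι → β × γ} (h : PTime b x p) : PTime b x (fun i => (p i).1) :=
  fst (z := fun i => (p i).2) h

theorem proj_snd {p : ι → β × γ} (h : PTime b x p) : PTime b x (fun i => (p i).2) :=
  snd (y := fun i => (p i).1) h

/-- The representation is all that matters. -/
theorem cast (h : PTime b x y) (hyz : ∀ i, enc (y i) = enc (z i)) : PTime b x z := by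
  obtain ⟨k, p, N, K, hN, h⟩ := h
  exact ⟨k, p, N, K, hN, fun i => hyz i ▸ h i⟩

theorem congr {y' : ι → β} (h : PTime b x y) (hyz : ∀ i, y i = y' i) : PTime b x y' :=
  h.cast fun i => by rw [hyz]

theorem mono {c : ι → ℕ} (h : PTime b x y) (hb : PolyBdd c b) : PTime c x y := by
  obtain ⟨k, p, N, K, hN, h⟩ := h
  obtain ⟨L, l, hL⟩ := (PolyBdd.trans (f := fun i => K * (b i + 1) ^ k) ⟨K, k, fun _ => le_rfl⟩ hb)
  exact ⟨l, p, N, L, hN, fun i => (h i).mono le_rfl (hL i)⟩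

theorem cons {a : ι → β} {l : ι → List β} (h : PTime b x a) (h' : PTime b x l) :
    PTime b x (fun i => a i :: l i) := (h.pair h').cast fun _ => rfl

theorem tail {l : ι → List β} (h : PTime b x l) : PTime b x (fun i => (l i).tail) :=
  h.comp (.expr (.tl (.var 0)) (by simp [Tm.varBound]) fun i => by
    simp only [Tm.eval]; cases l i <;> rfl)

theorem head {a : ι → β} {l : ι → List β} (h : PTime b x (fun i => a i :: l i)) : PTime b x a :=
  h.comp (.expr (.hd (.var 0)) (by simp [Tm.varBound]) fun i => rfl)

theorem succ {n : ι → ℕ} (h : PTime b x n) : PTime b x (fun i => n i + 1) :=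
  ((const ()).pair h).cast fun _ => rfl

theorem pred {n : ι → ℕ} (h : PTime b x n) : PTime b x (fun i => n i - 1) :=
  h.comp (.expr (.tl (.var 0)) (by simp [Tm.varBound]) fun i => by
    simp only [Tm.eval]; cases n i <;> rfl)

theorem ite {c : ι → Bool} {y z : ι → β} (hc : PTime b x c) (h : PTime b x y)
    (h' : PTime b x z) : PTime b x (fun i => if c i then y i else z i) := by
  obtain ⟨k1, hc⟩ := hc
  obtain ⟨k2, h⟩ := h
  obtain ⟨k3, h'⟩ := h'
  obtain ⟨c', N1, K1, hN, hc⟩ := hc.mono (show k1 ≤ k1 + k2 + k3 by omega)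
  obtain ⟨p, N2, K2, _, h⟩ := h.mono (show k2 ≤ k1 + k2 + k3 by omega)
  obtain ⟨q, N3, K3, _, h'⟩ := h'.mono (show k3 ≤ k1 + k2 + k3 by omega)
  refine ⟨k1 + k2 + k3, _, _, K1 + K2 + K3 + 3, by omega, fun i =>
    (Runs.ite (N := N1 + N2 + N3) (u := enc (if c i then y i else z i)) (by omega)
      ((hc i).mono (by omega) le_rfl) ((h i).mono (by omega) le_rfl)
      ((h' i).mono (by omega) le_rfl) (fun hf => ?_) (fun hf => ?_)).mono le_rfl ?_⟩
  · cases hci : c i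
    · rfl
    · rw [hci] at hf; cases hf
  · cases hci : c i
    · rw [hci] at hf; exact absurd rfl hf
    · rfl
  · have := le_mul_pow_succ 3 (b i) (k1 + k2 + k3)
    rw [add_mul, add_mul, add_mul]
    omega

theorem isNonempty {l : ι → List β} (h : PTime b x l) : PTime b x (fun i => !(l i).isEmpty) := by
  obtain ⟨k1, h⟩ := h
  obtain ⟨c', N1, K1, hN, hc⟩ := h
  refine ⟨k1, _, _, K1 + 7, by omega, fun i =>
    (Runs.ite (N := N1) (u := enc (!(l i).isEmpty)) (by omega) (hc i)
      ((Runs.expr (encBool true).toTm (by simp [Data.varBound_toTm]) _).mono (by omega) le_rfl)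
      ((Runs.expr (encBool false).toTm (by simp [Data.varBound_toTm]) _).mono
        (by omega) le_rfl) (fun hf => ?_) (fun hf => ?_)).mono le_rfl ?_⟩
  · rw [Data.eval_toTm]
    cases hl : l i
    · rfl
    · rw [hl] at hf; cases hf
  · rw [Data.eval_toTm]
    cases hl : l i
    · rw [hl] at hf; exact absurd rfl hf
    · rfl
  · have := le_mul_pow_succ 7 (b i) k1
    simp only [encBool, Data.toTm, Tm.cost]
    rw [add_mul]
    omega

/-- Iteration of a step that is computed in polynomial time; the left component of the state is the
test. -/
theorem iterate (N : ι → ℕ) (st : ι → ℕ → β) (hN : PolyBdd b N)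
    (hrun : ∀ i, ∀ j < N i, (enc (st i j)).hd ≠ .nil) (hend : ∀ i, (enc (st i (N i))).hd = .nil)
    (body : PTime (fun j : {j : ι × ℕ // j.2 < N j.1} => b j.1.1) (fun j => st j.1.1 j.1.2)
      (fun j => st j.1.1 (j.1.2 + 1))) :
    PTime b (fun i => st i 0) (fun i => st i (N i)) := by
  obtain ⟨K, k, hN⟩ := hN
  obtain ⟨l, p, V, L, hV, h⟩ := body
  refine ⟨k + l, _, V, K * (L + 2) + 2, hV, fun i => (Runs.loop (N i) (fun j => enc (st i j))
    (B := L * (b i + 1) ^ l) (hrun i) (hend i) (fun j hj => h ⟨(i, j), hj⟩)).mono le_rfl ?_⟩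
  have h1 := le_mul_pow_succ 2 (b i) (k + l)
  have h2 := le_mul_pow_succ 2 (b i) l
  calc N i * (L * (b i + 1) ^ l + 2) + 2
      ≤ K * (b i + 1) ^ k * (L * (b i + 1) ^ l + 2 * (b i + 1) ^ l) + 2 * (b i + 1) ^ (k + l) := by
        gcongr
        exact hN i
    _ = _ := by rw [pow_add]; ring

end PTime

/-! ### Folds over lists and search in polynomial time -/

namespace PTime

/-- The loop state is the remaining list, the accumulator and the original input, which the body may
consult. Indexing the body by `ListPos` restricts it to accumulators that actually arise from a
prefix, so size bounds are needed for those only. -/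
theorem foldl {l : ι → List β} {a0 : ι → γ} {g : ι → γ → β → γ} (hlen : PolyBdd b fun i => (l i).length)
    (hl : PTime b x l) (h0 : PTime b x a0)
    (body : PTime (fun j : ListPos l => b j.i)
      (fun j => (x j.i, (j.pre.foldl (g j.i) (a0 j.i), j.a)))
      (fun j => g j.i (j.pre.foldl (g j.i) (a0 j.i)) j.a)) :
    PTime b x (fun i => (l i).foldl (g i) (a0 i)) := by
  have key := iterate (b := b) (fun i => (l i).length)
    (fun i j => ((l i).drop j, (((l i).take j).foldl (g i) (a0 i), x i))) hlen ?_ ?_ ?_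
  · have := (hl.pair (h0.pair id)).comp (key.cast fun _ => rfl)
    refine (this.snd.fst).congr fun i => ?_
    simp
  · intro i j hj
    rw [List.drop_eq_getElem_cons hj]
    exact Data.noConfusion
  · intro i
    simp [enc, Data.hd, encList]
  · let r : {j : ι × ℕ // j.2 < (l j.1).length} → ListPos l := fun j =>
      ⟨j.1.1, (l j.1.1).take j.1.2, (l j.1.1)[j.1.2]'j.2, (l j.1.1).drop (j.1.2 + 1), by
        simp⟩
    have hb := body.reindex r
    have h1 : PTime (fun j : {j : ι × ℕ // j.2 < (l j.1).length} => b j.1.1)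
        (fun j => ((l j.1.1).drop j.1.2,
          (((l j.1.1).take j.1.2).foldl (g j.1.1) (a0 j.1.1), x j.1.1)))
        (fun j => ((r j).a :: (r j).post,
          (((l j.1.1).take j.1.2).foldl (g j.1.1) (a0 j.1.1), x j.1.1))) :=
      id.cast fun j => by rw [List.drop_eq_getElem_cons j.2]
    have h2 := (h1.snd.snd.pair (h1.snd.fst.pair h1.fst.head)).comp hb
    refine (h1.fst.tail.pair (h2.pair h1.snd.snd)).congr fun j => ?_
    rw [List.take_succ_eq_append_getElem j.2, List.foldl_append]
    rfl

/-- Search for the first number with a given property. -/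
theorem find {N : ι → ℕ} {P : ι → ℕ → Bool} (hN : PolyBdd b N) (hP : ∀ i, P i (N i) = true)
    (hlt : ∀ i, ∀ j < N i, P i j = false)
    (body : PTime (fun j : {j : ι × ℕ // j.2 ≤ N j.1} => b j.1.1) (fun j => (x j.1.1, j.1.2))
      (fun j => P j.1.1 j.1.2)) : PTime b x N := by
  -- The negated test stands in front of the state, so the loop runs as long as the property fails.
  -- The test is also evaluated at the final number, whence j ≤ N in the hypothesis on the body.
  have key := iterate (b := b) N (fun i j => (!P i j, (x i, j))) hN ?_ ?_ ?_
  · have h0 : PTime b x (fun i => (!P i 0, (x i, 0))) := by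
      have hb := body.reindex (κ := ι) fun i => ⟨(i, 0), Nat.zero_le _⟩
      have hx : PTime b x (fun i => (x i, 0)) := id.pair (const 0)
      exact (((hx.comp hb).ite (const false) (const true)).pair hx).congr fun i => by
        cases P i 0 <;> rfl
    exact (h0.comp key).snd.snd
  · intro i j hj
    simp [enc, hlt i j hj, encBool, Data.hd]
  · intro i
    simp [enc, hP, encBool, Data.hd]
  · have h1 : PTime (fun j : {j : ι × ℕ // j.2 < N j.1} => b j.1.1)
        (fun j => (!P j.1.1 j.1.2, (x j.1.1, j.1.2)))
        (fun j => (x j.1.1, j.1.2 + 1)) := id.snd.fst.pair id.snd.snd.succ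
    have h2 := body.reindex (κ := {j : ι × ℕ // j.2 < N j.1}) fun j => ⟨(j.1.1, j.1.2 + 1), j.2⟩
    exact (((h1.comp h2).ite (const false) (const true)).pair h1).congr fun j => by
      cases P j.1.1 (j.1.2 + 1) <;> rfl

end PTime

end

/-! ## Arithmetic and lists in polynomial time -/

section

variable [Enc α] [Enc β] [Enc γ] [Enc δ] {b : ι → ℕ} {x : ι → α} {y : ι → β} {z : ι → γ}

namespace PTime

/-- Computations in an extended context. -/
theorem lift {w : κ → δ} (h : PTime b x y) (r : κ → ι) :
    PTime (fun j => b (r j)) (fun j => (x (r j), w j)) (fun j => y (r j)) :=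
  id.fst.comp (h.reindex r)

theorem units {n : ι → ℕ} (h : PTime b x n) : PTime b x (fun i => List.replicate (n i) ()) :=
  h.cast fun _ => encNat_eq_encList _

/-- Primitive recursion. -/
theorem natRec {n : ι → ℕ} {st : ι → ℕ → β} (hb : PolyBdd b n) (hn : PTime b x n)
    (h0 : PTime b x (fun i => st i 0))
    (body : PTime (fun j : {j : ι × ℕ // j.2 < n j.1} => b j.1.1)
      (fun j => (x j.1.1, (j.1.2, st j.1.1 j.1.2))) (fun j => st j.1.1 (j.1.2 + 1))) :
    PTime b x (fun i => st i (n i)) := by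
  -- The fold carries a counter along, since the elements of a list of units do not show their
  -- position.
  have key := foldl (x := x) (l := fun i => List.replicate (n i) ()) (a0 := fun i => (0, st i 0))
    (g := fun i p _ => (p.1 + 1, st i (p.1 + 1))) (by simpa using hb) hn.units
    ((const 0).pair h0) ?_
  · refine key.snd.congr fun i => ?_
    have : ∀ k, (List.replicate k ()).foldl (fun p _ => (p.1 + 1, st i (p.1 + 1)))
        ((0, st i 0) : ℕ × β) = (k, st i k) := fun k => by
      induction k with
      | zero => rfl
      | succ k ih => rw [List.replicate_succ', List.foldl_append, ih]; rfl
    rw [this]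
  · have hpre : ∀ j : ListPos (fun i : ι => List.replicate (n i) ()), j.pre.length < n j.i := by
      intro j
      have := congrArg List.length j.eq
      simp at this
      omega
    have hst : ∀ (i : ι) (l : List Unit), l.foldl (fun p _ => (p.1 + 1, st i (p.1 + 1)))
        ((0, st i 0) : ℕ × β) = (l.length, st i l.length) := fun i l => by
      induction l using List.reverseRecOn with
      | nil => rfl
      | append_singleton l a ih => rw [List.foldl_append, ih]; simp
    simp only [hst]
    have hb := body.reindex fun j : ListPos (fun i : ι => List.replicate (n i) ()) =>
      ⟨(j.i, j.pre.length), hpre j⟩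
    exact id.snd.fst.fst.succ.pair ((id.fst.pair id.snd.fst).comp hb)

section Nat

variable {m n : ι → ℕ}

theorem add (hb : PolyBdd b n) (hm : PTime b x m) (hn : PTime b x n) :
    PTime b x (fun i => m i + n i) :=
  natRec (st := fun i k => m i + k) hb hn hm id.snd.snd.succ

theorem sub (hb : PolyBdd b n) (hm : PTime b x m) (hn : PTime b x n) :
    PTime b x (fun i => m i - n i) :=
  natRec (st := fun i k => m i - k) hb hn hm (id.snd.snd.pred.congr fun _ => Nat.sub_sub _ _ _)

theorem mul (hbm : PolyBdd b m) (hb : PolyBdd b n) (hm : PTime b x m) (hn : PTime b x n) :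
    PTime b x (fun i => m i * n i) :=
  natRec (st := fun i k => m i * k) hb hn (const 0)
    ((add (hbm.comp (r := fun j : {j : ι × ℕ // j.2 < n j.1} => j.1.1))
      id.snd.snd (hm.lift _)).congr fun _ => (Nat.mul_succ _ _).symm)

theorem not {c : ι → Bool} (h : PTime b x c) : PTime b x (fun i => !(c i)) :=
  (h.ite (const false) (const true)).congr fun i => by cases c i <;> rfl

theorem and {c d : ι → Bool} (h : PTime b x c) (h' : PTime b x d) :
    PTime b x (fun i => c i && d i) :=
  (h.ite h' (const false)).congr fun i => by cases c i <;> rfl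

theorem lt (hb : PolyBdd b m) (hm : PTime b x m) (hn : PTime b x n) :
    PTime b x (fun i => decide (m i < n i)) :=
  (sub hb hn hm).units.isNonempty.congr fun i => by
    by_cases h : m i < n i
    · obtain ⟨k, hk⟩ : ∃ k, n i - m i = k + 1 := ⟨n i - m i - 1, by omega⟩
      simp [h, hk, List.replicate_succ]
    · have : n i - m i = 0 := by omega
      simp [h, this]

theorem le (hb : PolyBdd b n) (hm : PTime b x m) (hn : PTime b x n) :
    PTime b x (fun i => decide (m i ≤ n i)) :=
  (lt hb hn hm).not.congr fun i => by
    by_cases h : m i ≤ n i <;> simp [h]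
    omega

theorem beq (hbm : PolyBdd b m) (hb : PolyBdd b n) (hm : PTime b x m) (hn : PTime b x n) :
    PTime b x (fun i => m i == n i) :=
  ((le hb hm hn).and (le hbm hn hm)).congr fun i => by
    by_cases h : m i = n i
    · simp [h]
    · rw [beq_eq_false_iff_ne.2 h, Bool.and_eq_false_iff]
      simp only [decide_eq_false_iff_not]
      omega

theorem max (hb : PolyBdd b n) (hm : PTime b x m) (hn : PTime b x n) :
    PTime b x (fun i => max (m i) (n i)) :=
  ((le hb hm hn).ite hn hm).congr fun i => by
    by_cases h : m i ≤ n i <;> simp [h]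
    omega

/-- The remainder is found by counting up to m and returning to 0 whenever n is reached. -/
theorem mod (hbm : PolyBdd b m) (hb : PolyBdd b n) (hm : PTime b x m) (hn : PTime b x n) :
    PTime b x (fun i => m i % n i) := by
  refine natRec (st := fun i k => k % n i) hbm hm ((const 0).congr fun i => by simp) ?_
  let r := fun j : {j : ι × ℕ // j.2 < m j.1} => j.1.1
  have h1 := beq (x := fun j : {j : ι × ℕ // j.2 < m j.1} => (x j.1.1, (j.1.2, j.1.2 % n j.1.1)))
    (b := fun j => b j.1.1)
    (((hbm.comp (r := r)).add (PolyBdd.const 1)).of_le fun j => by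
      have := Nat.mod_le j.1.2 (n j.1.1)
      have := j.2
      simp only [r]
      omega) (hb.comp (r := r)) id.snd.snd.succ (hn.lift _)
  refine (h1.ite (const 0) id.snd.snd.succ).congr fun j => ?_
  simp only [r]
  rcases Nat.eq_zero_or_pos (n j.1.1) with h | h
  · simp [h]
  · have hlt := Nat.mod_lt j.1.2 h
    rw [← Nat.mod_add_mod]
    by_cases h2 : j.1.2 % n j.1.1 + 1 = n j.1.1
    · rw [if_pos (by simpa using h2), h2, Nat.mod_self]
    · rw [if_neg (by simpa using h2), Nat.mod_eq_of_lt (show j.1.2 % n j.1.1 + 1 < n j.1.1 by omega)]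

theorem div (hbm : PolyBdd b m) (hb : PolyBdd b n) (hm : PTime b x m) (hn : PTime b x n) :
    PTime b x (fun i => m i / n i) := by
  refine natRec (st := fun i k => k / n i) hbm hm ((const 0).congr fun i => by simp) ?_
  let r := fun j : {j : ι × ℕ // j.2 < m j.1} => j.1.1
  have h0 := mod (x := fun j : {j : ι × ℕ // j.2 < m j.1} => (x j.1.1, (j.1.2, j.1.2 / n j.1.1)))
    (b := fun j => b j.1.1) ((hbm.comp (r := r)).of_le fun j => show j.1.2 + 1 ≤ _ from j.2)
    (hb.comp (r := r)) id.snd.fst.succ (hn.lift _)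
  have h1 := beq ((hbm.comp (r := r)).of_le fun j =>
    (Nat.mod_le _ _).trans (show j.1.2 + 1 ≤ _ from j.2)) (PolyBdd.const 0) h0 (const 0)
  refine (h1.ite id.snd.snd.succ id.snd.snd).congr fun j => ?_
  rw [Nat.succ_div]
  by_cases h : n j.1.1 ∣ j.1.2 + 1
  · rw [if_pos h, if_pos (by simpa using Nat.mod_eq_zero_of_dvd h)]
  · rw [if_neg h, if_neg (by simpa [Nat.dvd_iff_mod_eq_zero] using h), add_zero]

/-- The bound on (m + 1)^n controls all intermediate powers m^k, also for m = 0, where m^0 can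
exceed m^n. -/
theorem pow (hbm : PolyBdd b m) (hb : PolyBdd b n) (hmn : PolyBdd b fun i => (m i + 1) ^ n i)
    (hm : PTime b x m) (hn : PTime b x n) : PTime b x (fun i => m i ^ n i) := by
  refine natRec (st := fun i k => m i ^ k) hb hn (const 1) ?_
  let r := fun j : {j : ι × ℕ // j.2 < n j.1} => j.1.1
  refine (mul (b := fun j => b (r j)) ((hmn.comp (r := r)).of_le fun j => ?_)
    (hbm.comp (r := r)) id.snd.snd (hm.lift _)).congr fun _ => (pow_succ _ _).symm
  exact (Nat.pow_le_pow_left (Nat.le_succ _) _).trans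
    (Nat.pow_le_pow_right (Nat.succ_pos _) j.2.le)

end Nat

section List

variable {l l' : ι → List β}

theorem length (hb : PolyBdd b fun i => (l i).length) (hl : PTime b x l) :
    PTime b x (fun i => (l i).length) :=
  (foldl (g := fun _ k _ => k + 1) hb hl (const 0) id.snd.fst.succ).congr fun i => by simp

theorem reverse (hb : PolyBdd b fun i => (l i).length) (hl : PTime b x l) :
    PTime b x (fun i => (l i).reverse) :=
  (foldl (g := fun _ acc a => a :: acc) (a0 := fun _ => []) hb hl (const [])
    (id.snd.snd.cons id.snd.fst)).congr fun i => by
      simp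

theorem append (hb : PolyBdd b fun i => (l i).length) (hl : PTime b x l) (hl' : PTime b x l') :
    PTime b x (fun i => l i ++ l' i) :=
  (foldl (g := fun _ acc a => a :: acc) (by simpa using hb) (hl.reverse hb) hl'
    (id.snd.snd.cons id.snd.fst)).congr fun i => by
      simp

theorem map {f : ι → β → γ} (hb : PolyBdd b fun i => (l i).length) (hl : PTime b x l)
    (hf : PTime (fun j : ListPos l => b j.i) (fun j => (x j.i, j.a)) (fun j => f j.i j.a)) :
    PTime b x (fun i => (l i).map (f i)) := by
  have := foldl (g := fun i acc a => f i a :: acc) (a0 := fun _ => []) hb hl (const [])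
    (((id.fst.pair id.snd.snd).comp hf).cons id.snd.fst)
  have h2 : ∀ i (l : List β), l.foldl (fun acc a => f i a :: acc) [] = (l.map (f i)).reverse :=
    fun i l => by
      induction l using List.reverseRecOn with
      | nil => rfl
      | append_singleton l a ih => rw [List.foldl_append, ih]; simp
  simp only [h2] at this
  exact (this.reverse (by simpa using hb)).congr fun i => by simp

theorem filter {f : ι → β → Bool} (hb : PolyBdd b fun i => (l i).length) (hl : PTime b x l)
    (hf : PTime (fun j : ListPos l => b j.i) (fun j => (x j.i, j.a)) (fun j => f j.i j.a)) :
    PTime b x (fun i => (l i).filter (f i)) := by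
  have := foldl (g := fun i acc a => if f i a then a :: acc else acc) (a0 := fun _ => []) hb hl
    (const []) (((id.fst.pair id.snd.snd).comp hf).ite (id.snd.snd.cons id.snd.fst) id.snd.fst)
  have h2 : ∀ i (l : List β), l.foldl (fun acc a => if f i a then a :: acc else acc) [] =
      (l.filter (f i)).reverse := fun i l => by
    induction l using List.reverseRecOn with
    | nil => rfl
    | append_singleton l a ih =>
      rw [List.foldl_append, ih, List.filter_append, List.reverse_append]
      by_cases h : f i a <;> simp [h]
  simp only [h2] at this
  exact (this.reverse (hb.of_le fun i => by
    simpa using List.length_filter_le _ _)).congr fun i => by simp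

/-- The partial results are prefixes of the final one, so its length bounds the cost of every
append. -/
theorem flatMap {f : ι → β → List γ} (hb : PolyBdd b fun i => (l i).length)
    (hbf : PolyBdd b fun i => ((l i).flatMap (f i)).length) (hl : PTime b x l)
    (hf : PTime (fun j : ListPos l => b j.i) (fun j => (x j.i, j.a)) (fun j => f j.i j.a)) :
    PTime b x (fun i => (l i).flatMap (f i)) := by
  have h2 : ∀ i (l : List β), l.foldl (fun acc a => acc ++ f i a) [] = l.flatMap (f i) :=
    fun i l => by
      induction l using List.reverseRecOn with
      | nil => rfl
      | append_singleton l a ih => rw [List.foldl_append, ih]; simp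
  refine (foldl (g := fun i acc a => acc ++ f i a) (a0 := fun _ => []) hb hl (const []) ?_).congr
    fun i => h2 i _
  simp only [h2]
  refine append ((hbf.comp (r := ListPos.i)).of_le fun j => ?_) id.snd.fst
    ((id.fst.pair id.snd.snd).comp hf)
  rw [j.eq]
  simp

theorem zipIdx {n : ι → ℕ} (hb : PolyBdd b fun i => (l i).length) (hl : PTime b x l)
    (hn : PTime b x n) : PTime b x (fun i => (l i).zipIdx (n i)) := by
  have := foldl (g := fun _ p a => (p.1 + 1, (a, p.1) :: p.2)) (a0 := fun i => (n i, []))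
    hb hl (hn.pair (const [])) (id.snd.fst.fst.succ.pair
      ((id.snd.snd.pair id.snd.fst.fst).cons id.snd.fst.snd))
  have h2 : ∀ n (l : List β), l.foldl (fun p a => (p.1 + 1, (a, p.1) :: p.2)) (n, []) =
      (n + l.length, (l.zipIdx n).reverse) := fun n l => by
    induction l using List.reverseRecOn with
    | nil => rfl
    | append_singleton l a ih => rw [List.foldl_append, ih]; simp [List.zipIdx_append]; omega
  simp only [h2] at this
  exact (this.snd.reverse (by simpa using hb)).congr fun i => by simp

theorem range {n : ι → ℕ} (hb : PolyBdd b n) (hn : PTime b x n) :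
    PTime b x (fun i => List.range (n i)) :=
  natRec (st := fun _ k => List.range k) hb hn (const []) ((append ((hb.comp
    (r := fun j : {j : ι × ℕ // j.2 < n j.1} => j.1.1)).of_le fun j => by simpa using j.2.le)
      id.snd.snd (id.snd.fst.cons (const []))).congr fun _ => List.range_succ.symm)

theorem replicate {n : ι → ℕ} (hb : PolyBdd b n) (hn : PTime b x n) (hy : PTime b x y) :
    PTime b x (fun i => List.replicate (n i) (y i)) :=
  natRec (st := fun i k => List.replicate k (y i)) hb hn (const [])
    (((hy.lift fun j : {j : ι × ℕ // j.2 < n j.1} => j.1.1).cons id.snd.snd).congr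
      fun _ => List.replicate_succ.symm)

theorem drop {n : ι → ℕ} (hb : PolyBdd b n) (hn : PTime b x n) (hl : PTime b x l) :
    PTime b x (fun i => (l i).drop (n i)) :=
  natRec (st := fun i k => (l i).drop k) hb hn (hl.congr fun _ => rfl)
    (id.snd.snd.tail.congr fun _ => List.tail_drop)

theorem take {n : ι → ℕ} (hbn : PolyBdd b n) (hb : PolyBdd b fun i => (l i).length)
    (hn : PTime b x n) (hl : PTime b x l) : PTime b x (fun i => (l i).take (n i)) :=
  (reverse (hb.of_le fun i => by simp) (drop (hb.of_le fun i => Nat.sub_le _ _)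
    (sub hbn (hl.length hb) hn) (hl.reverse hb))).congr fun i => by
      rw [← List.reverse_take, List.reverse_reverse]

theorem sum {l : ι → List ℕ} (hb : PolyBdd b fun i => (l i).length)
    (hbs : PolyBdd b fun i => (l i).sum) (hl : PTime b x l) : PTime b x (fun i => (l i).sum) := by
  have h2 : ∀ (l : List ℕ), l.foldl (fun acc a => acc + a) 0 = l.sum :=
    fun l => List.sum_eq_foldl.symm
  refine (foldl (g := fun _ acc a => acc + a) (a0 := fun _ => 0) hb hl (const 0) ?_).congr
    fun i => h2 _
  refine add ((hbs.comp (r := ListPos.i)).of_le fun j => ?_) id.snd.fst id.snd.snd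
  rw [j.eq]
  simp only [List.sum_append, List.sum_cons]
  omega

end List

end PTime

end

/-! ## Weighted sums of parities -/

/-- A literal; `(v, true)` is the variable `v` and `(v, false)` its negation. -/
abbrev Lit : Type := ℕ × Bool

/-- A weighted parity `c * ∏ v, (-1) ^ (y v)`. -/
abbrev WTerm : Type := ℕ × List ℕ

/-- The sign `∏ v, (-1) ^ (y v)`. -/
def sgn (y : ℕ → Bool) (vs : List ℕ) : ℤ := (vs.map fun v => if y v then -1 else 1).prod

/-- The value modulo `M` of a weighted sum of parities. -/
def tval (M : ℕ) (y : ℕ → Bool) (L : List WTerm) : ZMod M :=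
  (L.map fun t => (t.1 : ZMod M) * (sgn y t.2 : ZMod M)).sum

/-- Multiplication by `1 ± (-1) ^ (y v)`, which is `2` if the literal is false and `0` if not. -/
def mulLit (M : ℕ) (L : List WTerm) (l : Lit) : List WTerm :=
  L ++ L.map fun t => ((if l.2 then 1 else M - 1) * t.1 % M, l.1 :: t.2)

/-- Multiplication by `1 + 2 ^ |cl| κ [cl is false]`. -/
def mulSat (M κ : ℕ) (L : List WTerm) (cl : List Lit) : List WTerm :=
  L ++ (cl.foldl (mulLit M) L).map fun t => (κ * t.1 % M, t.2)

/-- The expansion of `c` times a product over clauses. -/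
def prodSat (M κ c : ℕ) (cls : List (List Lit)) : List WTerm := cls.foldl (mulSat M κ) [(c, [])]

/-- The expansion of a sum of products over clauses. -/
def expand (M κ : ℕ) (mons : List (ℕ × List (List Lit))) : List WTerm :=
  mons.flatMap fun m => prodSat M κ m.1 m.2

/-- The clause is true. -/
def satB (y : ℕ → Bool) (cl : List Lit) : Bool := cl.any fun l => y l.1 == l.2

/-- The factor by which `mulSat` multiplies. -/
def cval (M κ : ℕ) (y : ℕ → Bool) (cl : List Lit) : ZMod M :=
  1 + κ * if satB y cl then 0 else 2 ^ cl.length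

/-! ### Values of the expansions -/

section Values

variable {M κ : ℕ} {y : ℕ → Bool}

theorem tval_append (L L' : List WTerm) : tval M y (L ++ L') = tval M y L + tval M y L' := by
  simp [tval]

theorem tval_mulLit [NeZero M] (L : List WTerm) (l : Lit) :
    tval M y (mulLit M L l) = (if y l.1 == l.2 then 0 else 2) * tval M y L := by
  have h1 : ((M - 1 : ℕ) : ZMod M) = -1 := by
    rw [Nat.cast_sub (Nat.one_le_iff_ne_zero.2 (NeZero.ne M))]; simp
  have h2 : tval M y (L.map fun t => ((if l.2 then 1 else M - 1) * t.1 % M, l.1 :: t.2)) =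
      ((if l.2 then 1 else -1) * (if y l.1 then -1 else 1)) * tval M y L := by
    rw [tval, tval, List.map_map, ← List.sum_map_mul_left]
    congr 2
    funext t
    have h3 : (((if l.2 then 1 else M - 1 : ℕ)) : ZMod M) = if l.2 then 1 else -1 := by
      split_ifs <;> simp [h1]
    simp only [Function.comp, ZMod.natCast_mod, Nat.cast_mul, h3, sgn, List.map_cons,
      List.prod_cons]
    split_ifs <;> push_cast <;> ring
  rw [mulLit, tval_append, h2]
  rcases l with ⟨v, b⟩
  cases b <;> cases y v <;> simp <;> ring

/-- A clause is false exactly when all its literals are, and only then does no factor vanish; the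
factors are then all 2. -/
theorem tval_foldl_mulLit [NeZero M] (cl : List Lit) (L : List WTerm) :
    tval M y (cl.foldl (mulLit M) L) = (if satB y cl then 0 else 2 ^ cl.length) * tval M y L := by
  induction cl generalizing L with
  | nil => simp [satB]
  | cons l cl ih =>
    rw [List.foldl_cons, ih, tval_mulLit]
    simp only [satB, List.any_cons, List.length_cons, Bool.or_eq_true]
    by_cases h1 : (y l.1 == l.2) = true <;>
      by_cases h2 : (cl.any fun l => y l.1 == l.2) = true <;> simp [h1, h2, pow_succ, mul_assoc]

theorem tval_mulSat [NeZero M] (L : List WTerm) (cl : List Lit) :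
    tval M y (mulSat M κ L cl) = cval M κ y cl * tval M y L := by
  have h2 : ∀ L : List WTerm, tval M y (L.map fun t => (κ * t.1 % M, t.2)) = κ * tval M y L := by
    intro L
    rw [tval, tval, List.map_map, ← List.sum_map_mul_left]
    congr 2
    funext t
    simp only [Function.comp, ZMod.natCast_mod, Nat.cast_mul]
    ring
  rw [mulSat, tval_append, h2, tval_foldl_mulLit, cval]
  ring

theorem tval_prodSat [NeZero M] (c : ℕ) (cls : List (List Lit)) :
    tval M y (prodSat M κ c cls) = c * (cls.map (cval M κ y)).prod := by
  have : ∀ L, tval M y (cls.foldl (mulSat M κ) L) = tval M y L * (cls.map (cval M κ y)).prod := by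
    induction cls with
    | nil => simp
    | cons cl cls ih => intro L; rw [List.foldl_cons, ih, tval_mulSat]; simp; ring
  rw [prodSat, this]
  simp [tval, sgn]

theorem tval_expand [NeZero M] (mons : List (ℕ × List (List Lit))) :
    tval M y (expand M κ mons) = (mons.map fun m => (m.1 : ZMod M) * (m.2.map (cval M κ y)).prod).sum := by
  induction mons with
  | nil => simp [expand, tval]
  | cons m mons ih =>
    rw [expand, List.flatMap_cons, tval_append, tval_prodSat, ← expand, ih]
    simp

end Values

/-! ### Number and shape of the terms -/

section Sizes

variable {M κ : ℕ}

theorem length_mulLit (L : List WTerm) (l : Lit) : (mulLit M L l).length = 2 * L.length := by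
  simp [mulLit, two_mul]

theorem length_foldl_mulLit (cl : List Lit) (L : List WTerm) :
    (cl.foldl (mulLit M) L).length = 2 ^ cl.length * L.length := by
  induction cl generalizing L with
  | nil => simp
  | cons l cl ih => rw [List.foldl_cons, ih, length_mulLit, List.length_cons, pow_succ]; ring

/-- 9 = 1 + 2³. Like terms are never merged, so the number of terms depends only on the number of
clauses and not on the formula. -/
theorem length_mulSat {cl : List Lit} (h : cl.length = 3) (L : List WTerm) :
    (mulSat M κ L cl).length = 9 * L.length := by
  simp [mulSat, length_foldl_mulLit, h]
  ring

theorem length_prodSat {c : ℕ} {cls : List (List Lit)} (h : ∀ cl ∈ cls, cl.length = 3) :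
    (prodSat M κ c cls).length = 9 ^ cls.length := by
  induction cls using List.reverseRecOn with
  | nil => simp [prodSat]
  | append_singleton l a ih =>
    rw [prodSat, List.foldl_append] at *
    rw [List.foldl_cons, List.foldl_nil, length_mulSat (h a (by simp)),
      ih fun cl hcl => h cl (by simp [hcl]), List.length_append, pow_add]
    simp [mul_comm]

theorem length_expand {mons : List (ℕ × List (List Lit))}
    (h : ∀ m ∈ mons, ∀ cl ∈ m.2, cl.length = 3) :
    (expand M κ mons).length = (mons.map fun m => 9 ^ m.2.length).sum := by
  induction mons with
  | nil => rfl
  | cons m mons ih =>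
    rw [expand, List.flatMap_cons, List.length_append, length_prodSat (h m (by simp)), ← expand,
      ih fun m hm => h m (by simp [hm])]
    simp

/-- Bounds for the coefficients, the variables and the lengths of the parities. -/
def Bounded (B V : ℕ) (k : ℕ) (L : List WTerm) : Prop :=
  ∀ t ∈ L, t.1 ≤ B ∧ (∀ v ∈ t.2, v < V) ∧ t.2.length ≤ k

variable {B V k : ℕ} (hM : 0 < M) (hB : M ≤ B)

include hM hB

theorem Bounded.mulLit {L : List WTerm} (h : Bounded B V k L) {l : Lit} (hl : l.1 < V) :
    Bounded B V (k + 1) (mulLit M L l) := by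
  intro t ht
  rw [ModCSP.mulLit, List.mem_append, List.mem_map] at ht
  rcases ht with ht | ⟨t, ht, rfl⟩
  · exact ⟨(h t ht).1, (h t ht).2.1, (h t ht).2.2.trans (Nat.le_succ _)⟩
  · refine ⟨(Nat.mod_lt _ hM).le.trans hB, fun v hv => ?_, by simpa using (h t ht).2.2⟩
    rcases List.mem_cons.1 hv with rfl | hv
    · exact hl
    · exact (h t ht).2.1 v hv

theorem Bounded.foldl_mulLit {cl : List Lit} {L : List WTerm} (h : Bounded B V k L)
    (hl : ∀ l ∈ cl, l.1 < V) : Bounded B V (k + cl.length) (cl.foldl (ModCSP.mulLit M) L) := by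
  induction cl generalizing L k with
  | nil => exact h
  | cons l cl ih =>
    rw [List.foldl_cons]
    have := ih (h.mulLit hM hB (hl l (by simp))) fun l hl' => hl l (by simp [hl'])
    rwa [add_assoc, add_comm 1] at this

theorem Bounded.mulSat {cl : List Lit} {L : List WTerm} (h : Bounded B V k L)
    (hl : ∀ l ∈ cl, l.1 < V) : Bounded B V (k + cl.length) (mulSat M κ L cl) := by
  intro t ht
  rw [ModCSP.mulSat, List.mem_append, List.mem_map] at ht
  rcases ht with ht | ⟨t, ht, rfl⟩
  · exact ⟨(h t ht).1, (h t ht).2.1, (h t ht).2.2.trans (Nat.le_add_right _ _)⟩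
  · obtain ⟨-, h2, h3⟩ := h.foldl_mulLit hM hB hl t ht
    exact ⟨(Nat.mod_lt _ hM).le.trans hB, h2, h3⟩

theorem bounded_prodSat {c : ℕ} {cls : List (List Lit)} (hc : c ≤ B)
    (h : ∀ cl ∈ cls, cl.length = 3 ∧ ∀ l ∈ cl, l.1 < V) :
    Bounded B V (3 * cls.length) (prodSat M κ c cls) := by
  induction cls using List.reverseRecOn with
  | nil => intro t ht; obtain rfl := List.mem_singleton.1 ht; simpa using hc
  | append_singleton l a ih =>
    rw [prodSat, List.foldl_append] at *
    have := (ih fun cl hcl => h cl (by simp [hcl])).mulSat (κ := κ) hM hB (h a (by simp)).2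
    rw [(h a (by simp)).1] at this
    simpa [mul_add] using this

theorem bounded_expand {mons : List (ℕ × List (List Lit))}
    (h : ∀ m ∈ mons, m.1 ≤ B ∧ m.2.length ≤ k ∧ ∀ cl ∈ m.2, cl.length = 3 ∧ ∀ l ∈ cl, l.1 < V) :
    Bounded B V (3 * k) (expand M κ mons) := by
  intro t ht
  obtain ⟨m, hm, ht⟩ := List.mem_flatMap.1 ht
  obtain ⟨h1, h2, h3⟩ := h m hm
  obtain ⟨h4, h5, h6⟩ := bounded_prodSat hM hB h1 h3 t ht
  exact ⟨h4, h5, h6.trans (by omega)⟩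

end Sizes

/-! ### Computing the expansions in polynomial time -/

namespace PTime

variable [Enc α] {b : ι → ℕ} {x : ι → α} {M K B V k : ι → ℕ}

/-- Scaling of the coefficients. -/
theorem mapCoeff {L : ι → List WTerm} (hM : PolyBdd b M) (hK : PolyBdd b K)
    (hB : PolyBdd b B) (hlen : PolyBdd b fun i => (L i).length) (hL : ∀ i, ∀ t ∈ L i, t.1 ≤ B i)
    (pM : PTime b x M) (pK : PTime b x K) (pL : PTime b x L) :
    PTime b x (fun i => (L i).map fun t => (K i * t.1 % M i, t.2)) := by
  refine map hlen pL ?_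
  have hc : PolyBdd (fun j : ListPos L => b j.i) (fun j => j.a.1) :=
    (hB.comp (r := ListPos.i)).of_le fun j => hL _ _ j.mem
  exact (mod ((hK.comp (r := ListPos.i)).mul hc) (hM.comp (r := ListPos.i))
    (mul (hK.comp (r := ListPos.i)) hc (pK.lift _) id.snd.proj_fst) (pM.lift _)).pair
      id.snd.proj_snd

theorem mulLit {L : ι → List WTerm} {l : ι → Lit} (hM : PolyBdd b M) (hB : PolyBdd b B)
    (hlen : PolyBdd b fun i => (L i).length) (hL : ∀ i, ∀ t ∈ L i, t.1 ≤ B i)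
    (pM : PTime b x M) (pL : PTime b x L) (pl : PTime b x l) :
    PTime b x (fun i => mulLit (M i) (L i) (l i)) := by
  refine append hlen pL ?_
  have h1 := mapCoeff hM (((PolyBdd.const 1).add hM).of_le fun i => by
      split_ifs <;> omega) hB hlen hL pM
    (pl.proj_snd.ite (const 1) (sub (PolyBdd.const 1) pM (const 1))) pL
  refine (map (f := fun i t => (t.1, (l i).1 :: t.2)) (hlen.of_le fun i => by simp) h1 ?_).congr
    fun i => by simp [Function.comp_def]
  exact id.snd.proj_fst.pair ((pl.proj_fst.lift _).cons id.snd.proj_snd)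

theorem mulSat {L : ι → List WTerm} {cl : ι → List Lit} (hM : PolyBdd b M) (hK : PolyBdd b K)
    (hB : PolyBdd b B) (hM0 : ∀ i, 0 < M i) (hMB : ∀ i, M i ≤ B i)
    (hlen : PolyBdd b fun i => (L i).length)
    (hL : ∀ i, ∀ t ∈ L i, t.1 ≤ B i) (hcl : ∀ i, (cl i).length = 3)
    (pM : PTime b x M) (pK : PTime b x K) (pL : PTime b x L) (pl : PTime b x cl) :
    PTime b x (fun i => mulSat (M i) (K i) (L i) (cl i)) := by
  -- Coefficients are reduced modulo M at every multiplication, so the bound persists along the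
  -- fold.
  have hB' : ∀ i (l : List Lit), ∀ t ∈ l.foldl (ModCSP.mulLit (M i)) (L i), t.1 ≤ B i := by
    intro i l
    induction l using List.reverseRecOn with
    | nil => exact hL i
    | append_singleton l a ih =>
      intro t ht
      rw [List.foldl_append, List.foldl_cons, List.foldl_nil, ModCSP.mulLit, List.mem_append,
        List.mem_map] at ht
      rcases ht with ht | ⟨t, ht, rfl⟩
      · exact ih t ht
      · exact (Nat.mod_lt _ (hM0 i)).le.trans (hMB i)
  refine append hlen pL (mapCoeff hM hK hB (((PolyBdd.const 8).mul hlen).of_le fun i => ?_)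
    (fun i => hB' i _) pM pK ?_)
  · rw [length_foldl_mulLit, hcl]; norm_num
  · refine foldl ((PolyBdd.const 3).of_le fun i => (hcl i).le) pl pL ?_
    refine mulLit (hM.comp (r := ListPos.i)) (hB.comp (r := ListPos.i))
      (((PolyBdd.const 8).mul (hlen.comp (r := ListPos.i))).of_le fun j => ?_)
      (fun j => hB' _ _) (pM.lift _) id.snd.fst id.snd.snd
    rw [length_foldl_mulLit]
    have h1 := congrArg List.length j.eq
    rw [hcl, List.length_append, List.length_cons] at h1
    gcongr
    calc 2 ^ j.pre.length ≤ 2 ^ 3 := Nat.pow_le_pow_right (by norm_num) (by omega)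
      _ = 8 := by norm_num

theorem prodSat {c : ι → ℕ} {cls : ι → List (List Lit)} (hM : PolyBdd b M) (hK : PolyBdd b K)
    (hB : PolyBdd b B) (hM0 : ∀ i, 0 < M i) (hMB : ∀ i, M i ≤ B i) (hc : ∀ i, c i ≤ B i)
    (hlen : PolyBdd b fun i => 9 ^ (cls i).length)
    (hcl : ∀ i, ∀ cl ∈ cls i, cl.length = 3)
    (pM : PTime b x M) (pK : PTime b x K) (pc : PTime b x c) (pl : PTime b x cls) :
    PTime b x (fun i => prodSat (M i) (K i) (c i) (cls i)) := by
  have hB' : ∀ i (l : List (List Lit)),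
      ∀ t ∈ l.foldl (ModCSP.mulSat (M i) (K i)) [(c i, [])], t.1 ≤ B i := by
    intro i l
    induction l using List.reverseRecOn with
    | nil => simpa using hc i
    | append_singleton l a ih =>
      intro t ht
      rw [List.foldl_append, List.foldl_cons, List.foldl_nil, ModCSP.mulSat, List.mem_append,
        List.mem_map] at ht
      rcases ht with ht | ⟨t, ht, rfl⟩
      · exact ih t ht
      · exact (Nat.mod_lt _ (hM0 i)).le.trans (hMB i)
  refine foldl (hlen.of_le fun i => (Nat.lt_pow_self (by norm_num)).le) pl
    ((pc.pair (const [])).cons (const [])) ?_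
  refine mulSat (hM.comp (r := ListPos.i)) (hK.comp (r := ListPos.i))
    (hB.comp (r := ListPos.i)) (fun j => hM0 _) (fun j => hMB _)
    ((hlen.comp (r := ListPos.i)).of_le fun j => ?_) (fun j => hB' _ _)
    (fun j => hcl _ _ j.mem) (pM.lift _) (pK.lift _) id.snd.fst id.snd.snd
  have h1 := j.eq
  have h2 : ∀ cl ∈ j.pre, cl.length = 3 := fun cl h => hcl j.i cl (by rw [h1]; simp [h])
  have h3 := length_prodSat (M := M j.i) (κ := K j.i) (c := c j.i) h2
  rw [ModCSP.prodSat] at h3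
  rw [h3]
  refine Nat.pow_le_pow_right (by norm_num) ?_
  rw [h1]
  simp

theorem expand {mons : ι → List (ℕ × List (List Lit))} (hM : PolyBdd b M) (hK : PolyBdd b K)
    (hB : PolyBdd b B) (hM0 : ∀ i, 0 < M i) (hMB : ∀ i, M i ≤ B i)
    (hc : ∀ i, ∀ m ∈ mons i, m.1 ≤ B i)
    (hlen : PolyBdd b fun i => ((mons i).map fun m => 9 ^ m.2.length).sum)
    (hcl : ∀ i, ∀ m ∈ mons i, ∀ cl ∈ m.2, cl.length = 3)
    (pM : PTime b x M) (pK : PTime b x K) (pl : PTime b x mons) :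
    PTime b x (fun i => expand (M i) (K i) (mons i)) := by
  refine flatMap (hlen.of_le fun i => ?_) (hlen.of_le fun i => (length_expand (hcl i)).le) pl ?_
  · simpa using List.length_le_sum_of_one_le ((mons i).map fun m => 9 ^ m.2.length) (by
      simp only [List.mem_map]
      rintro _ ⟨m, -, rfl⟩
      exact Nat.one_le_pow _ _ (by norm_num))
  · refine prodSat (hM.comp (r := ListPos.i)) (hK.comp (r := ListPos.i))
      (hB.comp (r := ListPos.i)) (fun j => hM0 _) (fun j => hMB _) (fun j => hc _ _ j.mem)
      ((hlen.comp (r := ListPos.i)).of_le fun j => ?_) (fun j => hcl _ _ j.mem)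
      (pM.lift _) (pK.lift _) id.snd.proj_fst id.snd.proj_snd
    exact List.single_le_sum (by simp) _ (List.mem_map.2 ⟨j.a, j.mem, rfl⟩)

theorem count {l : ι → List ℕ} {n : ι → ℕ} (hlen : PolyBdd b fun i => (l i).length)
    (hB : PolyBdd b B) (hl : ∀ i, ∀ v ∈ l i, v ≤ B i) (hn : PolyBdd b n) (pl : PTime b x l)
    (pn : PTime b x n) : PTime b x (fun i => (l i).count (n i)) := by
  refine (foldl (a0 := fun _ => 0) (g := fun i acc v => if v == n i then acc + 1 else acc) hlen pl
    (const 0) ?_).congr fun i => ?_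
  · exact (beq ((hB.comp (r := ListPos.i)).of_le fun j => hl _ _ j.mem)
      (hn.comp (r := ListPos.i)) id.snd.snd (pn.lift _)).ite id.snd.fst.succ id.snd.fst
  · induction l i using List.reverseRecOn with
    | nil => rfl
    | append_singleton l a ih =>
      rw [List.foldl_append, List.foldl_cons, List.foldl_nil, ih, List.count_append,
        List.count_singleton]
      split_ifs <;> simp

end PTime

/-! ## The instance of LIN-2-MOD built from a weighted sum of parities -/

/-- The variables are `V` free ones and one for each term; the equations define the latter as
parities of the former. -/
def lin2Mod (M V : ℕ) (L : List WTerm) (σ : ℕ) : Lin2Mod M (V + L.length) where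
  numEq := L.length
  numEq_le := Nat.le_add_left _ _
  -- Row e adds the new variable V + e to the parity of the listed ones; counting modulo 2 takes
  -- care of repetitions in the list.
  mat e j := (((V + e) :: L[e].2).count (j : ℕ) : ℕ)
  rhs _ := 0
  -- By (-1)^x = 1 - 2x, the condition ∑ c (-1)^x + σ = 0 reads ∑ 2c x = ∑ c + σ. This gives the
  -- weights and the target without dividing by 2, so M may be even.
  wt j := if h : V ≤ j then ((2 * (L[(j : ℕ) - V]'(by have := j.2; omega)).1 : ℕ) : ZMod M) else 0
  target := (((L.map Prod.fst).sum + σ : ℕ) : ZMod M)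

/-- The list form of the encoding of `lin2Mod`. -/
def lin2ModData (M V : ℕ) (L : List WTerm) (σ : ℕ) :
    ℕ × ℕ × List (List ℕ × ℕ) × List ℕ × ℕ :=
  (M, V + L.length, (L.zipIdx V).map fun t =>
      ((List.range (V + L.length)).map fun j => (t.2 :: t.1.2).count j % 2, 0),
    List.replicate V 0 ++ L.map fun t => 2 * t.1 % M, ((L.map Prod.fst).sum + σ) % M)

theorem enc_lin2Mod (M V : ℕ) (L : List WTerm) (σ : ℕ) (hM : 0 < M) :
    (lin2Mod M V L σ).enc = enc (lin2ModData M V L σ) := by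
  have : NeZero M := ⟨hM.ne'⟩
  have h1 : (List.ofFn fun e : Fin L.length => Data.cons (encList (List.ofFn fun j =>
      encNat ((lin2Mod M V L σ).mat e j).val)) (encNat ((lin2Mod M V L σ).rhs e).val)) =
      ((L.zipIdx V).map fun t => ((List.range (V + L.length)).map
        fun j => (t.2 :: t.1.2).count j % 2, 0)).map enc := by
    refine List.ext_getElem (by simp) fun e h1 h2 => ?_
    simp only [List.getElem_ofFn, List.getElem_map, List.getElem_zipIdx]
    refine congrArg₂ Data.cons (congrArg encList ?_) (by simp [lin2Mod]; rfl)
    refine List.ext_getElem (by simp) fun j h3 h4 => ?_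
    simp only [List.getElem_ofFn, List.getElem_map, List.getElem_range]
    simp only [lin2Mod, ZMod.val_natCast]
    rfl
  have h2 : (List.ofFn fun j => encNat ((lin2Mod M V L σ).wt j).val) =
      ((List.replicate V 0 ++ L.map fun t => 2 * t.1 % M : List ℕ)).map enc := by
    refine List.ext_getElem (by simp) fun j h3 h4 => ?_
    simp only [List.getElem_ofFn, List.getElem_map, lin2Mod]
    by_cases h : V ≤ j
    · rw [dif_pos h, List.getElem_append_right (by simpa using h)]
      simp only [List.getElem_map, List.length_replicate, ZMod.val_natCast]
      rfl
    · rw [dif_neg h, List.getElem_append_left (by simpa using h)]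
      simp only [List.getElem_replicate, ZMod.val_zero]
      rfl
  rw [Lin2Mod.enc]
  refine congrArg (Data.cons _) (congrArg (Data.cons _) (congrArg₂ Data.cons ?_
    (congrArg₂ Data.cons ?_ ?_)))
  · exact congrArg encList h1
  · exact congrArg encList h2
  · simp only [lin2Mod, ZMod.val_natCast]
    rfl

/-- The map a ↦ 1 - 2 a from ℤ/2 to {-1, 1} turns sums into products, so both sides gain the same
factor for each entry of the list. -/
theorem neg_one_pow_count (y : ℕ → Bool) (V : ℕ) (vs : List ℕ) (hv : ∀ v ∈ vs, v < V) :
    (sgn y vs : ℤ) = 1 - 2 * ((∑ v : Fin V, (vs.count (v : ℕ) : ZMod 2) *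
      if y v then 1 else 0 : ZMod 2).val : ℤ) := by
  have key : ∀ a b : ZMod 2, (1 - 2 * ((a + b).val : ℤ)) =
      (1 - 2 * (a.val : ℤ)) * (1 - 2 * (b.val : ℤ)) := by decide
  induction vs with
  | nil => simp [sgn]
  | cons v vs ih =>
    have h1 : ∑ w : Fin V, ((v :: vs).count (w : ℕ) : ZMod 2) * (if y w then 1 else 0 : ZMod 2) =
        (if y v then 1 else 0) + ∑ w : Fin V, (vs.count (w : ℕ) : ZMod 2) *
          (if y w then 1 else 0 : ZMod 2) := by
      have hvV := hv v (by simp)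
      have : (if y v then 1 else 0 : ZMod 2) = ∑ w : Fin V,
          if w = ⟨v, hvV⟩ then (if y v then 1 else 0 : ZMod 2) else 0 := by simp
      rw [this, ← Finset.sum_add_distrib]
      refine Finset.sum_congr rfl fun w _ => ?_
      rw [List.count_cons]
      by_cases hw : w = ⟨v, hvV⟩
      · subst hw; cases y v <;> simp [add_comm]
      · have : ¬ v = w := fun h => hw (Fin.ext h.symm)
        simp [hw, this]
    have h2 : sgn y (v :: vs) = (if y v then -1 else 1) * sgn y vs := by simp [sgn]
    have h3 : 1 - 2 * ((if y v then 1 else 0 : ZMod 2).val : ℤ) = if y v then -1 else 1 := by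
      cases y v <;> rfl
    rw [h1, key, h2, ih fun w hw => hv w (by simp [hw]), h3]

/-- The equations determine the variables of the terms from the free ones. Solutions therefore
correspond to assignments of the free variables, and along this correspondence the modular
constraint is the vanishing of the weighted sum of parities. -/
theorem lin2Mod_satisfiable_iff (M V : ℕ) (L : List WTerm) (σ : ℕ) {B k : ℕ}
    (hL : Bounded B V k L) :
    (lin2Mod M V L σ).Satisfiable ↔ ∃ y : ℕ → Bool, tval M y L + σ = 0 := by
  have hsum : ∀ x : Fin (V + L.length) → ZMod 2,
      ∑ j, (lin2Mod M V L σ).wt j * ((x j).val : ZMod M) =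
        ∑ e : Fin L.length, 2 * (L[e].1 : ZMod M) * ((x (Fin.natAdd V e)).val : ZMod M) := by
    intro x
    rw [Fin.sum_univ_add, Finset.sum_eq_zero, zero_add]
    · refine Finset.sum_congr rfl fun e _ => ?_
      simp [lin2Mod]
    · intro j _
      have : ¬ V ≤ j := by omega
      simp [lin2Mod, this]
  have htv : ∀ y : ℕ → Bool, tval M y L =
      ∑ e : Fin L.length, (L[e].1 : ZMod M) * (sgn y L[e].2 : ZMod M) := by
    intro y
    exact (Fin.sum_univ_fun_getElem L fun t => (t.1 : ZMod M) * (sgn y t.2 : ZMod M)).symm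
  have hs : ((L.map Prod.fst).sum : ZMod M) = ∑ e : Fin L.length, (L[e].1 : ZMod M) := by
    rw [Nat.cast_list_sum, List.map_map]
    exact (Fin.sum_univ_fun_getElem L fun t => (t.1 : ZMod M)).symm
  -- Boundedness enters here: the parities involve free variables only, so the block of the matrix
  -- on the new variables is the identity.
  have hsol : ∀ x : Fin (V + L.length) → ZMod 2, x ∈ (lin2Mod M V L σ).solutions ↔
      ∀ e : Fin L.length, x (Fin.natAdd V e) =
        ∑ v : Fin V, (L[e].2.count (v : ℕ) : ZMod 2) * x (Fin.castAdd _ v) := by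
    intro x
    refine forall_congr' fun (e : Fin L.length) => ?_
    have h1 : ∀ v : Fin V, (lin2Mod M V L σ).mat e (Fin.castAdd _ v) =
        (L[e].2.count (v : ℕ) : ZMod 2) := by
      intro v
      have : ¬ V + e = v := by omega
      simp [lin2Mod, this]
    have h2 : ∀ f : Fin L.length, (lin2Mod M V L σ).mat e (Fin.natAdd V f) =
        if f = e then 1 else 0 := by
      intro f
      have h0 : L[(e : ℕ)].2.count (V + f : ℕ) = 0 := by
        rw [List.count_eq_zero]
        intro h
        have := (hL L[(e : ℕ)] (by simp)).2.1 _ h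
        omega
      by_cases h : f = e
      · subst h
        have h0' : L[(f : ℕ)].2.count (V + f : ℕ) = 0 := h0
        simp [lin2Mod, h0']
      · have h' : ¬ (e : ℕ) = f := fun h1 => h (Fin.ext h1.symm)
        simp [lin2Mod, h, h', h0]
    have h3 : ∀ a b : ZMod 2, a + b = 0 ↔ b = a := by decide
    rw [show (lin2Mod M V L σ).rhs e = 0 from rfl, Fin.sum_univ_add]
    simp only [h1, h2]
    simp only [ite_mul, one_mul, zero_mul, Finset.sum_ite_eq', Finset.mem_univ, if_true]
    exact h3 _ _
  have hval : ∀ (y : ℕ → Bool) (x : Fin (V + L.length) → ZMod 2),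
      (∀ v : Fin V, x (Fin.castAdd _ v) = if y v then 1 else 0) →
      x ∈ (lin2Mod M V L σ).solutions →
      (∑ j, (lin2Mod M V L σ).wt j * ((x j).val : ZMod M) = (lin2Mod M V L σ).target ↔
        tval M y L + σ = 0) := by
    intro y x hxy hx
    rw [hsol] at hx
    have h1 : tval M y L = ∑ e : Fin L.length, (L[e].1 : ZMod M) -
        ∑ e : Fin L.length, 2 * (L[e].1 : ZMod M) * ((x (Fin.natAdd V e)).val : ZMod M) := by
      rw [htv, ← Finset.sum_sub_distrib]
      refine Finset.sum_congr rfl fun e _ => ?_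
      rw [neg_one_pow_count y V L[e].2 fun v hv => (hL L[e] (by simp)).2.1 v hv, hx]
      simp only [hxy]
      push_cast
      ring
    rw [hsum, h1]
    simp only [lin2Mod]
    rw [Nat.cast_add, hs]
    constructor
    · intro h; rw [h]; ring
    · intro h; linear_combination -h
  constructor
  · rintro ⟨x, hx, hx'⟩
    refine ⟨fun v => if h : v < V then decide (x (Fin.castAdd _ ⟨v, h⟩) = 1) else false, ?_⟩
    refine (hval _ x (fun v => ?_) hx).1 hx'
    have h2 : ∀ a : ZMod 2, a = if a = 1 then 1 else 0 := by decide
    simpa using h2 _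
  · rintro ⟨y, hy⟩
    let x : Fin (V + L.length) → ZMod 2 := Fin.addCases (fun v => if y v then 1 else 0)
      fun e => ∑ v : Fin V, (L[e].2.count (v : ℕ) : ZMod 2) * if y v then 1 else 0
    have hx : x ∈ (lin2Mod M V L σ).solutions := by
      rw [hsol]
      intro e
      simp [x]
    exact ⟨x, hx, (hval y x (fun v => by simp [x]) hx).2 hy⟩

theorem PTime.lin2ModData [Enc α] {b : ι → ℕ} {x : ι → α} {M V B k σ : ι → ℕ} {L : ι → List WTerm}
    (hM : PolyBdd b M) (hV : PolyBdd b V) (hB : PolyBdd b B) (hk : PolyBdd b k)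
    (hσ : PolyBdd b σ) (hlen : PolyBdd b fun i => (L i).length)
    (hL : ∀ i, Bounded (B i) (V i) (k i) (L i)) (pM : PTime b x M) (pV : PTime b x V)
    (pL : PTime b x L) (pσ : PTime b x σ) :
    PTime b x (fun i => lin2ModData (M i) (V i) (L i) (σ i)) := by
  have pn : PTime b x (fun i => V i + (L i).length) := add hlen pV (pL.length hlen)
  have hn : PolyBdd b (fun i => V i + (L i).length) := hV.add hlen
  have pw : PTime b x (fun i => (L i).map fun t => 2 * t.1 % M i) :=
    (map (f := fun _ t => t.1) (hlen.of_le fun i => by simp)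
      (mapCoeff hM (PolyBdd.const 2) hB hlen (fun i t ht => (hL i t ht).1) pM (const 2) pL)
      id.snd.proj_fst).congr fun i => by simp [Function.comp_def]
  have ps : PTime b x (fun i => (L i).map Prod.fst) :=
    (map (f := fun _ t => t.1) hlen pL id.snd.proj_fst).congr fun i => rfl
  have hs : PolyBdd b (fun i => ((L i).map Prod.fst).sum) := (hlen.mul hB).of_le fun i => by
    have := List.sum_le_card_nsmul ((L i).map Prod.fst) (B i) (by
      simp only [List.mem_map]
      rintro _ ⟨t, ht, rfl⟩
      exact (hL i t ht).1)
    simpa using this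
  refine pM.pair (pn.pair (PTime.pair ?_ (PTime.pair ?_ ?_)))
  · refine map (f := fun i t => ((List.range (V i + (L i).length)).map fun j =>
      (t.2 :: t.1.2).count j % 2, 0)) (hlen.of_le fun i => by simp) (zipIdx hlen pL pV) ?_
    refine PTime.pair ?_ (const 0)
    refine map ((hn.comp (r := ListPos.i)).of_le fun j => by simp)
      (range (hn.comp (r := ListPos.i)) (pn.lift _)) ?_
    have hmem : ∀ j : ListPos (fun i : ι => (L i).zipIdx (V i)),
        j.a.1 ∈ L j.i ∧ j.a.2 < V j.i + (L j.i).length := by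
      intro j
      have := j.mem
      rw [List.mem_zipIdx_iff_le_and_getElem?_sub] at this
      refine ⟨List.mem_of_getElem? this.2, ?_⟩
      have h2 := (List.getElem?_eq_some_iff.1 this.2).1
      omega
    let r := fun j : ListPos (fun j : ListPos (fun i : ι => (L i).zipIdx (V i)) =>
      List.range (V j.i + (L j.i).length)) => j.i.i
    have hcnt := count (x := fun j : ListPos (fun j : ListPos (fun i : ι => (L i).zipIdx (V i)) =>
        List.range (V j.i + (L j.i).length)) => ((x j.i.i, j.i.a), j.a))
      (b := fun j => b j.i.i) (l := fun j => j.i.a.2 :: j.i.a.1.2) (n := fun j => j.a)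
      (B := fun j => V j.i.i + (L j.i.i).length) (((hk.comp (r := r)).add (PolyBdd.const 1)).of_le
        fun j => by simpa using (hL _ _ (hmem j.i).1).2.2) (hn.comp (r := r))
      (fun j v hv => by
        rcases List.mem_cons.1 hv with rfl | hv
        · exact (hmem j.i).2.le
        · have := (hL _ _ (hmem j.i).1).2.1 v hv
          exact this.le.trans (Nat.le_add_right _ _))
      ((hn.comp (r := r)).of_le fun j => (List.mem_range.1 j.mem).le)
      (id.fst.proj_snd.proj_snd.cons id.fst.proj_snd.proj_fst.proj_snd) id.snd
    exact mod (((hk.comp (r := r)).add (PolyBdd.const 1)).of_le fun j => by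
      refine List.count_le_length.trans ?_
      simpa using (hL _ _ (hmem j.i).1).2.2) (PolyBdd.const 2) hcnt (const 2)
  · exact append (hV.of_le fun i => by simp) (replicate hV pV (const 0)) pw
  · exact mod (hs.add hσ) hM (add hσ (sum (hlen.of_le fun i => by simp) hs ps) pσ) pM

/-! ## Formulas as lists of clauses -/

/-- The list of clauses of a formula. -/
def ThreeCNF.clauses {m : ℕ} (φ : ThreeCNF m) : List (List Lit) :=
  List.ofFn fun i => List.ofFn fun j => (((φ i j).1 : ℕ), (φ i j).2)

/-- Clauses of three literals on variables below `V`. -/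
def GoodClauses (V : ℕ) (cls : List (List Lit)) : Prop :=
  ∀ cl ∈ cls, cl.length = 3 ∧ ∀ l ∈ cl, l.1 < V

namespace ThreeCNF

variable {m : ℕ} (φ : ThreeCNF m)

theorem enc_clauses : Enc.enc φ.clauses = φ.enc := by
  simp only [ThreeCNF.enc, clauses, Enc.enc, List.map_ofFn]
  rfl

theorem length_clauses : φ.clauses.length = m := by simp [clauses]

/-- One variable more than necessary is allowed, so that variable 0 exists even for m = 0; the
tautologies used for padding mention it. -/
theorem goodClauses : GoodClauses (3 * m + 1) φ.clauses := by
  intro cl hcl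
  simp only [clauses, List.mem_ofFn] at hcl
  obtain ⟨i, rfl⟩ := hcl
  refine ⟨by simp, fun l hl => ?_⟩
  rw [List.mem_ofFn] at hl
  obtain ⟨j, rfl⟩ := hl
  have := (φ i j).1.2
  simp only
  omega

theorem satB_clause (y : ℕ → Bool) (i : Fin m) :
    satB y (φ.clauses[(i : ℕ)]'(by rw [length_clauses]; exact i.2)) = true ↔
      φ.ClauseSat (fun v => y v) i := by
  simp only [satB, clauses, ClauseSat, List.any_eq_true, List.getElem_ofFn, List.mem_ofFn]
  constructor
  · rintro ⟨_, ⟨j, rfl⟩, h⟩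
    exact ⟨j, by simpa using h⟩
  · rintro ⟨j, h⟩
    exact ⟨_, ⟨j, rfl⟩, by simpa using h⟩

theorem satisfiable_iff : φ.Satisfiable ↔ ∃ y : ℕ → Bool, ∀ cl ∈ φ.clauses, satB y cl = true := by
  have h : ∀ y : ℕ → Bool, (∀ cl ∈ φ.clauses, satB y cl = true) ↔
      ∀ i, φ.ClauseSat (fun v => y v) i := by
    intro y
    simp only [← satB_clause]
    constructor
    · intro h i; exact h _ (List.getElem_mem _)
    · intro h cl hcl
      obtain ⟨i, hi, rfl⟩ := List.getElem_of_mem hcl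
      exact h ⟨i, by rwa [length_clauses] at hi⟩
  constructor
  · rintro ⟨x, hx⟩
    refine ⟨fun v => if h : v < 3 * m then x ⟨v, h⟩ else false, (h _).2 ?_⟩
    simpa using hx
  · rintro ⟨y, hy⟩
    exact ⟨_, (h y).1 hy⟩

end ThreeCNF

/-- A reduction from 3-SAT to LIN-2-MOD followed by an algorithm for the latter. -/
theorem exists_reduction [Enc δ] {μ n b : ℕ → ℕ} {k : ℕ} (D : (Σ m, ThreeCNF m) → δ)
    (hI : ∀ i, ∃ I : Lin2Mod (μ (n i.1)) (n i.1), I.enc = enc (D i) ∧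
      (I.Satisfiable ↔ i.2.Satisfiable))
    (h : PTimeE k (fun i : Σ m, ThreeCNF m => b i.1) (fun i => i.2.clauses) D) :
    ∃ (R : Prog) (K : ℕ), ∀ (P : Prog) (T : ℕ → ℕ), SolvesLin2Mod P μ T →
      SolvesThreeSat (.seq R P) (fun m => K * (b m + 1) ^ k + T (n m)) := by
  obtain ⟨p, N, K, hN, h⟩ := h
  obtain ⟨R, C, hR⟩ := exists_exec_of_runs p N
  refine ⟨R, K + C, fun P T hP m φ => ?_⟩
  obtain ⟨I, hID, hI⟩ := hI ⟨m, φ⟩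
  obtain ⟨o, ⟨t, ht, s, hs, hso⟩, ho⟩ := hP (n m) I
  obtain ⟨u, hu, hRu⟩ := hR _ _ _ (h ⟨m, φ⟩)
  simp only [ThreeCNF.enc_clauses] at hRu
  rw [← hID] at hRu
  refine ⟨o, ⟨u + t, ?_, s, .seq hRu hs, hso⟩, ho.trans hI⟩
  have := le_mul_pow_succ C (b m) k
  simp only [add_mul] at hu ⊢
  omega

theorem exists_lin2Mod {M V n B k σ : ℕ} {L : List WTerm} (hM : 0 < M) (hn : V + L.length = n)
    (hL : Bounded B V k L) : ∃ I : Lin2Mod M n, I.enc = enc (lin2ModData M V L σ) ∧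
      (I.Satisfiable ↔ ∃ y : ℕ → Bool, tval M y L + σ = 0) := by
  subst hn
  exact ⟨_, enc_lin2Mod M V L σ hM, lin2Mod_satisfiable_iff M V L σ hL⟩

/-- Terms with coefficient 0 adjust the number of variables without affecting the constraint. -/
theorem tval_append_replicate {M : ℕ} {y : ℕ → Bool} (L : List WTerm) (n : ℕ) :
    tval M y (L ++ List.replicate n (0, [])) = tval M y L := by
  rw [tval_append]
  simp [tval]

theorem Bounded.append_replicate {B V k : ℕ} {L : List WTerm} (h : Bounded B V k L) (n : ℕ) :
    Bounded B V k (L ++ List.replicate n (0, [])) := by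
  intro t ht
  rcases List.mem_append.1 ht with ht | ht
  · exact h t ht
  · rw [List.eq_of_mem_replicate ht]; simp

/-! ## Sublists of bounded length -/

/-- The sublists of length at most `k`. -/
def smallSublists (k : ℕ) (l : List β) : List (List β) :=
  l.foldl (fun A a => A ++ (A.filter fun s => decide (s.length < k)).map (a :: ·)) [[]]

theorem smallSublists_append (k : ℕ) (l : List β) (a : β) :
    smallSublists k (l ++ [a]) = smallSublists k l ++
      ((smallSublists k l).filter fun s => decide (s.length < k)).map (a :: ·) := by
  simp only [smallSublists, List.foldl_append, List.foldl_cons, List.foldl_nil]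

/-- For the running time: no intermediate list of the fold is longer than the final one. -/
theorem length_smallSublists_le_append (k : ℕ) (l l' : List β) :
    (smallSublists k l).length ≤ (smallSublists k (l ++ l')).length := by
  induction l' using List.reverseRecOn with
  | nil => simp
  | append_singleton l' a ih =>
    rw [← List.append_assoc, smallSublists_append, List.length_append]
    omega

theorem length_le_of_mem_smallSublists {k : ℕ} {l s : List β} (hs : s ∈ smallSublists k l) :
    s.length ≤ k ∧ ∀ a ∈ s, a ∈ l := by
  induction l using List.reverseRecOn generalizing s with
  | nil => obtain rfl := List.mem_singleton.1 hs; simp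
  | append_singleton l a ih =>
    rw [smallSublists_append, List.mem_append, List.mem_map] at hs
    rcases hs with hs | ⟨s, hs, rfl⟩
    · exact ⟨(ih hs).1, fun c hc => List.mem_append_left _ ((ih hs).2 c hc)⟩
    · rw [List.mem_filter, decide_eq_true_eq] at hs
      refine ⟨hs.2, fun c hc => ?_⟩
      rcases List.mem_cons.1 hc with rfl | hc
      · simp
      · exact List.mem_append_left _ ((ih hs.1).2 c hc)

/-- Pascal's rule along the list; since j ≤ k, the cut-off at length k removes nothing that is
counted. With f constantly true this counts sublists, and with f the truth of clauses it evaluates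
an elementary symmetric polynomial as a binomial coefficient. -/
theorem countP_smallSublists (f : β → Bool) {k j : ℕ} (hj : j ≤ k) (l : List β) :
    (smallSublists k l).countP (fun s => s.length == j && s.all f) =
      (l.countP f).choose j := by
  induction l using List.reverseRecOn generalizing j with
  | nil => cases j <;> simp [smallSublists]
  | append_singleton l a ih =>
    rw [smallSublists_append, List.countP_append, ih hj, List.countP_append, List.countP_map,
      List.countP_filter]
    cases j with
    | zero => simp
    | succ j =>
      by_cases hfa : f a = true
      · have h1 : ((smallSublists k l).countP fun s => ((fun s => s.length == j + 1 && s.all f) ∘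
            (a :: ·)) s && decide (s.length < k)) =
            (smallSublists k l).countP (fun s => s.length == j && s.all f) := by
          refine List.countP_congr fun s _ => ?_
          simp [hfa]
          omega
        rw [h1, ih (by omega)]
        simp [hfa, Nat.choose_succ_succ]
        omega
      · have h1 : ((smallSublists k l).countP fun s => ((fun s => s.length == j + 1 && s.all f) ∘
            (a :: ·)) s && decide (s.length < k)) = 0 := by
          rw [List.countP_eq_zero]
          intro s _
          simp [hfa]
        rw [h1]
        simp [hfa]

theorem length_eq_sum_countP {k : ℕ} (A : List (List β)) (h : ∀ s ∈ A, s.length ≤ k) :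
    A.length = ∑ j ∈ Finset.range (k + 1), A.countP (fun s => s.length == j) := by
  induction A with
  | nil => simp
  | cons s A ih =>
    simp only [List.countP_cons, Finset.sum_add_distrib, List.length_cons]
    rw [← ih fun s hs => h s (by simp [hs])]
    have := h s (by simp)
    have : s.length < k + 1 := by omega
    simp [this]

theorem length_smallSublists (k : ℕ) (l : List β) :
    (smallSublists k l).length = ∑ j ∈ Finset.range (k + 1), l.length.choose j := by
  rw [length_eq_sum_countP _ fun s hs => (length_le_of_mem_smallSublists hs).1]
  refine Finset.sum_congr rfl fun j hj => ?_
  have := countP_smallSublists (fun _ : β => true) (Nat.lt_succ_iff.1 (Finset.mem_range.1 hj)) l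
  rw [List.countP_true] at this
  rw [← this]
  exact List.countP_congr fun s _ => by simp

namespace PTime

variable [Enc α] [Enc β] {b : ι → ℕ} {x : ι → α}

theorem smallSublists {k : ι → ℕ} {l : ι → List β} (hk : PolyBdd b k)
    (hl : PolyBdd b fun i => (l i).length)
    (hs : PolyBdd b fun i => (smallSublists (k i) (l i)).length)
    (pk : PTime b x k) (pl : PTime b x l) : PTime b x (fun i => smallSublists (k i) (l i)) := by
  refine foldl hl pl (const [[]]) ?_
  have hpre : PolyBdd (fun j : ListPos l => b j.i)
      (fun j => (ModCSP.smallSublists (k j.i) j.pre).length) :=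
    (hs.comp (r := ListPos.i)).of_le fun j => by
      rw [j.eq]
      exact length_smallSublists_le_append _ _ _
  refine append hpre id.snd.fst ?_
  have h1 := filter (b := fun j : ListPos l => b j.i)
    (x := fun j => (x j.i, (ModCSP.smallSublists (k j.i) j.pre, j.a)))
    (f := fun j s => decide (s.length < k j.i)) hpre id.snd.fst ?_
  · exact map (f := fun j s => j.a :: s) (hpre.of_le fun j => List.length_filter_le _ _) h1
      (id.fst.snd.snd.cons id.snd)
  · let r := fun j : ListPos (fun j : ListPos l => ModCSP.smallSublists (k j.i) j.pre) => j.i.i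
    have h2 : PolyBdd (fun j => b (r j)) (fun j => j.a.length) :=
      (hk.comp (r := r)).of_le fun j => (length_le_of_mem_smallSublists j.mem).1
    have h3 : PTime (fun j : ListPos l => b j.i)
        (fun j => (x j.i, (ModCSP.smallSublists (k j.i) j.pre, j.a))) (fun j => k j.i) := pk.lift _
    exact lt h2 (id.snd.length h2) (h3.lift _)

theorem headD {l : ι → List (List β)} (h : PTime b x l) : PTime b x (fun i => (l i).headD []) :=
  h.comp (.expr (.hd (.var 0)) (by simp [Tm.varBound]) fun i => by
    simp only [Tm.eval]; cases l i <;> rfl)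

end PTime

/-! ## The reduction along a polynomial given by its monomials -/

/-- A modulus, the multiplier of `mulSat`, a list of clauses, and a polynomial in their values, given
by its monomials. -/
structure PolyInput where
  M : ℕ
  κ : ℕ
  cls : List (List Lit)
  pol : List (List ℕ × ℕ)
  M_pos : 0 < M
  κ_le : κ ≤ M
  good : GoodClauses (3 * cls.length + 1) cls
  coeff_le : ∀ t ∈ pol, t.2 ≤ M
  lt_length : ∀ t ∈ pol, ∀ v ∈ t.1, v < cls.length

namespace PolyInput

variable (i : PolyInput)

/-- The monomials, with clauses in the place of variables. -/
def mons : List (ℕ × List (List Lit)) :=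
  i.pol.map fun t => (t.2, t.1.map fun v => (i.cls.drop v).headD [])

/-- The degree of the polynomial. -/
def deg : ℕ := i.pol.foldl (fun d t => max d t.1.length) 0

/-- The number of multilinear monomials of that degree. -/
def numMon : ℕ := (smallSublists i.deg i.cls).length

/-- The expansion of the polynomial. -/
def terms : List WTerm := expand i.M i.κ i.mons ++ List.replicate i.numMon (0, [])

/-- The number of terms in the expansion. -/
def numTerms : ℕ := (i.pol.map fun t => 9 ^ t.1.length).sum

/-- The size of the input. -/
def size : ℕ := i.M + (3 * i.cls.length + 1 + i.numTerms + i.numMon)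

theorem headD_drop {v : ℕ} (hv : v < i.cls.length) : (i.cls.drop v).headD [] = i.cls[v] := by
  rw [List.drop_eq_getElem_cons hv]; rfl

theorem mons_good : ∀ m ∈ i.mons, m.1 ≤ i.M ∧
    ∀ cl ∈ m.2, cl.length = 3 ∧ ∀ l ∈ cl, l.1 < 3 * i.cls.length + 1 := by
  intro m hm
  obtain ⟨t, ht, rfl⟩ := List.mem_map.1 hm
  refine ⟨i.coeff_le t ht, fun cl hcl => ?_⟩
  obtain ⟨v, hv, rfl⟩ := List.mem_map.1 hcl
  rw [i.headD_drop (i.lt_length t ht v hv)]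
  exact i.good _ (List.getElem_mem _)

theorem length_expand : (expand i.M i.κ i.mons).length = i.numTerms := by
  rw [ModCSP.length_expand fun m hm cl hcl => ((i.mons_good m hm).2 cl hcl).1]
  simp [mons, numTerms, Function.comp_def]

theorem pow_le_numTerms {t : List ℕ × ℕ} (ht : t ∈ i.pol) : 9 ^ t.1.length ≤ i.numTerms :=
  List.single_le_sum (by simp) _ (List.mem_map.2 ⟨t, ht, rfl⟩)

theorem length_le_numTerms {t : List ℕ × ℕ} (ht : t ∈ i.pol) : t.1.length ≤ i.numTerms :=
  (Nat.lt_pow_self (by norm_num)).le.trans (i.pow_le_numTerms ht)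

theorem length_terms : i.terms.length = i.numTerms + i.numMon := by
  simp [terms, length_expand]

theorem bounded_terms : Bounded i.M (3 * i.cls.length + 1) (3 * i.numTerms) i.terms := by
  refine (bounded_expand i.M_pos le_rfl fun m hm =>
    ⟨(i.mons_good m hm).1, ?_, (i.mons_good m hm).2⟩).append_replicate _
  obtain ⟨t, ht, rfl⟩ := List.mem_map.1 hm
  simpa using i.length_le_numTerms ht

theorem tval_terms (y : ℕ → Bool) : tval i.M y i.terms = (i.pol.map fun t => (t.2 : ZMod i.M) *
    (t.1.map fun v => cval i.M i.κ y ((i.cls.drop v).headD [])).prod).sum := by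
  have : NeZero i.M := ⟨i.M_pos.ne'⟩
  rw [terms, tval_append_replicate, tval_expand]
  simp [mons, Function.comp_def]

theorem foldl_max_le {l : List (List ℕ × ℕ)} {d B : ℕ} (hd : d ≤ B)
    (h : ∀ t ∈ l, t.1.length ≤ B) : l.foldl (fun d t => max d t.1.length) d ≤ B := by
  induction l generalizing d with
  | nil => exact hd
  | cons t l ih =>
    exact ih (max_le hd (h t (by simp))) fun t ht => h t (by simp [ht])

theorem deg_le {B : ℕ} (h : ∀ t ∈ i.pol, t.1.length ≤ B) : i.deg ≤ B :=
  foldl_max_le (Nat.zero_le _) h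

theorem le_deg {t : List ℕ × ℕ} (ht : t ∈ i.pol) : t.1.length ≤ i.deg := by
  have h1 : ∀ (l : List (List ℕ × ℕ)) (d : ℕ), d ≤ l.foldl (fun d t => max d t.1.length) d := by
    intro l
    induction l with
    | nil => simp
    | cons s l ih => intro d; exact (le_max_left _ _).trans (ih _)
  have h2 : ∀ (l : List (List ℕ × ℕ)) (d : ℕ), t ∈ l →
      t.1.length ≤ l.foldl (fun d t => max d t.1.length) d := by
    intro l
    induction l with
    | nil => simp
    | cons s l ih =>
      intro d hs
      rcases List.mem_cons.1 hs with rfl | hs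
      · exact (le_max_right _ _).trans (h1 _ _)
      · exact ih _ hs
  exact h2 _ _ ht

/-- The reduction runs in polynomial time. -/
theorem pTime : PTime size (fun i => (i.M, i.κ, i.cls, i.pol))
    (fun i => lin2ModData i.M (3 * i.cls.length + 1) i.terms 0) := by
  have hM : PolyBdd size M := PolyBdd.self.of_le fun i => by simp only [size]; omega
  have hκ : PolyBdd size PolyInput.κ := hM.of_le fun i => i.κ_le
  have hm : PolyBdd size (fun i => i.cls.length) :=
    PolyBdd.self.of_le fun i => by simp only [size]; omega
  have hV : PolyBdd size (fun i => 3 * i.cls.length + 1) :=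
    PolyBdd.self.of_le fun i => by simp only [size]; omega
  have ht : PolyBdd size numTerms := PolyBdd.self.of_le fun i => by simp only [size]; omega
  have hs : PolyBdd size numMon := PolyBdd.self.of_le fun i => by simp only [size]; omega
  have hd : PolyBdd size deg := ht.of_le fun i => i.deg_le fun t ht => i.length_le_numTerms ht
  have hp : PolyBdd size (fun i => i.pol.length) := ht.of_le fun i => by
    simpa [numTerms] using List.length_le_sum_of_one_le (i.pol.map fun t => 9 ^ t.1.length) (by
      simp only [List.mem_map]
      rintro _ ⟨m, -, rfl⟩
      exact Nat.one_le_pow _ _ (by norm_num))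
  have pM : PTime size (fun i => (i.M, i.κ, i.cls, i.pol)) M := PTime.id.fst
  have pκ : PTime size (fun i => (i.M, i.κ, i.cls, i.pol)) PolyInput.κ := PTime.id.snd.fst
  have pcls : PTime size (fun i => (i.M, i.κ, i.cls, i.pol)) cls := PTime.id.snd.snd.fst
  have ppol : PTime size (fun i => (i.M, i.κ, i.cls, i.pol)) pol := PTime.id.snd.snd.snd
  have pV : PTime size (fun i => (i.M, i.κ, i.cls, i.pol)) (fun i => 3 * i.cls.length + 1) :=
    (PTime.mul (PolyBdd.const 3) hm (.const 3) (pcls.length hm)).succ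
  -- The degree is read off the monomials: the degree function of the family is not itself assumed
  -- to be computable.
  have pd : PTime size (fun i => (i.M, i.κ, i.cls, i.pol)) deg := by
    refine PTime.foldl (g := fun _ d t => max d t.1.length) hp ppol (.const 0) ?_
    have h1 : PolyBdd (fun j : ListPos pol => j.i.size) (fun j => j.a.1.length) :=
      (ht.comp (r := ListPos.i)).of_le fun j => j.i.length_le_numTerms j.mem
    exact PTime.max h1 PTime.id.snd.fst (PTime.id.snd.snd.proj_fst.length h1)
  have ps : PTime size (fun i => (i.M, i.κ, i.cls, i.pol)) numMon :=
    (PTime.smallSublists hd hm hs pd pcls).length hs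
  have pmons : PTime size (fun i => (i.M, i.κ, i.cls, i.pol)) mons := by
    have h2 : PTime (fun j : ListPos pol => j.i.size)
      (fun j => ((j.i.M, j.i.κ, j.i.cls, j.i.pol), j.a)) (fun j => j.a) := PTime.id.snd
    refine PTime.map hp ppol (h2.proj_snd.pair ?_)
    refine PTime.map (f := fun j v => (j.i.cls.drop v).headD [])
      ((ht.comp (r := ListPos.i)).of_le fun j => j.i.length_le_numTerms j.mem)
      h2.proj_fst (PTime.headD ?_)
    have h3 : PTime (fun j : ListPos pol => j.i.size)
      (fun j => ((j.i.M, j.i.κ, j.i.cls, j.i.pol), j.a)) (fun j => j.i.cls) := pcls.lift _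
    let r := fun j : ListPos (fun j : ListPos pol => j.a.1) => j.i.i
    exact PTime.drop ((hm.comp (r := r)).of_le fun j => (j.i.i.lt_length _ j.i.mem _ j.mem).le)
      PTime.id.snd (h3.lift _)
  have pL : PTime size (fun i => (i.M, i.κ, i.cls, i.pol)) terms :=
    PTime.append (ht.of_le fun i => i.length_expand.le)
      (PTime.expand hM hκ hM (fun i => i.M_pos) (fun i => le_rfl)
        (fun i m hm => (i.mons_good m hm).1)
        (ht.of_le fun i => by simp [mons, numTerms, Function.comp_def])
        (fun i m hm cl hcl => ((i.mons_good m hm).2 cl hcl).1) pM pκ pmons)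
      (PTime.replicate hs ps (.const (0, [])))
  exact PTime.lin2ModData hM hV hM ((PolyBdd.const 3).mul ht) (PolyBdd.const 0)
    ((ht.add hs).of_le fun i => i.length_terms.le) (fun i => i.bounded_terms) pM pV pL (.const 0)

end PolyInput

/-- A constant factor in the measure goes into the constant and leaves the exponent alone. This is
how exponents stay independent of M. -/
theorem PTimeE.mono_measure [Enc α] [Enc β] {b c : ι → ℕ} {x : ι → α} {y : ι → β} {k : ℕ}
    (h : PTimeE k b x y) (C : ℕ) (hbc : ∀ i, b i + 1 ≤ C * (c i + 1)) : PTimeE k c x y := by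
  obtain ⟨p, N, K, hN, h⟩ := h
  refine ⟨p, N, K * C ^ k, hN, fun i => (h i).mono le_rfl ?_⟩
  rw [mul_assoc, ← mul_pow]
  gcongr
  exact hbc i

theorem pTime_length_clauses :
    PTime (fun i : Σ m, ThreeCNF m => i.1) (fun i => i.2.clauses) (fun i => i.1) :=
  (PTime.length (PolyBdd.self.of_le fun i => by rw [ThreeCNF.length_clauses]) PTime.id).congr
    fun i => i.2.length_clauses

/-! ## Multilinear polynomials -/

section Multilinear

variable {m : ℕ} {p : MvPolynomial (Fin m) ℤ}

theorem eq_one_of_mem_support (hp : ∀ i, p.degreeOf i ≤ 1) {μ : Fin m →₀ ℕ} (hμ : μ ∈ p.support)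
    {i : Fin m} (hi : i ∈ μ.support) : μ i = 1 := by
  have h1 := (MvPolynomial.monomial_le_degreeOf i hμ).trans (hp i)
  have h2 := Finsupp.mem_support_iff.1 hi
  omega

theorem card_support_eq (hp : ∀ i, p.degreeOf i ≤ 1) {μ : Fin m →₀ ℕ} (hμ : μ ∈ p.support) :
    μ.support.card = μ.sum fun _ e => e := by
  rw [Finsupp.sum, Finset.card_eq_sum_ones]
  exact Finset.sum_congr rfl fun i hi => (eq_one_of_mem_support hp hμ hi).symm

theorem card_support_le (hp : ∀ i, p.degreeOf i ≤ 1) {μ : Fin m →₀ ℕ} (hμ : μ ∈ p.support) :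
    μ.support.card ≤ p.totalDegree := by
  rw [card_support_eq hp hμ]
  exact MvPolynomial.le_totalDegree hμ

theorem eval_multilinear (hp : ∀ i, p.degreeOf i ≤ 1) (z : Fin m → ℤ) :
    MvPolynomial.eval z p = ∑ μ ∈ p.support, p.coeff μ * ∏ i ∈ μ.support, z i := by
  rw [MvPolynomial.eval_eq]
  refine Finset.sum_congr rfl fun μ hμ => congrArg _ (Finset.prod_congr rfl fun i hi => ?_)
  rw [eq_one_of_mem_support hp hμ hi, pow_one]

theorem totalDegree_le (hp : ∀ i, p.degreeOf i ≤ 1) : p.totalDegree ≤ m := by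
  refine Finset.sup_le fun μ hμ => ?_
  rw [← card_support_eq hp hμ]
  simpa using Finset.card_le_univ μ.support

/-- The number of subsets of size at most `d`. -/
theorem card_filter_card_le (m d : ℕ) :
    (Finset.univ.filter fun S : Finset (Fin m) => S.card ≤ d).card ≤
      ∑ i ∈ Finset.range (d + 1), m.choose i := by
  have h : (Finset.univ.filter fun S : Finset (Fin m) => S.card ≤ d) ⊆
      (Finset.range (d + 1)).biUnion fun i => Finset.univ.powersetCard i := by
    intro S hS
    simp only [Finset.mem_filter, Finset.mem_univ, true_and] at hS
    simp only [Finset.mem_biUnion, Finset.mem_range, Finset.mem_powersetCard_univ]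
    exact ⟨_, Nat.lt_succ_of_le hS, rfl⟩
  refine (Finset.card_le_card h).trans (Finset.card_biUnion_le.trans (le_of_eq ?_))
  simp

/-- A multilinear monomial is determined by its support. -/
theorem card_monomials_le (hp : ∀ i, p.degreeOf i ≤ 1) :
    p.support.card ≤ ∑ i ∈ Finset.range (p.totalDegree + 1), m.choose i := by
  refine le_trans ?_ (card_filter_card_le m p.totalDegree)
  refine Finset.card_le_card_of_injOn Finsupp.support (fun μ hμ => ?_) fun μ hμ ν hν h => ?_
  · simpa using card_support_le hp hμ
  · ext i
    by_cases hi : i ∈ μ.support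
    · rw [eq_one_of_mem_support hp hμ hi, eq_one_of_mem_support hp hν (h ▸ hi)]
    · have h' : i ∉ ν.support := h ▸ hi
      rw [Finsupp.notMem_support_iff.1 hi, Finsupp.notMem_support_iff.1 h']

/-- A constant cannot separate the all-ones point from its negative. Positivity of the degree is
needed for the estimate involving log(em/f). -/
theorem RepresentsOR.totalDegree_pos {M : ℕ} (h : RepresentsOR M m p) (hm : 0 < m) :
    0 < p.totalDegree := by
  by_contra h0
  have h0 : p.totalDegree = 0 := by omega
  rw [MvPolynomial.totalDegree_eq_zero_iff_eq_C] at h0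
  have h1 := (h.2 1).2 rfl
  rw [h0, MvPolynomial.eval_C] at h1
  have h2 := (h.2 (fun _ => -1)).1 (by rw [h0, MvPolynomial.eval_C]; exact h1)
  have h3 : (-1 : ℤˣ) = 1 := congrFun h2 ⟨0, hm⟩
  exact absurd h3 (by decide)

end Multilinear

/-- The list form of `encPoly`. -/
def polyList (M : ℕ) {d : ℕ} (p : MvPolynomial (Fin d) ℤ) (L : List (Fin d →₀ ℕ)) :
    List (List ℕ × ℕ) :=
  L.map fun μ => ((μ.support.sort (· ≤ ·)).map fun i : Fin d => (i : ℕ), (p.coeff μ % (M : ℤ)).toNat)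

theorem enc_polyList (M : ℕ) {d : ℕ} (p : MvPolynomial (Fin d) ℤ) (L : List (Fin d →₀ ℕ)) :
    enc (polyList M p L) = encPoly M p L := by
  simp only [polyList, encPoly, enc, List.map_map]
  refine congrArg encList (List.map_congr_left fun μ _ => ?_)
  simp only [List.map_map, List.bind_eq_flatMap, List.pure_def, List.map_flatMap, List.map_cons,
    List.map_nil, Function.comp_def]
  exact congrArg (fun l => (encList l).cons _) List.map_eq_flatMap

section Input

variable {M m κ : ℕ} (hM : 0 < M) (hκ : κ ≤ M) {p : MvPolynomial (Fin m) ℤ}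
  (L : List (Fin m →₀ ℕ)) (φ : ThreeCNF m)

/-- The input of the reduction that comes from a polynomial and a formula. -/
def polyInput (p : MvPolynomial (Fin m) ℤ) : PolyInput where
  M := M
  κ := κ
  cls := φ.clauses
  pol := polyList M p L
  M_pos := hM
  κ_le := hκ
  good := by rw [ThreeCNF.length_clauses]; exact φ.goodClauses
  coeff_le t ht := by
    obtain ⟨μ, -, rfl⟩ := List.mem_map.1 ht
    have h1 := Int.emod_lt_of_pos (p.coeff μ) (Int.natCast_pos.2 hM)
    simp only
    omega
  lt_length t ht v hv := by
    obtain ⟨μ, -, rfl⟩ := List.mem_map.1 ht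
    obtain ⟨i, -, rfl⟩ := List.mem_map.1 hv
    rw [ThreeCNF.length_clauses]
    exact i.2

variable (hp : ∀ i, p.degreeOf i ≤ 1) (hL : (L : Multiset (Fin m →₀ ℕ)) = p.support.val)

include hL in
theorem mem_iff_of_coe_eq {μ : Fin m →₀ ℕ} : μ ∈ L ↔ μ ∈ p.support := by
  rw [← Multiset.mem_coe, hL, Finset.mem_val]

include hL in
theorem sum_map_eq_of_coe_eq {R : Type} [AddCommMonoid R] (g : (Fin m →₀ ℕ) → R) :
    (L.map g).sum = ∑ μ ∈ p.support, g μ := by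
  rw [Finset.sum, ← hL, Multiset.map_coe, Multiset.sum_coe]

include hL in
theorem numTerms_polyInput : (polyInput hM hκ L φ p).numTerms =
    ∑ μ ∈ p.support, 9 ^ μ.support.card := by
  rw [← sum_map_eq_of_coe_eq L hL]
  simp [PolyInput.numTerms, polyInput, polyList, Function.comp_def]

include hp hL in
theorem deg_polyInput : (polyInput hM hκ L φ p).deg = p.totalDegree := by
  apply le_antisymm
  · refine PolyInput.deg_le _ fun t ht => ?_
    obtain ⟨μ, hμ, rfl⟩ := List.mem_map.1 ht
    simpa using card_support_le hp ((mem_iff_of_coe_eq L hL).1 hμ)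
  · refine Finset.sup_le fun μ hμ => ?_
    rw [← card_support_eq hp hμ]
    have := (polyInput hM hκ L φ p).le_deg (List.mem_map.2 ⟨μ, (mem_iff_of_coe_eq L hL).2 hμ, rfl⟩)
    simpa using this

include hp hL in
theorem numMon_polyInput : (polyInput hM hκ L φ p).numMon =
    ∑ i ∈ Finset.range (p.totalDegree + 1), m.choose i := by
  rw [PolyInput.numMon, deg_polyInput hM hκ L φ hp hL, length_smallSublists]
  simp [polyInput, ThreeCNF.length_clauses]

-- With 8κ = -2 the factor contributed by a clause is 1 - 2 = -1 when it is false and 1 otherwise,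
-- which is its value in the polynomial.
include hp hL in
theorem tval_polyInput (hκM : M ∣ 8 * κ + 2) (y : ℕ → Bool) :
    tval M y (polyInput hM hκ L φ p).terms =
      ((MvPolynomial.eval (φ.clauseValue fun v => y v) p : ℤ) : ZMod M) := by
  have hcv : ∀ i : Fin m, cval M κ y ((φ.clauses.drop i).headD []) =
      (φ.clauseValue (fun v => y v) i : ZMod M) := by
    intro i
    have h0 : (κ : ZMod M) * 8 = -2 := by
      have := (ZMod.natCast_eq_zero_iff _ _).2 hκM
      push_cast at this
      linear_combination this
    have hi : (i : ℕ) < φ.clauses.length := by rw [φ.length_clauses]; exact i.2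
    rw [show (φ.clauses.drop i).headD [] = φ.clauses[(i : ℕ)] by
      rw [List.drop_eq_getElem_cons hi]; rfl]
    rw [cval, (φ.goodClauses _ (List.getElem_mem hi)).1, ThreeCNF.clauseValue]
    by_cases h : φ.ClauseSat (fun v => y v) i
    · rw [if_pos ((φ.satB_clause y i).2 h), if_pos h]; simp
    · rw [if_neg (fun h' => h ((φ.satB_clause y i).1 h')), if_neg h]
      push_cast
      linear_combination h0
  rw [eval_multilinear hp, ← sum_map_eq_of_coe_eq L hL]
  have hterms : tval M y (polyInput hM hκ L φ p).terms = ((polyList M p L).map fun t =>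
      (t.2 : ZMod M) * (t.1.map fun v => cval M κ y ((φ.clauses.drop v).headD [])).prod).sum :=
    (polyInput hM hκ L φ p).tval_terms y
  rw [hterms]
  simp only [polyList, List.map_map, Int.cast_list_sum]
  refine congrArg List.sum (List.map_congr_left fun μ _ => ?_)
  simp only [Function.comp_def, Int.cast_mul, Int.cast_prod, List.map_map, hcv]
  congr 1
  · have h1 := Int.emod_nonneg (p.coeff μ) (Int.natCast_ne_zero.2 hM.ne')
    rw [← Int.cast_natCast, Int.toNat_of_nonneg h1]
    simp
  · rw [← List.prod_toFinset _ (Finset.sort_nodup _ _), Finset.sort_toFinset]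

end Input

/-- 8 is invertible modulo an odd number. The case c = 2 yields clause values in {-1, 1}, the case c
= 1 yields indicators. -/
theorem exists_dvd_eight_mul_add {M : ℕ} (hM : Odd M) (c : ℕ) : ∃ κ < M, M ∣ 8 * κ + c := by
  have : NeZero M := ⟨hM.pos.ne'⟩
  have h8 : Nat.Coprime 8 M := by
    have := (Nat.coprime_two_left.2 hM).pow_left 3
    simpa using this
  have hu := ZMod.mul_inv_of_unit ((8 : ℕ) : ZMod M) ((ZMod.isUnit_iff_coprime 8 M).2 h8)
  refine ⟨(-(c : ZMod M) * ((8 : ℕ) : ZMod M)⁻¹).val, ZMod.val_lt _, ?_⟩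
  rw [← ZMod.natCast_eq_zero_iff]
  push_cast
  rw [ZMod.natCast_zmod_val]
  push_cast at hu
  linear_combination -(c : ZMod M) * hu

theorem RepresentsOR.clauseValue_iff {M m : ℕ} {p : MvPolynomial (Fin m) ℤ}
    (h : RepresentsOR M m p) (φ : ThreeCNF m) (x : Fin (3 * m) → Bool) :
    ((MvPolynomial.eval (φ.clauseValue x) p : ℤ) : ZMod M) = 0 ↔ ∀ i, φ.ClauseSat x i := by
  classical
  have hz := h.2 fun i => if φ.ClauseSat x i then 1 else -1
  have h1 : (fun i => ((if φ.ClauseSat x i then (1 : ℤˣ) else -1 : ℤˣ) : ℤ)) = φ.clauseValue x := by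
    funext i
    rw [ThreeCNF.clauseValue]
    split_ifs <;> rfl
  rw [h1] at hz
  rw [ZMod.intCast_zmod_eq_zero_iff_dvd, hz, funext_iff]
  refine forall_congr' fun i => ?_
  by_cases hs : φ.ClauseSat x i
  · simp [hs]
  · have h3 : ¬ (-1 : ℤˣ) = 1 := by decide
    simp [hs, h3]

/-- The reduction for a family of polynomials that a program writes down. -/
theorem exists_polyReduction (k : ℕ) : ∃ a : ℕ, ∀ (M : ℕ) (f : ℕ → ℕ), Odd M →
    EfficientOR M f k → ∃ (n : ℕ → ℕ) (R : Prog) (K : ℕ),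
      (∀ (P : Prog) (T : ℕ → ℕ), SolvesLin2Mod P (fun _ => M) T →
        SolvesThreeSat (.seq R P) (fun m => K * n m ^ a + T (n m))) ∧
      ∀ m, 0 < m → 0 < f m ∧ f m ≤ m ∧ m ≤ n m ∧
        n m ≤ 3 * m + 1 + (9 ^ f m + 1) * ∑ i ∈ Finset.range (f m + 1), m.choose i := by
  obtain ⟨k0, h0⟩ := pTime_length_clauses
  obtain ⟨k1, h1⟩ := PolyInput.pTime
  -- The exponent adds those for counting the clauses, for writing down the polynomial and for the
  -- expansion. The modulus, f and the program `G` only enter constants.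
  refine ⟨k0 + k + k1, fun M f hM ⟨p, G, K, hpG⟩ => ?_⟩
  choose hrep hdeg L hL hG using hpG
  obtain ⟨κ, hκ, hκM⟩ := exists_dvd_eight_mul_add hM 2
  let s : ℕ → ℕ := fun m => ∑ i ∈ Finset.range (f m + 1), m.choose i
  -- The summand s m stems from the zero terms. The polynomial may be sparse, yet writing it down
  -- may take time s^k; the filling makes this polynomial in n.
  let n : ℕ → ℕ := fun m => 3 * m + 1 + ∑ μ ∈ (p m).support, 9 ^ μ.support.card + s m
  let inp : (Σ m, ThreeCNF m) → PolyInput := fun i => polyInput hM.pos hκ.le (L i.1) i.2 (p i.1)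
  have hnum : ∀ i, (inp i).numTerms = ∑ μ ∈ (p i.1).support, 9 ^ μ.support.card := fun i =>
    numTerms_polyInput _ _ _ _ (hL i.1)
  have hmon : ∀ i, (inp i).numMon = s i.1 := fun i => by
    simp only [s, inp]
    rw [numMon_polyInput hM.pos hκ.le (L i.1) i.2 (hrep i.1).1 (hL i.1), hdeg]
  have hcls : ∀ i, (inp i).cls.length = i.1 := fun i => i.2.length_clauses
  have hlen : ∀ i, 3 * (inp i).cls.length + 1 + (inp i).terms.length = n i.1 := fun i => by
    rw [PolyInput.length_terms, hnum, hmon, hcls]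
    simp only [n]
    omega
  have hI : ∀ i : Σ m, ThreeCNF m, ∃ I : Lin2Mod M (n i.1), I.enc =
      enc (lin2ModData (inp i).M (3 * (inp i).cls.length + 1) (inp i).terms 0) ∧
      (I.Satisfiable ↔ i.2.Satisfiable) := by
    intro i
    obtain ⟨I, hI1, hI2⟩ := exists_lin2Mod (σ := 0) (inp i).M_pos (hlen i) (inp i).bounded_terms
    refine ⟨I, hI1, hI2.trans ?_⟩
    rw [ThreeCNF.Satisfiable]
    have h3 : ∀ y : ℕ → Bool, tval M y (inp i).terms + (0 : ℕ) = 0 ↔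
        ∀ j, i.2.ClauseSat (fun v => y v) j := fun y => by
      rw [Nat.cast_zero, add_zero, ← (hrep i.1).clauseValue_iff]
      simp only [inp]
      rw [tval_polyInput hM.pos hκ.le (L i.1) i.2 (hrep i.1).1 (hL i.1) hκM]
    constructor
    · rintro ⟨y, hy⟩
      exact ⟨_, (h3 y).1 hy⟩
    · rintro ⟨x, hx⟩
      refine ⟨fun v => if h : v < 3 * i.1 then x ⟨v, h⟩ else false, (h3 _).2 ?_⟩
      simpa using hx
  have hG' : PTimeE k (fun i : Σ m, ThreeCNF m => n i.1) (fun i => i.1)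
      (fun i => (inp i).pol) := by
    obtain ⟨q, N, C, hN, hq⟩ := exists_runs_of_outputsWithin G
    refine ⟨q, N, K + C, hN, fun i => ?_⟩
    have := hq _ _ _ (hG i.1)
    rw [← enc_polyList] at this
    refine this.mono le_rfl ?_
    rw [add_mul]
    refine Nat.add_le_add ?_ (le_mul_pow_succ _ _ _)
    gcongr
    simp only [n, s]
    omega
  have h0' : PTimeE (k0 + k + k1) (fun i : Σ m, ThreeCNF m => n i.1) (fun i => i.2.clauses)
      (fun i => i.1) := (h0.mono_measure 1 fun i => by simp only [n]; omega).mono (by omega)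
  have h1' : PTimeE (k0 + k + k1) (fun i : Σ m, ThreeCNF m => n i.1)
      (fun i => ((inp i).M, (inp i).κ, (inp i).cls, (inp i).pol))
      (fun i => lin2ModData (inp i).M (3 * (inp i).cls.length + 1) (inp i).terms 0) := by
    refine ((h1.reindex inp).mono_measure (M + 1) fun i => ?_).mono (by omega)
    have h2 : (inp i).size = M + n i.1 := by
      rw [PolyInput.size, hnum, hmon, hcls]
      rfl
    rw [h2]
    nlinarith
  have hall := (((PTimeE.const M).pair ((PTimeE.const κ).pair (PTimeE.id.pair
    (h0'.comp (hG'.mono (by omega)))))).comp h1')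
  obtain ⟨R, C, hR⟩ := exists_reduction (μ := fun _ => M) (n := n) (b := n) _ hI hall
  refine ⟨n, R, C * 2 ^ (k0 + k + k1), fun P T hP m φ => ?_, fun m hm => ?_⟩
  · obtain ⟨o, ⟨t, ht, r⟩, ho⟩ := hR P T hP m φ
    refine ⟨o, ⟨t, ht.trans (Nat.add_le_add_right ?_ _), r⟩, ho⟩
    rw [mul_assoc, ← mul_pow]
    gcongr
    simp only [n]
    omega
  · rw [← hdeg m]
    refine ⟨(hrep m).totalDegree_pos hm, totalDegree_le (hrep m).1, ?_, ?_⟩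
    · simp only [n]; omega
    · have h4 : ∑ μ ∈ (p m).support, 9 ^ μ.support.card ≤ 9 ^ (p m).totalDegree * s m := by
        calc ∑ μ ∈ (p m).support, 9 ^ μ.support.card
            ≤ ∑ μ ∈ (p m).support, 9 ^ (p m).totalDegree := Finset.sum_le_sum fun μ hμ =>
              Nat.pow_le_pow_right (by norm_num) (card_support_le (hrep m).1 hμ)
          _ = (p m).support.card * 9 ^ (p m).totalDegree := by simp
          _ ≤ 9 ^ (p m).totalDegree * s m := by
            rw [mul_comm]
            simp only [s, ← hdeg m]
            gcongr
            exact card_monomials_le (hrep m).1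
      simp only [n]
      simp only [s, ← hdeg m] at h4 ⊢
      rw [add_mul, one_mul]
      omega

/-! ## The reduction with disjoint blocks of clauses -/

theorem cval_eq_of_dvd {M κ : ℕ} (hκ : M ∣ 8 * κ + 1) (y : ℕ → Bool) {cl : List Lit}
    (hcl : cl.length = 3) : cval M κ y cl = if satB y cl then 1 else 0 := by
  have h0 := (ZMod.natCast_eq_zero_iff _ _).2 hκ
  push_cast at h0
  rw [cval, hcl]
  split_ifs
  · simp
  · linear_combination h0

theorem prod_map_ite {R : Type} [CommSemiring R] (f : β → Bool) (l : List β) :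
    (l.map fun a => if f a then (1 : R) else 0).prod = if l.all f then 1 else 0 := by
  induction l with
  | nil => simp
  | cons a l ih =>
    rw [List.map_cons, List.prod_cons, ih, List.all_cons]
    cases f a <;> simp

theorem sum_map_ite {R : Type} [CommSemiring R] (f : β → Bool) (l : List β) :
    (l.map fun a => if f a then (1 : R) else 0).sum = (l.countP f : R) := by
  induction l with
  | nil => simp
  | cons a l ih =>
    rw [List.map_cons, List.sum_cons, ih, List.countP_cons]
    cases f a <;> simp [add_comm]

/-- The number of variables that the blocks need. -/
def blockSize (M m : ℕ) : ℕ := 3 * m + 1 + (M - 1) * 9 ^ (m / (M - 1) + 1)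

/-- A modulus, a number of variables and a list of clauses. -/
structure BlockInput where
  M : ℕ
  n : ℕ
  cls : List (List Lit)
  odd : Odd M
  three_le : 3 ≤ M
  good : GoodClauses (3 * cls.length + 1) cls
  le : blockSize M cls.length ≤ n

namespace BlockInput

variable (i : BlockInput)

/-- The length of a block. -/
def width : ℕ := i.cls.length / (i.M - 1) + 1

/-- The blocks. -/
def blocks : List (List (List Lit)) :=
  (List.range (i.M - 1)).map fun j => (i.cls.drop (j * i.width)).take i.width

/-- The inverse of `-8` modulo `M`. -/
def mult : ℕ := Nat.find (p := fun κ => M i ∣ 8 * κ + 1)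
  ((exists_dvd_eight_mul_add i.odd 1).imp fun _ h => h.2)

theorem mult_spec : i.M ∣ 8 * i.mult + 1 :=
  Nat.find_spec (p := fun κ => M i ∣ 8 * κ + 1) _

theorem mult_le : i.mult ≤ i.M := by
  obtain ⟨κ, h1, h2⟩ := exists_dvd_eight_mul_add i.odd 1
  exact (Nat.find_min' (p := fun κ => M i ∣ 8 * κ + 1) _ h2).trans h1.le

/-- The expansion of the sum over the blocks of the conjunctions. -/
def sumTerms : List WTerm := expand i.M i.mult (i.blocks.map fun c => (1, c))

/-- The expansion, filled up to the right length. -/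
def terms : List WTerm :=
  i.sumTerms ++ List.replicate (i.n - (3 * i.cls.length + 1) - i.sumTerms.length) (0, [])

theorem mem_of_mem_blocks {c : List (List Lit)} (hc : c ∈ i.blocks) {cl : List Lit}
    (hcl : cl ∈ c) : cl ∈ i.cls := by
  obtain ⟨j, -, rfl⟩ := List.mem_map.1 hc
  exact List.mem_of_mem_drop (List.mem_of_mem_take hcl)

theorem length_le_width {c : List (List Lit)} (hc : c ∈ i.blocks) : c.length ≤ i.width := by
  obtain ⟨j, -, rfl⟩ := List.mem_map.1 hc
  exact List.length_take_le _ _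

/-- Clause number v lies in block v / width. The blocks suffice because the width, being the
quotient by M - 1 plus one, times M - 1 exceeds the number of clauses. -/
theorem exists_block {cl : List Lit} (hcl : cl ∈ i.cls) : ∃ c ∈ i.blocks, cl ∈ c := by
  obtain ⟨v, hv, rfl⟩ := List.getElem_of_mem hcl
  have h3 := i.three_le
  have hw : 0 < i.width := Nat.succ_pos _
  have hj : v / i.width < i.M - 1 := by
    rw [Nat.div_lt_iff_lt_mul hw]
    refine hv.trans ?_
    rw [width, mul_comm]
    exact Nat.lt_mul_of_div_lt (Nat.lt_succ_self _) (by omega)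
  refine ⟨_, List.mem_map.2 ⟨v / i.width, List.mem_range.2 hj, rfl⟩, ?_⟩
  rw [List.mem_take_iff_getElem]
  have h1 := Nat.div_add_mod v i.width
  have h2 := Nat.mod_lt v hw
  rw [mul_comm] at h1
  refine ⟨v % i.width, ?_, ?_⟩
  · rw [List.length_drop]; omega
  · rw [List.getElem_drop]
    congr 1

theorem sum_pow_le : ((i.blocks.map fun c => (1, c)).map fun m : ℕ × List (List Lit) =>
    9 ^ m.2.length).sum ≤ (i.M - 1) * 9 ^ i.width := by
  have := List.sum_le_card_nsmul ((i.blocks.map fun c => (1, c)).map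
    fun m : ℕ × List (List Lit) => 9 ^ m.2.length) (9 ^ i.width) (by
      intro x hx
      simp only [List.map_map, List.mem_map] at hx
      obtain ⟨c, hc, rfl⟩ := hx
      exact Nat.pow_le_pow_right (by norm_num) (i.length_le_width hc))
  simpa [blocks] using this

theorem mons_good : ∀ m ∈ i.blocks.map fun c => (1, c), m.1 ≤ i.M ∧ m.2.length ≤ i.width ∧
    ∀ cl ∈ m.2, cl.length = 3 ∧ ∀ l ∈ cl, l.1 < 3 * i.cls.length + 1 := by
  intro m hm
  obtain ⟨c, hc, rfl⟩ := List.mem_map.1 hm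
  exact ⟨i.odd.pos, i.length_le_width hc, fun cl hcl => i.good _ (i.mem_of_mem_blocks hc hcl)⟩

theorem length_sumTerms : i.sumTerms.length ≤ (i.M - 1) * 9 ^ i.width := by
  rw [sumTerms, length_expand fun m hm cl hcl => ((i.mons_good m hm).2.2 cl hcl).1]
  exact i.sum_pow_le

theorem length_terms : 3 * i.cls.length + 1 + i.terms.length = i.n := by
  have h1 := i.length_sumTerms
  have h2 := i.le
  rw [blockSize] at h2
  rw [terms, List.length_append, List.length_replicate]
  rw [width] at h1
  omega

theorem bounded_terms : Bounded i.M (3 * i.cls.length + 1) (3 * i.width) i.terms :=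
  (bounded_expand i.odd.pos le_rfl i.mons_good).append_replicate _

/-- The weighted sum is the number of satisfied blocks. It lies between 0 and M - 1, so adding 1
gives a multiple of M only if all M - 1 blocks are satisfied. -/
theorem tval_terms (y : ℕ → Bool) :
    tval i.M y i.terms + (1 : ℕ) = 0 ↔ ∀ cl ∈ i.cls, satB y cl = true := by
  have : NeZero i.M := ⟨i.odd.pos.ne'⟩
  have h3 := i.three_le
  have h1 : tval i.M y i.terms = (i.blocks.countP fun c => c.all (satB y) : ℕ) := by
    rw [terms, tval_append_replicate, sumTerms, tval_expand, ← sum_map_ite, List.map_map]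
    refine congrArg List.sum (List.map_congr_left fun c hc => ?_)
    simp only [Function.comp, Nat.cast_one, one_mul]
    rw [← prod_map_ite]
    refine congrArg List.prod (List.map_congr_left fun cl hcl => ?_)
    exact cval_eq_of_dvd i.mult_spec y (i.good _ (i.mem_of_mem_blocks hc hcl)).1
  have hlen : i.blocks.length = i.M - 1 := by simp [blocks]
  have h2 : (i.blocks.countP fun c => c.all (satB y)) ≤ i.M - 1 := hlen ▸ List.countP_le_length
  rw [h1, ← Nat.cast_add, ZMod.natCast_eq_zero_iff]
  have h4 : (i.M ∣ (i.blocks.countP fun c => c.all (satB y)) + 1) ↔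
      (i.blocks.countP fun c => c.all (satB y)) = i.blocks.length := by
    rw [hlen]
    constructor
    · intro h
      have := Nat.le_of_dvd (Nat.succ_pos _) h
      omega
    · intro h
      rw [h, Nat.sub_add_cancel (by omega)]
  rw [h4, List.countP_eq_length]
  simp only [List.all_eq_true]
  constructor
  · intro h cl hcl
    obtain ⟨c, hc, hcl⟩ := i.exists_block hcl
    exact h c hc cl hcl
  · intro h c hc cl hcl
    exact h cl (i.mem_of_mem_blocks hc hcl)

/-- The reduction runs in polynomial time. -/
theorem pTime : PTime n (fun i => (i.M, i.n, i.cls))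
    (fun i => lin2ModData i.M (3 * i.cls.length + 1) i.terms 1) := by
  have hle : ∀ i : BlockInput, 3 * i.cls.length + 1 + (i.M - 1) * 9 ^ i.width ≤ i.n :=
    fun i => i.le
  have hpow : PolyBdd n (fun i => (i.M - 1) * 9 ^ i.width) :=
    PolyBdd.self.of_le fun i => by have := hle i; omega
  have hM1 : PolyBdd n (fun i => i.M - 1) := hpow.of_le fun i =>
    Nat.le_mul_of_pos_right _ (Nat.pow_pos (by norm_num))
  have hM : PolyBdd n M := (hM1.add (PolyBdd.const 1)).of_le fun i => by
    have := i.three_le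
    omega
  have hm : PolyBdd n (fun i => i.cls.length) :=
    PolyBdd.self.of_le fun i => by have := hle i; omega
  have hV : PolyBdd n (fun i => 3 * i.cls.length + 1) :=
    PolyBdd.self.of_le fun i => by have := hle i; omega
  have hw : PolyBdd n width := (hm.add (PolyBdd.const 1)).of_le fun i => by
    have := Nat.div_le_self i.cls.length (i.M - 1)
    simp only [width]
    omega
  have hκ : PolyBdd n mult := hM.of_le mult_le
  have pM : PTime n (fun i => (i.M, i.n, i.cls)) M := PTime.id.fst
  have pn : PTime n (fun i => (i.M, i.n, i.cls)) n := PTime.id.snd.fst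
  have pcls : PTime n (fun i => (i.M, i.n, i.cls)) cls := PTime.id.snd.snd
  have pM1 : PTime n (fun i => (i.M, i.n, i.cls)) (fun i => i.M - 1) := pM.pred
  have pV : PTime n (fun i => (i.M, i.n, i.cls)) (fun i => 3 * i.cls.length + 1) :=
    (PTime.mul (PolyBdd.const 3) hm (.const 3) (pcls.length hm)).succ
  have pw : PTime n (fun i => (i.M, i.n, i.cls)) width :=
    (PTime.div hm hM1 (pcls.length hm) pM1).succ
  have pκ : PTime n (fun i => (i.M, i.n, i.cls)) mult := by
    refine PTime.find (P := fun i k => (8 * k + 1) % i.M == 0) hκ (fun i => ?_)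
      (fun i j hj => ?_) ?_
    · simpa using Nat.mod_eq_zero_of_dvd i.mult_spec
    · have := Nat.find_min (p := fun κ => M i ∣ 8 * κ + 1) _ hj
      simpa [Nat.dvd_iff_mod_eq_zero] using this
    · let r := fun j : {j : BlockInput × ℕ // j.2 ≤ j.1.mult} => j.1.1
      have h1 : PolyBdd (fun j => n (r j)) (fun j => j.1.2) :=
        (hκ.comp (r := r)).of_le fun j => j.2
      have h2 : PolyBdd (fun j => n (r j)) (fun j => 8 * j.1.2 + 1) :=
        ((PolyBdd.const 8).mul h1).succ
      exact PTime.beq (h2.of_le fun j => Nat.mod_le _ _) (PolyBdd.const 0)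
        (PTime.mod h2 (hM.comp (r := r)) (PTime.mul (PolyBdd.const 8) h1 (.const 8)
          PTime.id.snd).succ (pM.lift r)) (.const 0)
  have pb : PTime n (fun i => (i.M, i.n, i.cls)) blocks := by
    refine PTime.map (f := fun i j => (i.cls.drop (j * i.width)).take i.width)
      (hM1.of_le fun i => by simp) (PTime.range hM1 pM1) ?_
    have h1 : PolyBdd (fun j : ListPos fun i : BlockInput => List.range (i.M - 1) => j.i.n)
        (fun j => j.a) := (hM1.comp (r := ListPos.i)).of_le fun j => (List.mem_range.1 j.mem).le
    have hw' := hw.comp (r := fun j : ListPos fun i : BlockInput => List.range (i.M - 1) => j.i)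
    exact PTime.take hw' ((hm.comp (r := ListPos.i)).of_le fun j => by simp) (pw.lift _)
      (PTime.drop (h1.mul hw') (PTime.mul h1 hw' PTime.id.snd (pw.lift _)) (pcls.lift _))
  have hs : PolyBdd n (fun i => i.sumTerms.length) := hpow.of_le length_sumTerms
  have hbl : PolyBdd n (fun i => i.blocks.length) := hM1.of_le fun i => by simp [blocks]
  have ps : PTime n (fun i => (i.M, i.n, i.cls)) sumTerms :=
    PTime.expand hM hκ hM (fun i => i.odd.pos) (fun i => le_rfl)
      (fun i m hm => (i.mons_good m hm).1) (hpow.of_le sum_pow_le)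
      (fun i m hm cl hcl => ((i.mons_good m hm).2.2 cl hcl).1) pM pκ
      (PTime.map (f := fun _ c => (1, c)) hbl pb ((PTime.const 1).pair PTime.id.snd))
  have hpad : PolyBdd n (fun i => i.n - (3 * i.cls.length + 1) - i.sumTerms.length) :=
    PolyBdd.self.of_le fun i => by omega
  have pt : PTime n (fun i => (i.M, i.n, i.cls)) terms :=
    PTime.append hs ps (PTime.replicate hpad (PTime.sub hs (PTime.sub hV pn pV) (ps.length hs))
      (.const (0, [])))
  exact PTime.lin2ModData hM hV hM ((PolyBdd.const 3).mul hw) (PolyBdd.const 1)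
    (PolyBdd.self.of_le fun i => by have := i.length_terms; omega) (fun i => i.bounded_terms)
    pM pV pt (.const 1)

/-- The input that comes from a formula. -/
def ofFormula {M n m : ℕ} (hM : Odd M) (h3 : 3 ≤ M) (φ : ThreeCNF m) (hn : blockSize M m ≤ n) :
    BlockInput where
  M := M
  n := n
  cls := φ.clauses
  odd := hM
  three_le := h3
  good := by rw [ThreeCNF.length_clauses]; exact φ.goodClauses
  le := by rw [ThreeCNF.length_clauses]; exact hn

end BlockInput

/-- The block reduction, when the modulus and the number of variables can be computed. -/
theorem exists_blockReduction_of_pTimeE {k : ℕ} (hk : PTimeE k BlockInput.n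
      (fun i => (i.M, i.n, i.cls)) (fun i => lin2ModData i.M (3 * i.cls.length + 1) i.terms 1))
    {μ n : ℕ → ℕ} (hμ : ∀ n, Odd (μ n)) (h3 : ∀ n, 3 ≤ μ n)
    (hn : ∀ m, blockSize (μ (n m)) m ≤ n m)
    (pn : PTimeE k (fun i : Σ m, ThreeCNF m => n i.1) (fun i => i.2.clauses)
      (fun i => (μ (n i.1), n i.1))) :
    ∃ (R : Prog) (K : ℕ), ∀ (P : Prog) (T : ℕ → ℕ), SolvesLin2Mod P μ T →
      SolvesThreeSat (.seq R P) (fun m => K * (n m + 1) ^ k + T (n m)) := by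
  let inp : (Σ m, ThreeCNF m) → BlockInput := fun i =>
    BlockInput.ofFormula (hμ _) (h3 _) i.2 (hn i.1)
  have pc : PTimeE k (fun i : Σ m, ThreeCNF m => n i.1) (fun i => i.2.clauses)
      (fun i => ((inp i).M, (inp i).n, (inp i).cls)) :=
    PTimeE.pair (PTimeE.fst pn) (PTimeE.pair (PTimeE.snd pn) PTimeE.id)
  refine exists_reduction (μ := μ) (n := n) (b := n) _ (fun i => ?_) (pc.comp (hk.reindex inp))
  obtain ⟨I, hI1, hI2⟩ := exists_lin2Mod (σ := 1) (inp i).odd.pos (inp i).length_terms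
    (inp i).bounded_terms
  exact ⟨I, hI1, hI2.trans ((exists_congr fun y => (inp i).tval_terms y).trans
    i.2.satisfiable_iff.symm)⟩

/-- The block reduction for a fixed modulus. -/
theorem exists_blockReduction : ∃ a : ℕ, ∀ M : ℕ, Odd M → 3 ≤ M → ∃ (R : Prog) (K : ℕ),
    ∀ (P : Prog) (T : ℕ → ℕ), SolvesLin2Mod P (fun _ => M) T →
      SolvesThreeSat (.seq R P) (fun m => K * (blockSize M m + 1) ^ a + T (blockSize M m)) := by
  obtain ⟨k0, h0⟩ := pTime_length_clauses
  obtain ⟨k1, h1⟩ := BlockInput.pTime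
  -- M is treated as part of the input here, so that one exponent serves all moduli.
  have h2 : PTime (fun i : {i : ℕ × ℕ // 3 ≤ i.1} => blockSize i.1.1 i.1.2) (fun i => i.1)
      (fun i => blockSize i.1.1 i.1.2) := by
    have hself := PolyBdd.self (b := fun i : {i : ℕ × ℕ // 3 ≤ i.1} => blockSize i.1.1 i.1.2)
    have hm : PolyBdd (fun i : {i : ℕ × ℕ // 3 ≤ i.1} => blockSize i.1.1 i.1.2)
        (fun i => i.1.2) := hself.of_le fun i => by simp only [blockSize]; omega
    have hpow : PolyBdd (fun i : {i : ℕ × ℕ // 3 ≤ i.1} => blockSize i.1.1 i.1.2)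
        (fun i => (i.1.1 - 1) * 9 ^ (i.1.2 / (i.1.1 - 1) + 1)) :=
      hself.of_le fun i => by simp only [blockSize]; omega
    have hM : PolyBdd (fun i : {i : ℕ × ℕ // 3 ≤ i.1} => blockSize i.1.1 i.1.2)
        (fun i => i.1.1 - 1) := hpow.of_le fun i =>
      Nat.le_mul_of_pos_right _ (Nat.pow_pos (by norm_num))
    have h9 : PolyBdd (fun i : {i : ℕ × ℕ // 3 ≤ i.1} => blockSize i.1.1 i.1.2)
        (fun i => 9 ^ (i.1.2 / (i.1.1 - 1) + 1)) := hpow.of_le fun i => by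
      have := i.2
      exact Nat.le_mul_of_pos_left _ (by omega)
    have hw : PolyBdd (fun i : {i : ℕ × ℕ // 3 ≤ i.1} => blockSize i.1.1 i.1.2)
        (fun i => i.1.2 / (i.1.1 - 1) + 1) := h9.of_le fun i => (Nat.lt_pow_self (by norm_num)).le
    have h10 : PolyBdd (fun i : {i : ℕ × ℕ // 3 ≤ i.1} => blockSize i.1.1 i.1.2)
        (fun i => (9 + 1) ^ (i.1.2 / (i.1.1 - 1) + 1)) := (h9.mul h9).of_le fun i => by
      rw [← mul_pow]
      exact Nat.pow_le_pow_left (by norm_num) _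
    have pM : PTime (fun i : {i : ℕ × ℕ // 3 ≤ i.1} => blockSize i.1.1 i.1.2) (fun i => i.1)
      (fun i => i.1.1 - 1) := PTime.id.proj_fst.pred
    have pm : PTime (fun i : {i : ℕ × ℕ // 3 ≤ i.1} => blockSize i.1.1 i.1.2) (fun i => i.1)
      (fun i => i.1.2) := PTime.id.proj_snd
    exact PTime.add hpow (PTime.mul (PolyBdd.const 3) hm (.const 3) pm).succ
      (PTime.mul hM h9 pM (PTime.pow (PolyBdd.const 9) hw h10 (.const 9)
        (PTime.div hm hM pm pM).succ))
  obtain ⟨k2, h2⟩ := h2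
  refine ⟨k0 + k1 + k2, fun M hM h3 => exists_blockReduction_of_pTimeE (μ := fun _ => M)
    (h1.mono (by omega)) (fun _ => hM) (fun _ => h3) (fun m => le_rfl) ?_⟩
  have h0' : PTimeE (k0 + k1 + k2) (fun i : Σ m, ThreeCNF m => blockSize M i.1)
      (fun i => i.2.clauses) (fun i => i.1) :=
    (h0.mono_measure 1 fun i => by simp only [blockSize]; omega).mono (by omega)
  exact (PTimeE.const M).pair (((PTimeE.const M).pair h0').comp
    ((h2.reindex fun i : Σ m, ThreeCNF m => ⟨(M, i.1), h3⟩).mono (by omega)))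

/-- Repeated multiplication by `9` that stops beyond `n`. -/
def cappedMul (n x : ℕ) : ℕ → ℕ
  | 0 => x
  | j + 1 => if cappedMul n x j ≤ n then cappedMul n x j * 9 else cappedMul n x j

theorem cappedMul_le (n x j : ℕ) : cappedMul n x j ≤ x + 9 * n := by
  induction j with
  | zero => simp [cappedMul]
  | succ j ih =>
    rw [cappedMul]
    split_ifs <;> omega

theorem cappedMul_spec (n x j : ℕ) : cappedMul n x j ≤ x * 9 ^ j ∧
    (cappedMul n x j ≤ n → cappedMul n x j = x * 9 ^ j) := by
  induction j with
  | zero => simp [cappedMul]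
  | succ j ih =>
    rw [cappedMul, pow_succ, ← mul_assoc]
    split_ifs with h
    · rw [ih.2 h]; simp
    · exact ⟨ih.1.trans (Nat.le_mul_of_pos_right _ (by norm_num)), fun h' => absurd h' h⟩

/-- Below the cap the product is exact, and beyond it both sides fail. The comparison with n thus
never requires computing a huge power. -/
theorem add_cappedMul_le_iff (n x j v : ℕ) : v + cappedMul n x j ≤ n ↔ v + x * 9 ^ j ≤ n := by
  have h := cappedMul_spec n x j
  constructor
  · intro h1
    rwa [← h.2 (by omega)]
  · intro h1
    have := h.1
    omega

/-- The block reduction for a growing modulus. -/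
theorem exists_growingReduction {μ : ℕ → ℕ} (hμ : ∀ n, Odd (μ n)) (h3 : ∀ n, 3 ≤ μ n)
    (hp : PolyTimeNat μ) {C : ℕ} (hC : ∀ n, μ n ≤ n + C) (n : ℕ → ℕ)
    (hn : ∀ m, blockSize (μ (n m)) m ≤ n m) (hmin : ∀ m, ∀ j < n m, j < blockSize (μ j) m) :
    ∃ (a : ℕ) (R : Prog) (K : ℕ), ∀ (P : Prog) (T : ℕ → ℕ), SolvesLin2Mod P μ T →
      SolvesThreeSat (.seq R P) (fun m => K * (n m + 1) ^ a + T (n m)) := by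
  have pμ : PTime (fun n : ℕ => n) (fun n => n) μ := by
    obtain ⟨G, K, k, hG⟩ := hp
    obtain ⟨q, N, C, hN, hq⟩ := exists_runs_of_outputsWithin G
    refine ⟨k, q, N, K + C, hN, fun i => (hq _ _ _ (hG i)).mono le_rfl ?_⟩
    rw [add_mul]
    exact Nat.add_le_add_left (le_mul_pow_succ _ _ _) _
  have hnm : ∀ m, 3 * m + 1 ≤ n m := fun m => (Nat.le_add_right _ _).trans (hn m)
  have pm : PTime (fun i : Σ m, ThreeCNF m => n i.1) (fun i => i.2.clauses) (fun i => i.1) :=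
    pTime_length_clauses.mono (PolyBdd.self.of_le fun i => by have := hnm i.1; omega)
  have pn : PTime (fun i : Σ m, ThreeCNF m => n i.1) (fun i => i.2.clauses) (fun i => n i.1) := by
    -- The number of variables is found by trying 0, 1, 2, …. For small j the modulus μ j may be
    -- small and the block size exponential in the number of clauses, hence the capped product.
    refine PTime.find (P := fun i j => decide (3 * i.1 + 1 +
      cappedMul j (μ j - 1) (i.1 / (μ j - 1) + 1) ≤ j)) PolyBdd.self (fun i => ?_)
      (fun i j hj => ?_) ?_
    · rw [decide_eq_true_eq, add_cappedMul_le_iff]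
      exact hn i.1
    · rw [decide_eq_false_iff_not, add_cappedMul_le_iff, not_le]
      exact hmin i.1 j hj
    · let r := fun j : {j : (Σ m, ThreeCNF m) × ℕ // j.2 ≤ n j.1.1} => j.1.1
      have hj : PolyBdd (fun j => n (r j).1) (fun j => j.1.2) := PolyBdd.self.of_le fun j => j.2
      have hm : PolyBdd (fun j => n (r j).1) (fun j => j.1.1.1) :=
        PolyBdd.self.of_le fun j => by
          have := hnm j.1.1.1
          simp only [r]
          omega
      have hM : PolyBdd (fun j => n (r j).1) (fun j => μ j.1.2 - 1) :=
        (hj.add (PolyBdd.const C)).of_le fun j => (Nat.sub_le _ _).trans (hC _)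
      have hw : PolyBdd (fun j => n (r j).1) (fun j => j.1.1.1 / (μ j.1.2 - 1) + 1) :=
        hm.succ.of_le fun j => Nat.succ_le_succ (Nat.div_le_self _ _)
      have hcap : PolyBdd (fun j => n (r j).1) (fun j => μ j.1.2 - 1 + 9 * j.1.2) :=
        hM.add ((PolyBdd.const 9).mul hj)
      have qj : PTime (fun j => n (r j).1) (fun j => (j.1.1.2.clauses, j.1.2)) (fun j => j.1.2) :=
        PTime.id.snd
      have qm : PTime (fun j => n (r j).1) (fun j => (j.1.1.2.clauses, j.1.2))
        (fun j => j.1.1.1) := pm.lift r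
      have qM : PTime (fun j => n (r j).1) (fun j => (j.1.1.2.clauses, j.1.2))
          (fun j => μ j.1.2 - 1) :=
        (qj.comp ((pμ.reindex fun j : {j : (Σ m, ThreeCNF m) × ℕ // j.2 ≤ n j.1.1} =>
          j.1.2).mono hj)).pred
      have qw : PTime (fun j => n (r j).1) (fun j => (j.1.1.2.clauses, j.1.2))
        (fun j => j.1.1.1 / (μ j.1.2 - 1) + 1) := (PTime.div hm hM qm qM).succ
      have qc : PTime (fun j => n (r j).1) (fun j => (j.1.1.2.clauses, j.1.2))
          (fun j => cappedMul j.1.2 (μ j.1.2 - 1) (j.1.1.1 / (μ j.1.2 - 1) + 1)) := by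
        refine PTime.natRec (st := fun (j : {j : (Σ m, ThreeCNF m) × ℕ // j.2 ≤ n j.1.1}) k =>
          cappedMul j.1.2 (μ j.1.2 - 1) k) hw qw (by exact qM) ?_
        let s := fun j : {j : {j : (Σ m, ThreeCNF m) × ℕ // j.2 ≤ n j.1.1} × ℕ //
          j.2 < j.1.1.1.1 / (μ j.1.1.2 - 1) + 1} => j.1.1
        have hc' := (hcap.comp (r := s)).of_le (f := fun j => cappedMul j.1.1.1.2
          (μ j.1.1.1.2 - 1) j.1.2) fun j => cappedMul_le _ _ _
        have qs : PTime (fun j => n (r (s j)).1) (fun j => (((s j).1.1.2.clauses, (s j).1.2),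
            (j.1.2, cappedMul j.1.1.1.2 (μ j.1.1.1.2 - 1) j.1.2)))
            (fun j => cappedMul j.1.1.1.2 (μ j.1.1.1.2 - 1) j.1.2) :=
          PTime.snd (y := fun j => j.1.2) (PTime.snd (y := fun j => ((s j).1.1.2.clauses, (s j).1.2))
            PTime.id)
        have h1 := PTime.le (hj.comp (r := s)) qs (qj.lift s)
        refine (h1.ite (PTime.mul hc' (PolyBdd.const 9) qs (.const 9)) qs).congr fun j => ?_
        simp only [cappedMul, s, decide_eq_true_eq]
      exact PTime.le hj (PTime.add (hcap.of_le fun j => cappedMul_le _ _ _)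
        (PTime.mul (PolyBdd.const 3) hm (.const 3) qm).succ qc) qj
  have pall : PTime (fun i : Σ m, ThreeCNF m => n i.1) (fun i => i.2.clauses)
      (fun i => (μ (n i.1), n i.1)) :=
    (pn.comp (pμ.reindex fun i : Σ m, ThreeCNF m => n i.1)).pair pn
  obtain ⟨k1, h1⟩ := BlockInput.pTime
  obtain ⟨k2, h2⟩ := pall
  exact ⟨k1 + k2, exists_blockReduction_of_pTimeE (h1.mono (by omega)) hμ h3 hn
    (h2.mono (by omega))⟩

/-! ## The reduction for several prime factors -/

/-- Lucas: all e digits of p^e - 1 in base p are p - 1. The binomial coefficient is therefore 0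
modulo p unless the last e digits of s are p - 1 as well, that is p^e ∣ s + 1, and then it is 1. -/
theorem choose_prime_pow_sub_one {p : ℕ} (hp : p.Prime) (e s : ℕ) :
    s.choose (p ^ e - 1) ≡ (if p ^ e ∣ s + 1 then 1 else 0) [MOD p] := by
  have : Fact p.Prime := ⟨hp⟩
  induction e generalizing s with
  | zero => simp [Nat.ModEq.refl]
  | succ e ih =>
    have hpe : 0 < p ^ e := Nat.pow_pos hp.pos
    have hk : p ^ (e + 1) - 1 = p * (p ^ e - 1) + (p - 1) := by
      rw [pow_succ, mul_comm, Nat.mul_sub]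
      have : p * 1 ≤ p * p ^ e := Nat.mul_le_mul_left _ hpe
      have := hp.pos
      omega
    have hk1 : (p ^ (e + 1) - 1) % p = p - 1 := by
      rw [hk, Nat.mul_add_mod, Nat.mod_eq_of_lt (Nat.sub_lt hp.pos one_pos)]
    have hk2 : (p ^ (e + 1) - 1) / p = p ^ e - 1 := by
      rw [hk, Nat.mul_add_div hp.pos, Nat.div_eq_of_lt (Nat.sub_lt hp.pos one_pos), add_zero]
    refine (Choose.choose_modEq_choose_mod_mul_choose_div_nat (n := s) (p := p)).trans ?_
    rw [hk1, hk2]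
    have hs := Nat.mod_lt s hp.pos
    have hdm := Nat.div_add_mod s p
    by_cases h : s % p = p - 1
    · rw [h, Nat.choose_self, one_mul]
      refine (ih (s / p)).trans ?_
      have h1 : s + 1 = p * (s / p + 1) := by
        rw [mul_add, mul_one]
        omega
      rw [h1, pow_succ, mul_comm (p ^ e) p]
      simp only [Nat.mul_dvd_mul_iff_left hp.pos]
      rfl
    · rw [Nat.choose_eq_zero_of_lt (by omega), zero_mul, if_neg]
      intro hd
      have h1 : p ∣ s + 1 := (Dvd.intro_left (p ^ e) rfl).trans (by rwa [pow_succ] at hd)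
      rw [← hdm, add_assoc, Nat.dvd_add_right (Dvd.intro _ rfl)] at h1
      have := Nat.le_of_dvd (Nat.succ_pos _) h1
      omega

/-- To isolate p, multiply by the other primes of `S`: all other summands become multiples of M.
Then M / p cancels and the product of the other primes is coprime to p. M need not be squarefree. -/
theorem dvd_sum_div_mul_iff {M : ℕ} (hM : 0 < M) {S : Finset ℕ} (hS : ∀ p ∈ S, p.Prime ∧ p ∣ M)
    (x : ℕ → ℤ) : (M : ℤ) ∣ ∑ p ∈ S, ((M / p : ℕ) : ℤ) * x p ↔ ∀ p ∈ S, (p : ℤ) ∣ x p := by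
  have hmul : ∀ p ∈ S, (M : ℤ) = ((M / p : ℕ) : ℤ) * p := fun p hp => by
    rw [← Nat.cast_mul, Nat.div_mul_cancel (hS p hp).2]
  constructor
  · intro h p hp
    have h1 : (M : ℤ) ∣ (∏ q ∈ S.erase p, (q : ℤ)) * ∑ p ∈ S, ((M / p : ℕ) : ℤ) * x p :=
      h.mul_left _
    rw [← Finset.add_sum_erase _ _ hp, mul_add, dvd_add_left] at h1
    · rw [hmul p hp, mul_left_comm] at h1
      have h0 : ((M / p : ℕ) : ℤ) ≠ 0 := by
        intro h0
        have := hmul p hp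
        rw [h0, zero_mul] at this
        exact hM.ne' (by exact_mod_cast this)
      rw [mul_dvd_mul_iff_left h0] at h1
      refine IsCoprime.dvd_of_dvd_mul_left (IsCoprime.prod_right fun q hq => ?_) h1
      rw [Nat.isCoprime_iff_coprime, Nat.coprime_primes (hS p hp).1
        (hS q (Finset.mem_of_mem_erase hq)).1]
      exact (Finset.ne_of_mem_erase hq).symm
    · rw [Finset.mul_sum]
      refine Finset.dvd_sum fun q hq => ?_
      obtain ⟨c, hc⟩ := Finset.dvd_prod_of_mem (fun q : ℕ => (q : ℤ)) hq
      rw [hc, hmul q (Finset.mem_of_mem_erase hq)]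
      exact ⟨c * x q, by ring⟩
  · intro h
    refine Finset.dvd_sum fun p hp => ?_
    rw [hmul p hp]
    exact mul_dvd_mul_left _ (h p hp)

theorem exists_lt_pow_pow {p r : ℕ} (hp : 2 ≤ p) (hr : 1 ≤ r) (m : ℕ) : ∃ e, m < (p ^ e) ^ r :=
  ⟨m, (Nat.lt_pow_self (by omega)).trans_le (Nat.le_self_pow (by omega) _)⟩

open Classical in
/-- The least power of `p` whose `r`-th power exceeds `m`. -/
noncomputable def leastExp (p r m : ℕ) : ℕ :=
  if h : ∃ e, m < (p ^ e) ^ r then Nat.find h else 0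

theorem leastExp_spec {p r : ℕ} (hp : 2 ≤ p) (hr : 1 ≤ r) (m : ℕ) :
    m < (p ^ leastExp p r m) ^ r ∧ ∀ j < leastExp p r m, (p ^ j) ^ r ≤ m := by
  have h := exists_lt_pow_pow hp hr m
  rw [leastExp, dif_pos h]
  exact ⟨Nat.find_spec h, fun j hj => not_lt.1 (Nat.find_min h hj)⟩

open Classical in
/-- The least number whose `r`-th power exceeds `m`. -/
noncomputable def leastRoot (r m : ℕ) : ℕ := if h : ∃ s, m < s ^ r then Nat.find h else 0

theorem leastRoot_spec {r : ℕ} (hr : 1 ≤ r) (m : ℕ) :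
    m < leastRoot r m ^ r ∧ ∀ j < leastRoot r m, j ^ r ≤ m := by
  have h : ∃ s, m < s ^ r := ⟨m + 1, (Nat.lt_succ_self m).trans_le (Nat.le_self_pow (by omega) _)⟩
  rw [leastRoot, dif_pos h]
  exact ⟨Nat.find_spec h, fun j hj => not_lt.1 (Nat.find_min h hj)⟩

/-- By minimality the preceding power of p is below `leastRoot r m`, and one more factor p ≤ M is
lost. -/
theorem pow_leastExp_le {p r M : ℕ} (hp : 2 ≤ p) (hpM : p ≤ M) (hr : 1 ≤ r) (m : ℕ) :
    p ^ leastExp p r m ≤ M * leastRoot r m := by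
  obtain ⟨h1, h2⟩ := leastExp_spec hp hr m
  have h3 := (leastRoot_spec hr m).1
  rcases h : leastExp p r m with _ | e
  · have : 0 < leastRoot r m := by
      rcases Nat.eq_zero_or_pos (leastRoot r m) with h0 | h0
      · rw [h0, zero_pow (by omega)] at h3; omega
      · exact h0
    rw [pow_zero]
    exact Nat.mul_pos (by omega) this
  · have h4 := (h2 e (by omega)).trans_lt h3
    have h5 := lt_of_pow_lt_pow_left₀ r (Nat.zero_le _) h4
    rw [pow_succ, mul_comm]
    exact Nat.mul_le_mul hpM h5.le

/-- A clause that is always true. -/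
def tautology : List Lit := [(0, true), (0, false), (0, true)]

/-- The number of tautologies that fill up a list of length `m` to `-1` modulo `q`. -/
def padding (q m : ℕ) : ℕ := q - 1 - m % q

/-- The clauses, filled up with tautologies. -/
def paddedClauses (q : ℕ) (cls : List (List Lit)) : List (List Lit) :=
  cls ++ List.replicate (padding q cls.length) tautology

/-- The sublists of length `q - 1` of the padded list, with a coefficient. -/
def sublistMons (c q : ℕ) (cls : List (List Lit)) : List (ℕ × List (List Lit)) :=
  ((smallSublists (q - 1) (paddedClauses q cls)).filter fun s => s.length == q - 1).map
    fun s => (c, s)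

section

variable {q V : ℕ} {cls : List (List Lit)}

theorem length_paddedClauses : (paddedClauses q cls).length = cls.length + padding q cls.length := by
  simp [paddedClauses]

/-- The padded length is -1 modulo q, so the number of true clauses plus 1 is minus the number of
false ones modulo q. -/
theorem dvd_padding (hq : 0 < q) (m : ℕ) : q ∣ m + padding q m + 1 := by
  have h1 := Nat.mod_lt m hq
  have h2 := Nat.div_add_mod m q
  refine ⟨m / q + 1, ?_⟩
  rw [padding, mul_add, mul_one]
  omega

theorem goodClauses_padded (h : GoodClauses V cls) (hV : 0 < V) :
    GoodClauses V (paddedClauses q cls) := by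
  intro cl hcl
  rcases List.mem_append.1 hcl with hcl | hcl
  · exact h cl hcl
  · rw [List.eq_of_mem_replicate hcl]
    refine ⟨rfl, fun l hl => ?_⟩
    simp only [tautology, List.mem_cons, List.not_mem_nil, or_false] at hl
    rcases hl with rfl | rfl | rfl <;> exact hV

theorem sublistMons_good (h : GoodClauses V cls) (hV : 0 < V) {c : ℕ} :
    ∀ m ∈ sublistMons c q cls, m.1 = c ∧ m.2.length = q - 1 ∧ GoodClauses V m.2 := by
  intro m hm
  obtain ⟨s, hs, rfl⟩ := List.mem_map.1 hm
  rw [List.mem_filter, beq_iff_eq] at hs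
  exact ⟨rfl, hs.2, fun cl hcl => goodClauses_padded h hV cl
    ((length_le_of_mem_smallSublists hs.1).2 cl hcl)⟩

theorem length_sublistMons (c : ℕ) :
    (sublistMons c q cls).length = (cls.length + padding q cls.length).choose (q - 1) := by
  rw [sublistMons, List.length_map, ← List.countP_eq_length_filter, ← length_paddedClauses]
  have := countP_smallSublists (fun _ => true) (le_refl (q - 1)) (paddedClauses q cls)
  rw [List.countP_true] at this
  rw [← this]
  exact List.countP_congr fun s _ => by simp

theorem countP_paddedClauses (y : ℕ → Bool) :
    (paddedClauses q cls).countP (satB y) = cls.countP (satB y) + padding q cls.length := by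
  rw [paddedClauses, List.countP_append, List.countP_replicate, if_pos]
  cases h : y 0 <;> simp [satB, tautology, h]

/-- Because of the coefficient M / p, the clause factors need to be indicators modulo p only; this
is why κ is asked to invert -8 modulo p, and why M may be even. The sum then counts the sublists
consisting of true clauses. -/
theorem tval_sublistMons {M κ p : ℕ} (hpM : p ∣ M) (hκ : p ∣ 8 * κ + 1)
    (hcls : GoodClauses V cls) (hV : 0 < V) (y : ℕ → Bool) :
    ((sublistMons (M / p) q cls).map fun m =>
      (m.1 : ZMod M) * (m.2.map (cval M κ y)).prod).sum =
      ((M / p * (cls.countP (satB y) + padding q cls.length).choose (q - 1) : ℕ) : ZMod M) := by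
  have hprod : ∀ s : List (List Lit), GoodClauses V s →
      ((M / p : ℕ) : ZMod M) * (s.map (cval M κ y)).prod =
        ((M / p : ℕ) : ZMod M) * if s.all (satB y) then 1 else 0 := by
    intro s hs
    have h1 : (s.map (cval M κ y)).prod =
        ((s.map fun cl => 1 + κ * if satB y cl then 0 else 8).prod : ℕ) := by
      rw [Nat.cast_list_prod, List.map_map]
      refine congrArg List.prod (List.map_congr_left fun cl hcl => ?_)
      rw [cval, (hs cl hcl).1]
      by_cases h : satB y cl = true
      · simp [h]
      · simp [h, show (2 : ZMod M) ^ 3 = 8 by norm_num]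
    have h2 : (s.map fun cl => 1 + κ * if satB y cl then 0 else 8).prod ≡
        (if s.all (satB y) then 1 else 0) [MOD p] := by
      rw [← ZMod.natCast_eq_natCast_iff, Nat.cast_list_prod, List.map_map]
      have h3 := prod_map_ite (R := ZMod p) (satB y) s
      push_cast
      rw [← h3]
      refine congrArg List.prod (List.map_congr_left fun cl hcl => ?_)
      have h4 := (ZMod.natCast_eq_zero_iff _ _).2 hκ
      push_cast at h4
      by_cases h : satB y cl = true
      · simp [h]
      · simp [h]
        linear_combination h4
    have h5 := h2.mul_left' (M / p)
    rw [Nat.div_mul_cancel hpM, ← ZMod.natCast_eq_natCast_iff] at h5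
    rw [h1, ← Nat.cast_mul, h5]
    push_cast
    rfl
  have h1 : ((sublistMons (M / p) q cls).map fun m =>
      (m.1 : ZMod M) * (m.2.map (cval M κ y)).prod) = (sublistMons (M / p) q cls).map fun m =>
        ((M / p : ℕ) : ZMod M) * if m.2.all (satB y) then 1 else 0 := by
    refine List.map_congr_left fun m hm => ?_
    obtain ⟨h1, -, h3⟩ := sublistMons_good hcls hV m hm
    rw [h1, hprod _ h3]
  rw [h1, List.sum_map_mul_left, sum_map_ite (fun m : ℕ × List (List Lit) => m.2.all (satB y)),
    sublistMons, List.countP_map, List.countP_filter, Nat.cast_mul, ← countP_paddedClauses,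
    ← countP_smallSublists (satB y) le_rfl (paddedClauses q cls)]
  refine congrArg (fun k : ℕ => _ * (k : ZMod M)) (List.countP_congr fun s _ => ?_)
  simp [and_comm]

end

section Primes

variable (M κ r : ℕ) (S : Finset ℕ)

/-- All the monomials. -/
noncomputable def primeMons (cls : List (List Lit)) : List (ℕ × List (List Lit)) :=
  S.toList.flatMap fun p => sublistMons (M / p) (p ^ leastExp p r cls.length) cls

/-- The expansion. -/
noncomputable def primeTerms (cls : List (List Lit)) : List WTerm := expand M κ (primeMons M r S cls)

/-- The number of variables. -/
noncomputable def primeSize (m : ℕ) : ℕ := 3 * m + 1 + (S.toList.map fun p =>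
  (m + padding (p ^ leastExp p r m) m).choose (p ^ leastExp p r m - 1) *
    9 ^ (p ^ leastExp p r m - 1)).sum

/-- The constant term. -/
def primeConst : ℕ := ∑ p ∈ S, (M - M / p)

variable {M κ r S} (hM : 0 < M) (hr : 1 ≤ r) (hS : ∀ p ∈ S, p.Prime ∧ p ∣ M)
  (hκ : ∀ p ∈ S, p ∣ 8 * κ + 1) {cls : List (List Lit)} {V : ℕ} (hcls : GoodClauses V cls)
  (hV : 0 < V)

include hcls hV in
theorem primeMons_good : ∀ m ∈ primeMons M r S cls, m.1 ≤ M ∧ GoodClauses V m.2 := by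
  intro m hm
  obtain ⟨p, hp, hm⟩ := List.mem_flatMap.1 hm
  obtain ⟨h1, -, h2⟩ := sublistMons_good hcls hV m hm
  exact ⟨h1.trans_le (Nat.div_le_self _ _), h2⟩

include hcls hV in
theorem sum_pow_primeMons : ((primeMons M r S cls).map fun m => 9 ^ m.2.length).sum =
    (S.toList.map fun p => (cls.length + padding (p ^ leastExp p r cls.length) cls.length).choose
      (p ^ leastExp p r cls.length - 1) * 9 ^ (p ^ leastExp p r cls.length - 1)).sum := by
  rw [primeMons]
  induction S.toList with
  | nil => simp
  | cons p l ih =>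
    rw [List.flatMap_cons, List.map_append, List.sum_append, ih, List.map_cons, List.sum_cons]
    congr 1
    rw [← length_sublistMons (M / p), ← smul_eq_mul]
    have h1 : ((sublistMons (M / p) (p ^ leastExp p r cls.length) cls).map
        fun m => 9 ^ m.2.length) = (sublistMons (M / p) (p ^ leastExp p r cls.length) cls).map
        fun m => 9 ^ (p ^ leastExp p r cls.length - 1) :=
      List.map_congr_left fun m hm => by rw [(sublistMons_good hcls hV m hm).2.1]
    rw [h1, List.map_const', List.sum_replicate]

include hcls hV in
theorem length_primeTerms :
    3 * cls.length + 1 + (primeTerms M κ r S cls).length = primeSize r S cls.length := by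
  rw [primeTerms, length_expand fun m hm cl hcl => ((primeMons_good hcls hV m hm).2 cl hcl).1,
    sum_pow_primeMons hcls hV, primeSize]

include hM hcls hV in
theorem bounded_primeTerms : Bounded M V (3 * primeSize r S cls.length)
    (primeTerms M κ r S cls) := by
  refine bounded_expand hM le_rfl fun m hm =>
    ⟨(primeMons_good hcls hV m hm).1, ?_, (primeMons_good hcls hV m hm).2⟩
  have h1 : 9 ^ m.2.length ≤ ((primeMons M r S cls).map fun m => 9 ^ m.2.length).sum :=
    List.single_le_sum (by simp) _ (List.mem_map.2 ⟨m, hm, rfl⟩)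
  rw [sum_pow_primeMons hcls hV] at h1
  have h2 : m.2.length < 9 ^ m.2.length := Nat.lt_pow_self (by norm_num)
  rw [primeSize]
  omega

-- The constant term turns the sum into ∑ (M / p)(C p - 1), which vanishes modulo M iff every C p is
-- 1 modulo p. By Lucas and the padding this means that each prime power q p divides the number of
-- false clauses. That number is at most m, while the product of the coprime q p exceeds m, so it is
-- 0.
include hM hr hS hκ hcls hV in
theorem tval_primeTerms (hcard : S.card = r) (y : ℕ → Bool) :
    tval M y (primeTerms M κ r S cls) + primeConst M S = 0 ↔
      ∀ cl ∈ cls, satB y cl = true := by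
  have : NeZero M := ⟨hM.ne'⟩
  let q : ℕ → ℕ := fun p => p ^ leastExp p r cls.length
  let C : ℕ → ℕ := fun p => (cls.countP (satB y) + padding (q p) cls.length).choose (q p - 1)
  have hq : ∀ p ∈ S, 0 < q p := fun p hp => Nat.pow_pos (hS p hp).1.pos
  have h1 : tval M y (primeTerms M κ r S cls) = ∑ p ∈ S, ((M / p * C p : ℕ) : ZMod M) := by
    rw [primeTerms, tval_expand, primeMons,
      ← Finset.sum_map_toList S fun p => ((M / p * C p : ℕ) : ZMod M)]
    have h2 : ∀ p ∈ S.toList, _ := fun p hp =>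
      tval_sublistMons (q := q p) (hS p (Finset.mem_toList.1 hp)).2
        (hκ p (Finset.mem_toList.1 hp)) hcls hV y
    generalize S.toList = l at h2
    induction l with
    | nil => simp
    | cons p l ih =>
      rw [List.flatMap_cons, List.map_append, List.sum_append, List.map_cons, List.sum_cons,
        ih fun p hp => h2 p (by simp [hp])]
      exact congrArg (· + _) (h2 p (by simp))
  have h2 : tval M y (primeTerms M κ r S cls) + primeConst M S =
      ((∑ p ∈ S, ((M / p : ℕ) : ℤ) * ((C p : ℤ) - 1) : ℤ) : ZMod M) := by
    rw [h1, primeConst]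
    rw [Nat.cast_sum, ← Finset.sum_add_distrib, Int.cast_sum]
    refine Finset.sum_congr rfl fun p hp => ?_
    rw [Nat.cast_sub (Nat.div_le_self _ _), ZMod.natCast_self, Nat.cast_mul, Int.cast_mul,
      Int.cast_sub, Int.cast_natCast, Int.cast_natCast, Int.cast_one]
    ring
  have hw : cls.countP (satB y) + cls.countP (fun cl => !satB y cl) = cls.length := by
    rw [List.length_eq_countP_add_countP (satB y) (l := cls)]
    congr 2
    funext cl
    simp
  have h3 : ∀ p ∈ S, ((p : ℤ) ∣ (C p : ℤ) - 1 ↔ q p ∣ cls.countP fun cl => !satB y cl) := by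
    intro p hp
    have h4 := choose_prime_pow_sub_one (hS p hp).1 (leastExp p r cls.length)
      (cls.countP (satB y) + padding (q p) cls.length)
    have h5 : (p : ℤ) ∣ (C p : ℤ) - 1 ↔ C p ≡ 1 [MOD p] := by
      rw [Nat.ModEq.comm, Nat.modEq_iff_dvd]
      simp
    -- True clauses, padding, the extra 1 and false clauses add up to a multiple of q p.
    have h6 : q p ∣ cls.countP (satB y) + padding (q p) cls.length + 1 ↔
        q p ∣ cls.countP fun cl => !satB y cl := by
      have h7 := dvd_padding (hq p hp) cls.length
      rw [← hw] at h7
      have h8 : cls.countP (satB y) + cls.countP (fun cl => !satB y cl) +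
        padding (q p) (cls.countP (satB y) + cls.countP fun cl => !satB y cl) + 1 =
        cls.countP (satB y) + padding (q p) cls.length + 1 + cls.countP fun cl => !satB y cl := by
        rw [hw]; omega
      rw [h8] at h7
      constructor
      · intro h; exact (Nat.dvd_add_right h).1 h7
      · intro h; exact (Nat.dvd_add_left h).1 h7
    rw [h5, ← h6]
    by_cases h : q p ∣ cls.countP (satB y) + padding (q p) cls.length + 1
    · rw [if_pos h] at h4
      exact iff_of_true h4 h
    · rw [if_neg h] at h4
      refine iff_of_false (fun h9 => ?_) h
      have := (h9.symm.trans h4 : 1 ≡ 0 [MOD p])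
      rw [Nat.modEq_zero_iff_dvd, Nat.dvd_one] at this
      exact (hS p hp).1.one_lt.ne' this
  rw [h2, ZMod.intCast_zmod_eq_zero_iff_dvd, dvd_sum_div_mul_iff hM hS]
  have h4 : (∀ cl ∈ cls, satB y cl = true) ↔ cls.countP (fun cl => !satB y cl) = 0 := by
    rw [List.countP_eq_zero]
    simp
  rw [h4]
  constructor
  · intro h
    have h5 : ∏ p ∈ S, q p ∣ cls.countP fun cl => !satB y cl := by
      refine Finset.prod_dvd_of_isRelPrime (fun p hp p' hp' hne => ?_)
        fun p hp => (h3 p hp).1 (h p hp)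
      exact Nat.coprime_iff_isRelPrime.1 (Nat.Coprime.pow _ _
        ((Nat.coprime_primes (hS p hp).1 (hS p' hp').1).2 hne))
    refine Nat.eq_zero_of_dvd_of_lt h5 (lt_of_le_of_lt (show _ ≤ cls.length by omega) ?_)
    -- Only q^r > m is known for each of the r factors, so the comparison of the product with m is
    -- made between r-th powers.
    refine lt_of_pow_lt_pow_left₀ r (Nat.zero_le _) ?_
    rw [← Finset.prod_pow, ← hcard, ← Finset.prod_const, hcard]
    have h6 : ∀ p ∈ S, cls.length < q p ^ r := fun p hp =>
      (leastExp_spec (hS p hp).1.two_le hr cls.length).1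
    rcases Nat.eq_zero_or_pos cls.length with h0 | h0
    · rw [h0, Finset.prod_const, zero_pow (by omega)]
      exact Finset.prod_pos fun p hp => Nat.pow_pos (hq p hp)
    · exact Finset.prod_lt_prod_of_nonempty (fun p _ => h0) h6 (Finset.card_pos.1 (by omega))
  · intro h p hp
    rw [h3 p hp, h]
    exact dvd_zero _

end Primes

/-! ### Running time -/

theorem sum_choose_le_pow (n k : ℕ) : ∑ j ∈ Finset.range (k + 1), n.choose j ≤ (n + 1) ^ k := by
  rw [add_pow]
  refine Finset.sum_le_sum fun j hj => ?_
  rw [one_pow, mul_one, Nat.cast_id]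
  exact (Nat.choose_le_pow n j).trans (Nat.le_mul_of_pos_right _
    (Nat.choose_pos (Nat.lt_succ_iff.1 (Finset.mem_range.1 hj))))

theorem length_smallSublists_le (k : ℕ) (l : List β) :
    (smallSublists k l).length ≤ (l.length + 1) ^ k :=
  (length_smallSublists k l).trans_le (sum_choose_le_pow _ _)

/-- A bound for the number of sublists that occur, and for the size of their expansion. -/
noncomputable def primeBound (M r m : ℕ) : ℕ :=
  (9 * (m + M * leastRoot r m + 2)) ^ (M * leastRoot r m)

theorem leastRoot_pos {r : ℕ} (hr : 1 ≤ r) (m : ℕ) : 0 < leastRoot r m := by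
  rcases Nat.eq_zero_or_pos (leastRoot r m) with h0 | h0
  · have h3 := (leastRoot_spec hr m).1
    rw [h0, zero_pow (by omega)] at h3
    omega
  · exact h0

theorem le_primeBound {M r : ℕ} (hM : 0 < M) (hr : 1 ≤ r) (m : ℕ) :
    9 * (m + M * leastRoot r m + 2) ≤ primeBound M r m :=
  Nat.le_self_pow (Nat.mul_pos hM (leastRoot_pos hr m)).ne' _

theorem pow_le_primeBound {M r m q : ℕ} (hq : q ≤ M * leastRoot r m) :
    (m + padding q m + 1) ^ (q - 1) * 9 ^ (q - 1) ≤ primeBound M r m := by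
  rw [← mul_pow, primeBound]
  refine (Nat.pow_le_pow_left (m := 9 * (m + M * leastRoot r m + 2)) ?_ _).trans
    (Nat.pow_le_pow_right (by omega) (by omega))
  rw [padding]
  omega

section Primes

variable {M κ r p : ℕ} {S : Finset ℕ}

theorem pTime_sublistMons (hM : 0 < M) (hr : 1 ≤ r) (hp : p.Prime) (hpM : p ∣ M) :
    PTime (fun i : Σ m, ThreeCNF m => primeBound M r i.1) (fun i => i.2.clauses)
      (fun i => sublistMons (M / p) (p ^ leastExp p r i.2.clauses.length) i.2.clauses) := by
  let b : (Σ m, ThreeCNF m) → ℕ := fun i => primeBound M r i.1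
  have hq : ∀ i : Σ m, ThreeCNF m, p ^ leastExp p r i.1 ≤ M * leastRoot r i.1 := fun i =>
    pow_leastExp_le hp.two_le (Nat.le_of_dvd hM hpM) hr i.1
  have hb : ∀ i : Σ m, ThreeCNF m, 9 * (i.1 + M * leastRoot r i.1 + 2) ≤ b i := fun i =>
    le_primeBound hM hr i.1
  have bm : PolyBdd b (fun i => i.1) := PolyBdd.self.of_le fun i => by have := hb i; omega
  have bq : PolyBdd b (fun i => p ^ leastExp p r i.1) := PolyBdd.self.of_le fun i => by
    have := hb i
    have := hq i
    omega
  have be : PolyBdd b (fun i => leastExp p r i.1) := bq.of_le fun i =>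
    (Nat.lt_pow_self hp.one_lt).le
  -- The rule for powers asks for a bound on (p + 1)^e; as p + 1 ≤ p², the square of p^e will do.
  have hpp : ∀ e, (p + 1) ^ e ≤ p ^ e * p ^ e := fun e => by
    rw [← mul_pow]
    refine Nat.pow_le_pow_left ?_ _
    have := hp.two_le
    nlinarith
  have pm : PTime b (fun i => i.2.clauses) (fun i => i.1) := pTime_length_clauses.mono bm
  have pe : PTime b (fun i => i.2.clauses) (fun i => leastExp p r i.1) := by
    refine PTime.find (P := fun i j => decide (i.1 < (p ^ j) ^ r)) be (fun i => ?_)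
      (fun i j hj => ?_) ?_
    · simpa using (leastExp_spec hp.two_le hr i.1).1
    · simpa using (leastExp_spec hp.two_le hr i.1).2 j hj
    · let s := fun j : {j : (Σ m, ThreeCNF m) × ℕ // j.2 ≤ leastExp p r j.1.1} => j.1.1
      have b1 : PolyBdd (fun j => b (s j)) (fun j => p ^ j.1.2) := (bq.comp (r := s)).of_le
        fun j => Nat.pow_le_pow_right hp.pos j.2
      have b2 : PolyBdd (fun j => b (s j)) (fun j => j.1.2) := (be.comp (r := s)).of_le
        fun j => j.2
      have h1 := PTime.pow (PolyBdd.const p) b2 ((b1.mul b1).of_le fun j => hpp _)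
        (x := fun j => ((s j).2.clauses, j.1.2)) (.const p) PTime.id.snd
      exact PTime.lt (bm.comp (r := s)) (pm.lift s)
        (PTime.pow b1 (PolyBdd.const r) (b1.succ.pow r) h1 (.const r))
  have pq : PTime b (fun i => i.2.clauses) (fun i => p ^ leastExp p r i.1) :=
    PTime.pow (PolyBdd.const p) be ((bq.mul bq).of_le fun i => hpp _) (.const p) pe
  have bpad : PolyBdd b (fun i => padding (p ^ leastExp p r i.1) i.1) :=
    bq.of_le fun i => (Nat.sub_le _ _).trans (Nat.sub_le _ _)
  have bmod : PolyBdd b (fun i => i.1 % p ^ leastExp p r i.1) := bm.of_le fun i => Nat.mod_le _ _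
  have ppad : PTime b (fun i => i.2.clauses) (fun i => padding (p ^ leastExp p r i.1) i.1) :=
    PTime.sub bmod pq.pred (PTime.mod bm bq pm pq)
  have bcls : PolyBdd b (fun i => i.2.clauses.length) :=
    bm.of_le fun i => i.2.length_clauses.le
  have pcls : PTime b (fun i => i.2.clauses)
      (fun i => paddedClauses (p ^ leastExp p r i.1) i.2.clauses) :=
    (PTime.append bcls PTime.id (PTime.replicate bpad ppad (.const tautology))).congr fun i => by
      rw [paddedClauses, i.2.length_clauses]
  have bpcls : PolyBdd b
      (fun i => (paddedClauses (p ^ leastExp p r i.1) i.2.clauses).length) :=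
    (bm.add bpad).of_le fun i => by rw [length_paddedClauses, i.2.length_clauses]
  have bq1 : PolyBdd b (fun i => p ^ leastExp p r i.1 - 1) := bq.of_le fun i => Nat.sub_le _ _
  have bsub : PolyBdd b (fun i => (smallSublists (p ^ leastExp p r i.1 - 1)
      (paddedClauses (p ^ leastExp p r i.1) i.2.clauses)).length) :=
    PolyBdd.self.of_le fun i => by
      refine (length_smallSublists_le _ _).trans (le_trans ?_ (pow_le_primeBound (hq i)))
      rw [length_paddedClauses, i.2.length_clauses]
      exact Nat.le_mul_of_pos_right _ (Nat.pow_pos (by norm_num))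
  have psub := PTime.smallSublists bq1 bpcls bsub pq.pred pcls
  refine (PTime.map (f := fun _ s => (M / p, s)) (bsub.of_le fun i => List.length_filter_le _ _)
    (PTime.filter (f := fun i s => s.length == p ^ leastExp p r i.1 - 1) bsub psub ?_)
    ((PTime.const _).pair PTime.id.snd)).congr fun i => by rw [sublistMons, i.2.length_clauses]
  have bl : PolyBdd (fun j : ListPos fun i : Σ m, ThreeCNF m =>
      smallSublists (p ^ leastExp p r i.1 - 1)
        (paddedClauses (p ^ leastExp p r i.1) i.2.clauses) => b j.i) (fun j => j.a.length) :=
    (bq1.comp (r := ListPos.i)).of_le fun j => (length_le_of_mem_smallSublists j.mem).1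
  exact PTime.beq bl (bq1.comp (r := ListPos.i)) (PTime.id.snd.length bl) (pq.pred.lift _)

theorem length_sublistMons_le (hM : 0 < M) (hr : 1 ≤ r) (hp : p.Prime) (hpM : p ∣ M)
    (m : ℕ) : (m + padding (p ^ leastExp p r m) m).choose (p ^ leastExp p r m - 1) *
      9 ^ (p ^ leastExp p r m - 1) ≤ primeBound M r m := by
  refine le_trans (Nat.mul_le_mul_right _ ?_) (pow_le_primeBound
    (pow_leastExp_le hp.two_le (Nat.le_of_dvd hM hpM) hr m))
  exact (Nat.choose_le_pow _ _).trans (Nat.pow_le_pow_left (Nat.le_succ _) _)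

theorem pTime_primeMons (hM : 0 < M) (hr : 1 ≤ r) (hS : ∀ p ∈ S, p.Prime ∧ p ∣ M) :
    PTime (fun i : Σ m, ThreeCNF m => primeBound M r i.1) (fun i => i.2.clauses)
      (fun i => primeMons M r S i.2.clauses) := by
  simp only [primeMons]
  have hS' : ∀ p ∈ S.toList, p.Prime ∧ p ∣ M := fun p hp => hS p (Finset.mem_toList.1 hp)
  generalize S.toList = l at hS'
  induction l with
  | nil => exact .const []
  | cons p l ih =>
    obtain ⟨hp, hpM⟩ := hS' p (by simp)
    refine PTime.append (PolyBdd.self.of_le fun i => ?_) (pTime_sublistMons hM hr hp hpM)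
      (ih fun p hp => hS' p (by simp [hp]))
    rw [length_sublistMons, i.2.length_clauses]
    exact (Nat.le_mul_of_pos_right _ (Nat.pow_pos (by norm_num))).trans
      (length_sublistMons_le hM hr hp hpM i.1)

theorem primeSize_le (hM : 0 < M) (hr : 1 ≤ r) (hS : ∀ p ∈ S, p.Prime ∧ p ∣ M) (m : ℕ) :
    primeSize r S m ≤ (S.card + 1) * primeBound M r m := by
  have h1 := List.sum_le_card_nsmul (S.toList.map fun p =>
    (m + padding (p ^ leastExp p r m) m).choose (p ^ leastExp p r m - 1) *
      9 ^ (p ^ leastExp p r m - 1)) (primeBound M r m) (by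
    intro x hx
    obtain ⟨p, hp, rfl⟩ := List.mem_map.1 hx
    obtain ⟨hp, hpM⟩ := hS p (Finset.mem_toList.1 hp)
    exact length_sublistMons_le hM hr hp hpM m)
  rw [List.length_map, Finset.length_toList, smul_eq_mul] at h1
  have h2 := le_primeBound hM hr m
  rw [primeSize, add_mul]
  omega

/-- The reduction for a modulus with `r` odd prime factors. -/
theorem exists_primeReduction (hM : 0 < M) (hr : 1 ≤ r) (hS : ∀ p ∈ S, p.Prime ∧ p ∣ M)
    (h2 : 2 ∉ S) (hcard : S.card = r) : ∃ (a : ℕ) (R : Prog) (K : ℕ), ∀ (P : Prog) (T : ℕ → ℕ),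
      SolvesLin2Mod P (fun _ => M) T → SolvesThreeSat (.seq R P)
        (fun m => K * (primeBound M r m + 1) ^ a + T (primeSize r S m)) := by
  -- κ is taken modulo the product of the odd primes, since 8 need not be invertible modulo M.
  obtain ⟨κ, -, hκ⟩ := exists_dvd_eight_mul_add (M := ∏ p ∈ S, p) (by
    refine Finset.prod_induction _ Odd (fun _ _ => Odd.mul) odd_one fun p hp => ?_
    exact (hS p hp).1.odd_of_ne_two fun h => h2 (h ▸ hp)) 1
  have hκ' : ∀ p ∈ S, p ∣ 8 * κ + 1 := fun p hp => (Finset.dvd_prod_of_mem _ hp).trans hκ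
  have hgood : ∀ i : Σ m, ThreeCNF m, GoodClauses (3 * i.2.clauses.length + 1) i.2.clauses :=
    fun i => by rw [i.2.length_clauses]; exact i.2.goodClauses
  let b : (Σ m, ThreeCNF m) → ℕ := fun i => primeBound M r i.1
  have bm : PolyBdd b (fun i => i.1) := PolyBdd.self.of_le fun i => by
    have := le_primeBound hM hr i.1
    simp only [b]
    omega
  have bsize : PolyBdd b (fun i => primeSize r S i.1) :=
    ((PolyBdd.const (S.card + 1)).mul PolyBdd.self).of_le fun i => primeSize_le hM hr hS i.1
  have bsum : PolyBdd b (fun i => ((primeMons M r S i.2.clauses).map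
      fun m => 9 ^ m.2.length).sum) := bsize.of_le fun i => by
    rw [sum_pow_primeMons (hgood i) (Nat.succ_pos _), i.2.length_clauses, primeSize]
    omega
  have blen : PolyBdd b (fun i => (primeTerms M κ r S i.2.clauses).length) :=
    bsize.of_le fun i => by
      have := length_primeTerms (M := M) (κ := κ) (r := r) (S := S) (hgood i) (Nat.succ_pos _)
      rw [i.2.length_clauses] at this
      omega
  have hD : PTime b (fun i => i.2.clauses) (fun i =>
      lin2ModData M (3 * i.1 + 1) (primeTerms M κ r S i.2.clauses) (primeConst M S)) := by
    refine PTime.lin2ModData (B := fun _ => M) (k := fun i => 3 * primeSize r S i.1)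
      (PolyBdd.const M) ((PolyBdd.const 3).mul bm).succ (PolyBdd.const M)
      ((PolyBdd.const 3).mul bsize) (PolyBdd.const _) blen (fun i => ?_) (.const M)
      (PTime.mul (PolyBdd.const 3) bm (.const 3) (pTime_length_clauses.mono bm)).succ
      (PTime.expand (PolyBdd.const M) (PolyBdd.const κ) (PolyBdd.const M) (fun _ => hM)
        (fun _ => le_rfl) (fun i m hm => (primeMons_good (hgood i) (Nat.succ_pos _) m hm).1) bsum
        (fun i m hm cl hcl => ((primeMons_good (hgood i) (Nat.succ_pos _) m hm).2 cl hcl).1)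
        (.const M) (.const κ) (pTime_primeMons hM hr hS)) (.const _)
    have := bounded_primeTerms (M := M) (κ := κ) (r := r) (S := S) hM (hgood i) (Nat.succ_pos _)
    rwa [i.2.length_clauses] at this
  obtain ⟨a, hD⟩ := hD
  refine ⟨a, exists_reduction (μ := fun _ => M) (n := primeSize r S) (b := primeBound M r) _
    (fun i => ?_) hD⟩
  have h1 := length_primeTerms (M := M) (κ := κ) (r := r) (S := S) (hgood i) (Nat.succ_pos _)
  rw [i.2.length_clauses] at h1
  have h3 := bounded_primeTerms (M := M) (κ := κ) (r := r) (S := S) hM (hgood i) (Nat.succ_pos _)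
  rw [i.2.length_clauses] at h3
  obtain ⟨I, hI1, hI2⟩ := exists_lin2Mod (σ := primeConst M S) hM h1 h3
  exact ⟨I, hI1, hI2.trans ((exists_congr fun y =>
    tval_primeTerms hM hr hS hκ' (hgood i) (Nat.succ_pos _) hcard y).trans
      i.2.satisfiable_iff.symm)⟩

end Primes

/-! ## Lower bounds -/

/-- If the bound 2^(εm) failed to be exceeded infinitely often, the finitely many exceptions would
disappear in the constant of O(2^(εm)). -/
theorem ETH.exists_frequently (h : ETH) : ∃ ε : ℝ, 0 < ε ∧ ∀ (Q : Prog) (S : ℕ → ℕ),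
    SolvesThreeSat Q S → ∃ᶠ m : ℕ in atTop, (2 : ℝ) ^ (ε * (m : ℝ)) < S m := by
  obtain ⟨ε, hε, h⟩ := h
  refine ⟨ε, hε, fun Q S hQ => ?_⟩
  by_contra hf
  rw [not_frequently] at hf
  simp only [not_lt] at hf
  obtain ⟨N, hN⟩ := eventually_atTop.1 hf
  refine h ⟨Q, S, 1 + ∑ m ∈ Finset.range N, (S m : ℝ), hQ, fun m => ?_⟩
  have h1 : (1 : ℝ) ≤ 2 ^ (ε * (m : ℝ)) := Real.one_le_rpow (by norm_num) (by positivity)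
  have h2 : (0 : ℝ) ≤ ∑ m ∈ Finset.range N, (S m : ℝ) :=
    Finset.sum_nonneg fun _ _ => Nat.cast_nonneg _
  rcases lt_or_ge m N with hm | hm
  · have h3 : (S m : ℝ) ≤ ∑ m ∈ Finset.range N, (S m : ℝ) :=
      Finset.single_le_sum (f := fun m => (S m : ℝ)) (fun _ _ => Nat.cast_nonneg _)
        (Finset.mem_range.2 hm)
    nlinarith
  · nlinarith [hN m hm]

/-- If for every ε the time were eventually at most 2^(εm), its logarithm would be o(m). The rate ε
now depends on the algorithm. -/
theorem ETHLittleO.exists_frequently (h : ETHLittleO) {Q : Prog} {S : ℕ → ℕ}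
    (hQ : SolvesThreeSat Q S) :
    ∃ ε : ℝ, 0 < ε ∧ ∃ᶠ m : ℕ in atTop, (2 : ℝ) ^ (ε * (m : ℝ)) < S m := by
  by_contra hf
  push Not at hf
  refine h ⟨Q, S, hQ, isLittleO_iff.2 fun c hc => ?_⟩
  filter_upwards [hf c hc] with m hm
  rw [Real.norm_of_nonneg (Real.log_natCast_nonneg _), Real.norm_of_nonneg (Nat.cast_nonneg _)]
  rcases Nat.eq_zero_or_pos (S m) with h0 | h0
  · rw [h0]
    simp only [Nat.cast_zero, Real.log_zero]
    positivity
  · have h1 := Real.log_le_log (by exact_mod_cast h0) hm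
    rw [Real.log_rpow (by norm_num)] at h1
    have h2 := Real.log_two_lt_d9
    nlinarith [mul_nonneg hc.le (Nat.cast_nonneg (α := ℝ) m)]

/-! ### General representations of `OR` -/

/-- With t = f/m ≤ 1, the sum times t^f is at most ∑ (m choose i) t^i = (1 + t)^m ≤ e^f. -/
theorem sum_choose_le_rpow {f m : ℕ} (hf : 0 < f) (hfm : f ≤ m) :
    (∑ i ∈ Finset.range (f + 1), (m.choose i : ℝ)) ≤ (Real.exp 1 * m / f) ^ f := by
  have hf' : (0 : ℝ) < f := by exact_mod_cast hf
  have hm' : (0 : ℝ) < m := by exact_mod_cast hf.trans_le hfm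
  have ht : (0 : ℝ) < f / m := by positivity
  have ht1 : (f / m : ℝ) ≤ 1 := (div_le_one hm').2 (by exact_mod_cast hfm)
  have h1 : (∑ i ∈ Finset.range (f + 1), (m.choose i : ℝ)) * (f / m : ℝ) ^ f ≤
      (1 + f / m : ℝ) ^ m := by
    rw [Finset.sum_mul, add_comm (1 : ℝ), add_pow]
    refine (Finset.sum_le_sum fun i hi => ?_).trans (Finset.sum_le_sum_of_subset_of_nonneg
      (Finset.range_subset_range.2 (by omega : f + 1 ≤ m + 1)) fun i _ _ => by positivity)
    rw [one_pow, mul_one, mul_comm]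
    exact mul_le_mul_of_nonneg_right (pow_le_pow_of_le_one ht.le ht1
      (Nat.lt_succ_iff.1 (Finset.mem_range.1 hi))) (Nat.cast_nonneg _)
  have h2 : (1 + f / m : ℝ) ^ m ≤ Real.exp f := by
    rw [add_comm]
    refine (pow_le_pow_left₀ (by positivity) (Real.add_one_le_exp _) m).trans_eq ?_
    rw [← Real.exp_nat_mul, mul_div_cancel₀ _ hm'.ne']
  have h3 : (Real.exp 1 * m / f : ℝ) ^ f * (f / m : ℝ) ^ f = Real.exp f := by
    rw [← mul_pow, show Real.exp 1 * m / f * (f / m : ℝ) = Real.exp 1 by field_simp,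
      ← Real.exp_nat_mul, mul_one]
  exact le_of_mul_le_mul_right ((h1.trans h2).trans_eq h3.symm) (by positivity)

/-- The sum s of binomials is at least m + 1, so n ≤ (9^f + 4) s ≤ 13^f s, and 13 ≤ e³. Since
log(em/f) ≥ 1, the resulting 3f is at most 3f log(em/f), which makes the constant 3 + 1 = 4. -/
theorem log_le_of_le_sum_choose {f m n : ℕ} (hf : 0 < f) (hfm : f ≤ m) (hn : 0 < n)
    (h : n ≤ 3 * m + 1 + (9 ^ f + 1) * ∑ i ∈ Finset.range (f + 1), m.choose i) :
    Real.log n ≤ 4 * ((f : ℝ) * Real.log (Real.exp 1 * m / f)) := by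
  have hf' : (0 : ℝ) < f := by exact_mod_cast hf
  have hfm' : (f : ℝ) ≤ m := by exact_mod_cast hfm
  have hm' : (0 : ℝ) < m := hf'.trans_le hfm'
  have h1 : 1 + m ≤ ∑ i ∈ Finset.range (f + 1), m.choose i := by
    refine le_trans ?_ (Finset.sum_le_sum_of_subset
      (Finset.range_subset_range.2 (by omega : 2 ≤ f + 1)))
    simp [Finset.sum_range_succ]
  have h2 : n ≤ 13 ^ f * ∑ i ∈ Finset.range (f + 1), m.choose i := by
    refine h.trans ((?_ : _ ≤ (9 ^ f + 4) * ∑ i ∈ Finset.range (f + 1), m.choose i).trans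
      (Nat.mul_le_mul_right _ ?_))
    · linarith
    · obtain ⟨g, rfl⟩ : ∃ g, f = g + 1 := ⟨f - 1, by omega⟩
      have h3 : 9 ^ g ≤ 13 ^ g := Nat.pow_le_pow_left (by norm_num) g
      have h4 : 1 ≤ 13 ^ g := Nat.one_le_pow _ _ (by norm_num)
      rw [pow_succ, pow_succ]
      omega
  have h3 : (n : ℝ) ≤ Real.exp 3 ^ f * (Real.exp 1 * m / f) ^ f := by
    have h4 : (n : ℝ) ≤ 13 ^ f * ∑ i ∈ Finset.range (f + 1), (m.choose i : ℝ) := by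
      exact_mod_cast h2
    refine h4.trans (mul_le_mul (pow_le_pow_left₀ (by norm_num) ?_ f)
      (sum_choose_le_rpow hf hfm) (Finset.sum_nonneg fun _ _ => Nat.cast_nonneg _)
      (by positivity))
    have h5 := Real.exp_one_gt_d9
    have h6 : Real.exp 3 = Real.exp 1 ^ 3 := by rw [← Real.exp_nat_mul]; norm_num
    rw [h6]
    refine le_trans ?_ (pow_le_pow_left₀ (by norm_num) (h5.le) 3)
    norm_num
  have h4 : (1 : ℝ) ≤ Real.log (Real.exp 1 * m / f) := by
    rw [Real.le_log_iff_exp_le (by positivity), le_div_iff₀ hf']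
    exact mul_le_mul_of_nonneg_left hfm' (Real.exp_pos 1).le
  have h5 := Real.log_le_log (by exact_mod_cast hn) h3
  rw [Real.log_mul (by positivity) (by positivity), Real.log_pow, Real.log_pow,
    Real.log_exp] at h5
  nlinarith

theorem frequently_exists_of_reduction {f n T : ℕ → ℕ} {K a : ℕ} {ε : ℝ}
    (hn : ∀ m, 0 < m → 0 < f m ∧ f m ≤ m ∧ m ≤ n m ∧
      n m ≤ 3 * m + 1 + (9 ^ f m + 1) * ∑ i ∈ Finset.range (f m + 1), m.choose i)
    (h : ∃ᶠ m : ℕ in atTop, (2 : ℝ) ^ (ε * (m : ℝ)) < ((K * n m ^ a + T (n m) : ℕ) : ℝ)) :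
    ∃ᶠ m : ℕ in atTop, ∃ n : ℕ, m ≤ n ∧
      Real.log n ≤ 4 * ((f m : ℝ) * Real.log (Real.exp 1 * (m : ℝ) / (f m : ℝ))) ∧
      (2 : ℝ) ^ (ε * (m : ℝ)) - (K : ℝ) * (n : ℝ) ^ a ≤ (T n : ℝ) := by
  refine (h.and_eventually (eventually_gt_atTop 0)).mono ?_
  rintro m ⟨h, hm⟩
  obtain ⟨h1, h2, h3, h4⟩ := hn m hm
  refine ⟨n m, h3, log_le_of_le_sum_choose h1 h2 (by omega) h4, ?_⟩
  push_cast at h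
  linarith

/-! ### Disjoint blocks -/

/-- Half of the exponent is given away: for u ≥ a + 1 the reduction itself costs at most n^(a+1) ≤
n^u, and n^(2u) - n^u ≥ n^u because n^u ≥ 2. -/
theorem rpow_le_time {n K a T : ℕ} {u : ℝ} (hn : 2 ≤ n) (hK : K * 2 ^ a ≤ n)
    (hu : (a : ℝ) + 1 ≤ u) (h : (n : ℝ) ^ (2 * u) < ((K * (n + 1) ^ a + T : ℕ) : ℝ)) :
    (n : ℝ) ^ u ≤ T := by
  have hn1 : (1 : ℝ) ≤ n := by exact_mod_cast (by omega : 1 ≤ n)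
  have h1 : K * (n + 1) ^ a ≤ n ^ (a + 1) := by
    calc K * (n + 1) ^ a ≤ K * (2 * n) ^ a := by gcongr; omega
      _ = K * 2 ^ a * n ^ a := by rw [mul_pow]; ring
      _ ≤ n * n ^ a := by gcongr
      _ = n ^ (a + 1) := by ring
  have h2 : ((n ^ (a + 1) : ℕ) : ℝ) ≤ (n : ℝ) ^ u := by
    rw [Nat.cast_pow, ← Real.rpow_natCast]
    exact Real.rpow_le_rpow_of_exponent_le hn1 (by push_cast; exact hu)
  have h3 : (2 : ℝ) ≤ (n : ℝ) ^ u := by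
    refine le_trans ?_ h2
    exact_mod_cast hn.trans (Nat.le_self_pow (by omega) n)
  have h4 : (n : ℝ) ^ (2 * u) = (n : ℝ) ^ u * (n : ℝ) ^ u := by
    rw [← Real.rpow_add (by linarith)]; ring_nf
  have h5 : ((K * (n + 1) ^ a : ℕ) : ℝ) ≤ ((n ^ (a + 1) : ℕ) : ℝ) := by exact_mod_cast h1
  rw [Nat.cast_add, h4] at h
  nlinarith

/-- N is the modulus that bounds n and M the one in the result; for growing moduli they belong to
consecutive arguments. The blocks contribute the exponent m/(N - 1) ≤ 3m/M, times log 9 ≤ 3. The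
factor m + 1 is harmless because M ≤ 2m + 2 and log x / x decreases from e on; it contributes 16,
and 16 + 9 = 25. -/
theorem log_le_of_le_blockSize {M N m n : ℕ} (hN : 3 ≤ N) (hM : 3 ≤ M) (hMN : M ≤ 2 * N)
    (hNm : N ≤ m + 1) (hn : 0 < n) (h : n ≤ 1 + blockSize N m) :
    Real.log n ≤ 25 * (m * (Real.log M / M)) := by
  have hm : (2 : ℝ) ≤ m := by exact_mod_cast (by omega : 2 ≤ m)
  have hM' : (3 : ℝ) ≤ M := by exact_mod_cast hM
  have hlogM : 1 ≤ Real.log M := by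
    rw [Real.le_log_iff_exp_le (by linarith)]
    linarith [Real.exp_one_lt_d9]
  have h1 : n ≤ 14 * (m + 1) * 9 ^ (m / (N - 1)) := by
    have h2 : 1 ≤ 9 ^ (m / (N - 1)) := Nat.one_le_pow _ _ (by norm_num)
    have h3 : (N - 1) * 9 ^ (m / (N - 1)) ≤ m * 9 ^ (m / (N - 1)) :=
      Nat.mul_le_mul_right _ (by omega)
    refine h.trans ?_
    rw [blockSize, pow_succ]
    nlinarith
  have h2 : Real.log n ≤ Real.log (14 * (m + 1)) + (m / (N - 1) : ℕ) * Real.log 9 := by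
    rw [← Real.log_pow, ← Real.log_mul (by positivity) (by positivity)]
    exact Real.log_le_log (by exact_mod_cast hn) (by exact_mod_cast h1)
  have h3 : Real.log (14 * (m + 1)) ≤ 16 * (m * (Real.log M / M)) := by
    have h4 : Real.log (14 * ((m : ℝ) + 1)) ≤ 4 * Real.log (2 * m + 2) := by
      have : (4 : ℝ) * Real.log (2 * m + 2) = Real.log ((2 * m + 2) ^ 4) := by
        rw [Real.log_pow]; norm_num
      rw [this]
      refine Real.log_le_log (by positivity) ?_
      have h5 : (6 : ℝ) ^ 3 ≤ (2 * m + 2) ^ 3 := pow_le_pow_left₀ (by norm_num) (by linarith) 3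
      have h6 : (2 * m + 2 : ℝ) ^ 4 = (2 * m + 2) ^ 3 * (2 * m + 2) := by ring
      rw [h6]
      nlinarith
    have hle : (M : ℝ) ≤ 2 * m + 2 := by exact_mod_cast (by omega : M ≤ 2 * m + 2)
    have h5 := Real.log_div_self_antitoneOn (a := (M : ℝ)) (b := 2 * m + 2)
      (by rw [Set.mem_Ici]; linarith [Real.exp_one_lt_d9])
      (by rw [Set.mem_Ici]; linarith [Real.exp_one_lt_d9]) hle
    have h6 : Real.log (2 * m + 2) / 4 ≤ m * (Real.log (2 * m + 2) / (2 * m + 2)) := by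
      have h7 : 0 ≤ Real.log (2 * (m : ℝ) + 2) := Real.log_nonneg (by linarith)
      rw [← mul_div_assoc, div_le_div_iff₀ (by norm_num) (by linarith)]
      nlinarith
    have h7 := mul_le_mul_of_nonneg_left h5 (Nat.cast_nonneg (α := ℝ) m)
    linarith
  have h4 : ((m / (N - 1) : ℕ) : ℝ) ≤ 3 * (m * (Real.log M / M)) := by
    refine Nat.cast_div_le.trans ?_
    have h5 : (M : ℝ) / 3 ≤ (N - 1 : ℕ) := by
      rw [div_le_iff₀ (by norm_num)]
      exact_mod_cast (by omega : M ≤ (N - 1) * 3)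
    calc (m : ℝ) / (N - 1 : ℕ) ≤ m / (M / 3) := by gcongr
      _ = 3 * (m * (1 / M)) := by field_simp
      _ ≤ 3 * (m * (Real.log M / M)) := by gcongr
  have h5 : Real.log 9 ≤ 3 := by
    rw [Real.log_le_iff_le_exp (by norm_num)]
    have h6 : Real.exp 3 = Real.exp 1 ^ 3 := by rw [← Real.exp_nat_mul]; norm_num
    rw [h6]
    refine le_trans ?_ (pow_le_pow_left₀ (by norm_num) Real.exp_one_gt_d9.le 3)
    norm_num
  have h6 : (0 : ℝ) ≤ (m / (N - 1) : ℕ) := Nat.cast_nonneg _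
  have h7 : ((m / (N - 1) : ℕ) : ℝ) * Real.log 9 ≤ (m / (N - 1) : ℕ) * 3 :=
    mul_le_mul_of_nonneg_left h5 h6
  linarith

theorem rpow_le_two_rpow {M m n : ℕ} {ε : ℝ} (hε : 0 < ε) (hM : 3 ≤ M) (hn : 0 < n)
    (h : Real.log n ≤ 25 * (m * (Real.log M / M))) :
    (n : ℝ) ^ (ε * Real.log 2 / 25 * (M / Real.log M)) ≤ (2 : ℝ) ^ (ε * (m : ℝ)) := by
  have hM' : (0 : ℝ) < M := by exact_mod_cast (by omega : 0 < M)
  have hl : 0 < Real.log M := Real.log_pos (by exact_mod_cast (by omega : 1 < M))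
  rw [Real.rpow_def_of_pos (by exact_mod_cast hn), Real.rpow_def_of_pos (by norm_num),
    Real.exp_le_exp]
  have h2 := Real.log_pos (by norm_num : (1 : ℝ) < 2)
  calc Real.log n * (ε * Real.log 2 / 25 * (M / Real.log M))
      ≤ 25 * (m * (Real.log M / M)) * (ε * Real.log 2 / 25 * (M / Real.log M)) := by gcongr
    _ = Real.log 2 * (ε * m) := by field_simp

theorem le_blockSize (M m : ℕ) : m ≤ blockSize M m := by
  rw [blockSize]; omega

theorem blockSize_tendsto (M : ℕ) : Tendsto (blockSize M) atTop atTop :=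
  tendsto_atTop_mono (le_blockSize M) tendsto_id

/-- The lower bound for a fixed modulus. -/
theorem frequently_le_time_of_blocks {M K a : ℕ} {P : Prog} {T : ℕ → ℕ} {ε : ℝ} (hε : 0 < ε)
    (hM : 3 ≤ M) (hP : SolvesLin2Mod P (fun _ => M) T)
    (h : ∃ᶠ m : ℕ in atTop, (2 : ℝ) ^ (ε * (m : ℝ)) <
      ((K * (blockSize M m + 1) ^ a + T (blockSize M m) : ℕ) : ℝ)) :
    ∃ᶠ n : ℕ in atTop,
      (n : ℝ) ^ (ε * Real.log 2 / (50 * (a + 1)) * (M / Real.log M)) ≤ T n := by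
  have h2 := Real.log_pos (by norm_num : (1 : ℝ) < 2)
  have hM' : (0 : ℝ) < M := by exact_mod_cast (by omega : 0 < M)
  have hl : 0 < Real.log M := Real.log_pos (by exact_mod_cast (by omega : 1 < M))
  set u := ε * Real.log 2 / 50 * (M / Real.log M) with hu
  have hu0 : 0 ≤ u := by positivity
  have heq : ε * Real.log 2 / (50 * (a + 1)) * (M / Real.log M) = u / (a + 1) := by
    rw [hu]; field_simp
  rw [heq]
  have ha : (0 : ℝ) < a + 1 := by positivity
  -- If u < a + 1, the claimed exponent u/(a + 1) is below 1 and reading the input already takes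
  -- that long. Since a does not depend on M, neither does the constant.
  rcases le_or_gt (a + 1 : ℝ) u with hau | hau
  · refine (blockSize_tendsto M).frequently ((h.and_eventually
      ((blockSize_tendsto M).eventually_ge_atTop (K * 2 ^ a + 2) |>.and
        (eventually_ge_atTop M))).mono ?_)
    rintro m ⟨hm, hK, hMm⟩
    have h3 := rpow_le_two_rpow (m := m) (n := blockSize M m) hε hM (by omega)
      (log_le_of_le_blockSize hM hM (by omega) (by omega) (by omega) (by omega))
    have h4 : ε * Real.log 2 / 25 * (M / Real.log M) = 2 * u := by rw [hu]; ring
    rw [h4] at h3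
    refine le_trans (Real.rpow_le_rpow_of_exponent_le ?_ ?_)
      (rpow_le_time (by omega) (by omega) hau (h3.trans_lt hm))
    · exact_mod_cast (by omega : 1 ≤ blockSize M m)
    · exact div_le_self hu0 (by linarith [Nat.cast_nonneg (α := ℝ) a])
  · refine ((eventually_ge_atTop 1).mono fun n hn => ?_).frequently
    have h3 : (n : ℝ) ≤ T n := by exact_mod_cast hP.le_time hn (by omega)
    refine le_trans (Real.rpow_le_rpow_of_exponent_le (by exact_mod_cast hn)
      ((div_le_one ha).2 hau.le)) (by rwa [Real.rpow_one])

/-- Once μ n ≥ m + 2, the block width is 1 and the size is 3m + 1 + 9(μ n - 1), which fits below a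
large n because μ n ≤ n/100. -/
theorem GrowingModulus.exists_size {c : ℝ} (hc : c ≤ 1 / 100) {μ : ℕ → ℕ}
    (hμ : GrowingModulus c μ) (m : ℕ) : ∃ n, blockSize (μ n) m ≤ n := by
  obtain ⟨n, hn1, hn2, hn3⟩ := (hμ.le_mul.and ((hμ.tendsto.eventually_ge_atTop (m + 2)).and
    (eventually_ge_atTop (4 * m + 2)))).exists
  refine ⟨n, ?_⟩
  have h1 : (μ n : ℝ) * 100 ≤ n := by nlinarith [Nat.cast_nonneg (α := ℝ) n]
  have h2 : μ n * 100 ≤ n := by exact_mod_cast h1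
  rw [blockSize, Nat.div_eq_of_lt (by omega)]
  omega

theorem GrowingModulus.exists_le_add {c : ℝ} (hc : c ≤ 1 / 100) {μ : ℕ → ℕ}
    (hμ : GrowingModulus c μ) : ∃ C, ∀ n, μ n ≤ n + C := by
  obtain ⟨N, hN⟩ := eventually_atTop.1 hμ.le_mul
  refine ⟨∑ n ∈ Finset.range N, μ n, fun n => ?_⟩
  rcases lt_or_ge n N with h | h
  · exact (Finset.single_le_sum (fun _ _ => Nat.zero_le _) (Finset.mem_range.2 h)).trans
      (Nat.le_add_left _ _)
  · have h1 : (μ n : ℝ) ≤ n := by nlinarith [hN n h, Nat.cast_nonneg (α := ℝ) n]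
    exact (Nat.cast_le.1 h1).trans (Nat.le_add_right _ _)

/-- The number of variables of the block reduction for a growing modulus. -/
theorem GrowingModulus.exists_reduction {c : ℝ} (hc : c ≤ 1 / 100) {μ : ℕ → ℕ}
    (hμ : GrowingModulus c μ) : ∃ (n : ℕ → ℕ) (a : ℕ) (R : Prog) (K : ℕ),
      (∀ (P : Prog) (T : ℕ → ℕ), SolvesLin2Mod P μ T →
        SolvesThreeSat (.seq R P) (fun m => K * (n m + 1) ^ a + T (n m))) ∧
      Tendsto n atTop atTop ∧
      ∀ᶠ m in atTop, Real.log (n m) ≤ 25 * (m * (Real.log (μ (n m)) / μ (n m))) := by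
  classical
  -- Taking the least admissible n makes n - 1 inadmissible, which bounds n from above by the block
  -- size for μ (n - 1); the doubling condition then compares μ n with μ (n - 1).
  let n : ℕ → ℕ := fun m => Nat.find (hμ.exists_size hc m)
  have hn : ∀ m, blockSize (μ (n m)) m ≤ n m := fun m => Nat.find_spec (hμ.exists_size hc m)
  have hmin : ∀ m, ∀ j < n m, j < blockSize (μ j) m := fun m j hj =>
    not_le.1 (Nat.find_min (hμ.exists_size hc m) hj)
  obtain ⟨C, hC⟩ := hμ.exists_le_add hc
  obtain ⟨a, R, K, hR⟩ := exists_growingReduction hμ.odd hμ.three_le hμ.polyTime hC n hn hmin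
  have hle : ∀ m, m ≤ n m := fun m => (le_blockSize _ m).trans (hn m)
  have hlim : Tendsto n atTop atTop := tendsto_atTop_mono hle tendsto_id
  refine ⟨n, a, R, K, hR, hlim, ?_⟩
  have hpred : Tendsto (fun m => n m - 1) atTop atTop := (tendsto_sub_atTop_nat 1).comp hlim
  filter_upwards [hpred.eventually hμ.le_mul, hpred.eventually hμ.doubling,
    eventually_ge_atTop 3] with m h1 h2 hm
  have hnm := hle m
  obtain ⟨j, hj⟩ : ∃ j, n m = j + 1 := ⟨n m - 1, by omega⟩
  rw [hj] at h1 h2 ⊢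
  rw [Nat.add_sub_cancel] at h1 h2
  have h3 := hmin m j (by omega)
  have h4 : (μ j : ℝ) * 100 ≤ j := by nlinarith [Nat.cast_nonneg (α := ℝ) j]
  have h5 : μ j * 100 ≤ j := by exact_mod_cast h4
  have h6 := hμ.three_le j
  refine log_le_of_le_blockSize h6 (hμ.three_le _) h2 ?_ (Nat.succ_pos _) (by omega)
  -- If μ j exceeded m + 1, the blocks would have width 1 and j itself would be admissible.
  by_contra h7
  rw [blockSize, Nat.div_eq_of_lt (by omega)] at h3
  omega

/-- The lower bound for a growing modulus. -/
theorem GrowingModulus.frequently_le_time {c : ℝ} {μ : ℕ → ℕ} (hμ : GrowingModulus c μ)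
    {n : ℕ → ℕ} {K a : ℕ} {T : ℕ → ℕ} {ε : ℝ} (hε : 0 < ε) (hn : Tendsto n atTop atTop)
    (hlog : ∀ᶠ m in atTop, Real.log (n m) ≤ 25 * (m * (Real.log (μ (n m)) / μ (n m))))
    (h : ∃ᶠ m : ℕ in atTop, (2 : ℝ) ^ (ε * (m : ℝ)) <
      ((K * (n m + 1) ^ a + T (n m) : ℕ) : ℝ)) :
    ∃ᶠ n : ℕ in atTop,
      (n : ℝ) ^ (ε * Real.log 2 / 50 * (μ n / Real.log (μ n))) ≤ T n := by
  have h2 := Real.log_pos (by norm_num : (1 : ℝ) < 2)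
  have hlim : Tendsto (fun n => (μ n : ℝ) / Real.log (μ n)) atTop atTop := by
    have h1 : Tendsto (fun x : ℝ => x / Real.log x) atTop atTop := by
      have h3 : Tendsto (fun x : ℝ => Real.log x / x) atTop (nhdsWithin 0 (Set.Ioi 0)) := by
        refine tendsto_nhdsWithin_iff.2 ⟨Real.isLittleO_log_id_atTop.tendsto_div_nhds_zero, ?_⟩
        filter_upwards [eventually_gt_atTop 1] with x hx
        exact div_pos (Real.log_pos hx) (by linarith)
      exact (tendsto_inv_nhdsGT_zero.comp h3).congr fun x => inv_div _ _
    exact h1.comp (tendsto_natCast_atTop_atTop.comp hμ.tendsto)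
  -- The exponent tends to infinity with the modulus, so it passes a + 1 even though a depends on μ.
  have hbig : ∀ᶠ n in atTop, (a : ℝ) + 1 ≤ ε * Real.log 2 / 50 * (μ n / Real.log (μ n)) :=
    (hlim.const_mul_atTop (by positivity)).eventually_ge_atTop _
  refine hn.frequently ((h.and_eventually (hlog.and ((hn.eventually hbig).and
    (hn.eventually_ge_atTop (K * 2 ^ a + 2))))).mono ?_)
  rintro m ⟨hm, hl, hu, hK⟩
  refine rpow_le_time (by omega) (by omega) hu (lt_of_le_of_lt ?_ hm)
  refine le_trans (le_of_eq ?_) (rpow_le_two_rpow hε (hμ.three_le _) (by omega) hl)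
  congr 1
  ring

/-! ### Several prime factors -/

theorem leastRoot_le {r m : ℕ} (hr : 1 ≤ r) (hm : 1 ≤ m) :
    (leastRoot r m : ℝ) ≤ 2 * (m : ℝ) ^ (1 / r : ℝ) := by
  obtain ⟨s, hs⟩ : ∃ s, leastRoot r m = s + 1 := ⟨leastRoot r m - 1, by
    have := leastRoot_pos hr m
    omega⟩
  have h1 := (leastRoot_spec hr m).2 s (by omega)
  have h2 : (s : ℝ) ≤ (m : ℝ) ^ (1 / r : ℝ) := by
    rw [one_div, Real.le_rpow_inv_iff_of_pos (Nat.cast_nonneg _) (Nat.cast_nonneg _)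
      (by exact_mod_cast hr), Real.rpow_natCast]
    exact_mod_cast h1
  have h3 : (1 : ℝ) ≤ (m : ℝ) ^ (1 / r : ℝ) :=
    Real.one_le_rpow (by exact_mod_cast hm) (by positivity)
  rw [hs]
  push_cast
  linarith

theorem eventually_log_primeBound_le {M r : ℕ} (hM : 0 < M) (hr : 1 ≤ r) :
    ∀ᶠ m : ℕ in atTop,
      Real.log (primeBound M r m) ≤ 4 * M * ((m : ℝ) ^ (1 / r : ℝ) * Real.log m) := by
  -- As the root is at most 2m, the base is at most 9(m + 2Mm + 2) ≤ 45Mm; from m ≥ 45M on this is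
  -- at most m². The exponent is at most 2M m^(1/r), whence the constant 4M.
  filter_upwards [eventually_ge_atTop (45 * M)] with m hm
  have hM1 : (1 : ℝ) ≤ M := by exact_mod_cast hM
  have hm' : (45 : ℝ) * M ≤ m := by exact_mod_cast hm
  have hm1 : (1 : ℝ) ≤ m := by linarith
  have h1 := leastRoot_le hr (m := m) (by omega)
  have h2 : (m : ℝ) ^ (1 / r : ℝ) ≤ m := by
    refine (Real.rpow_le_rpow_of_exponent_le hm1 ?_).trans_eq (Real.rpow_one _)
    exact (div_le_one (by exact_mod_cast hr)).2 (by exact_mod_cast hr)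
  have h3 : ((9 * (m + M * leastRoot r m + 2) : ℕ) : ℝ) ≤ (m : ℝ) ^ 2 := by
    push_cast
    have : (M : ℝ) * leastRoot r m ≤ M * (2 * m) := by gcongr; linarith
    nlinarith
  have h4 : Real.log ((9 * (m + M * leastRoot r m + 2) : ℕ) : ℝ) ≤ 2 * Real.log m := by
    have h5 := Real.log_le_log (by positivity) h3
    rwa [Real.log_pow] at h5
  have h0 := Real.log_nonneg hm1
  rw [primeBound, Nat.cast_pow, Real.log_pow]
  calc ((M * leastRoot r m : ℕ) : ℝ) * Real.log ((9 * (m + M * leastRoot r m + 2) : ℕ) : ℝ)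
      ≤ (M * (2 * (m : ℝ) ^ (1 / r : ℝ))) * (2 * Real.log m) := by
        refine mul_le_mul ?_ h4 (Real.log_natCast_nonneg _) (by positivity)
        push_cast
        gcongr
    _ = 4 * M * ((m : ℝ) ^ (1 / r : ℝ) * Real.log m) := by ring

/-- This is what needs two primes: m^(1/r) ≤ m^(1/2) and log m = o(m^(1/2)). It keeps the time of
the reduction below any 2^(εm). -/
theorem eventually_rpow_mul_log_le {r : ℕ} (hr : 2 ≤ r) {c : ℝ} (hc : 0 < c) :
    ∀ᶠ m : ℕ in atTop, (m : ℝ) ^ (1 / r : ℝ) * Real.log m ≤ c * m := by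
  have h1 := tendsto_natCast_atTop_atTop.eventually
    ((isLittleO_log_rpow_atTop (by norm_num : (0 : ℝ) < 1 / 2)).bound hc)
  filter_upwards [h1, eventually_ge_atTop 1] with m h1 hm
  have hm1 : (1 : ℝ) ≤ m := by exact_mod_cast hm
  rw [Real.norm_of_nonneg (Real.log_nonneg hm1), Real.norm_of_nonneg (by positivity)] at h1
  have h2 : (m : ℝ) ^ (1 / r : ℝ) ≤ (m : ℝ) ^ (1 / 2 : ℝ) :=
    Real.rpow_le_rpow_of_exponent_le hm1
      (one_div_le_one_div_of_le (by norm_num) (by exact_mod_cast hr))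
  have h3 : (m : ℝ) ^ (1 / 2 : ℝ) * (m : ℝ) ^ (1 / 2 : ℝ) = m := by
    rw [← Real.rpow_add (by linarith)]
    norm_num
  calc (m : ℝ) ^ (1 / r : ℝ) * Real.log m
      ≤ (m : ℝ) ^ (1 / 2 : ℝ) * (c * (m : ℝ) ^ (1 / 2 : ℝ)) :=
        mul_le_mul h2 h1 (Real.log_nonneg hm1) (by positivity)
    _ = c * m := by rw [mul_left_comm, h3]

theorem eventually_mul_primeBound_pow_le {M r : ℕ} (hM : 0 < M) (hr : 2 ≤ r) (K a : ℕ) {ε : ℝ}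
    (hε : 0 < ε) : ∀ᶠ m : ℕ in atTop,
      ((K * (primeBound M r m + 1) ^ a : ℕ) : ℝ) ≤ (2 : ℝ) ^ (ε * (m : ℝ)) / 2 := by
  have h2 := Real.log_pos (by norm_num : (1 : ℝ) < 2)
  have hlim : Tendsto (fun m : ℕ => Real.exp (ε * Real.log 2 / 2 * m)) atTop atTop :=
    Real.tendsto_exp_atTop.comp
      (tendsto_natCast_atTop_atTop.const_mul_atTop (by positivity))
  filter_upwards [eventually_log_primeBound_le hM (by omega : 1 ≤ r),
    eventually_rpow_mul_log_le hr (c := ε * Real.log 2 / 2 / (4 * M * (a + 1))) (by positivity),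
    hlim.eventually_ge_atTop (2 * (K * 2 ^ a))] with m h3 h4 h5
  have hB : 0 < primeBound M r m := by
    have := le_primeBound hM (by omega : 1 ≤ r) m
    omega
  have h6 : (a : ℝ) * Real.log (primeBound M r m) ≤ ε * Real.log 2 / 2 * m := by
    have h7 : 0 ≤ Real.log (primeBound M r m) := Real.log_natCast_nonneg _
    calc (a : ℝ) * Real.log (primeBound M r m)
        ≤ (a + 1) * (4 * M * (ε * Real.log 2 / 2 / (4 * M * (a + 1)) * m)) := by
          refine mul_le_mul (by linarith) (h3.trans ?_) h7 (by positivity)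
          gcongr
      _ = ε * Real.log 2 / 2 * m := by field_simp
  have h7 : ((primeBound M r m : ℝ)) ^ a ≤ Real.exp (ε * Real.log 2 / 2 * m) := by
    rw [← Real.log_le_iff_le_exp (by positivity), Real.log_pow]
    exact h6
  have h8 : K * (primeBound M r m + 1) ^ a ≤ K * 2 ^ a * primeBound M r m ^ a := by
    rw [mul_assoc, ← mul_pow]
    gcongr
    omega
  have h9 : (2 : ℝ) ^ (ε * (m : ℝ)) = Real.exp (ε * Real.log 2 / 2 * m) *
      Real.exp (ε * Real.log 2 / 2 * m) := by
    rw [Real.rpow_def_of_pos (by norm_num), ← Real.exp_add]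
    ring_nf
  rw [h9]
  calc ((K * (primeBound M r m + 1) ^ a : ℕ) : ℝ)
      ≤ ((K * 2 ^ a * primeBound M r m ^ a : ℕ) : ℝ) := by exact_mod_cast h8
    _ = (K * 2 ^ a) * (primeBound M r m : ℝ) ^ a := by push_cast; ring
    _ ≤ (Real.exp (ε * Real.log 2 / 2 * m) / 2) * Real.exp (ε * Real.log 2 / 2 * m) := by
        gcongr
        linarith
    _ = _ := by ring

/-- As x / log x increases from e on, x may be replaced by X = A w log m with w = m^(1/r). Then log
X ≥ log w = (log m)/r, so the quotient is at most A r w, and w^r = m. -/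
theorem log_div_log_log_pow_le {r m : ℕ} {x A : ℝ} (hr : 1 ≤ r) (hm : 2 ≤ m) (hA : 1 ≤ A)
    (hx : Real.exp 1 ≤ x) (h : x ≤ A * ((m : ℝ) ^ (1 / r : ℝ) * Real.log m))
    (hlog : 1 ≤ Real.log m) :
    (x / Real.log x) ^ r ≤ (A * r) ^ r * m := by
  have hm1 : (1 : ℝ) < m := by exact_mod_cast hm
  have hr0 : (0 : ℝ) < r := by exact_mod_cast hr
  set w := (m : ℝ) ^ (1 / r : ℝ) with hw
  have hw1 : 1 ≤ w := Real.one_le_rpow hm1.le (by positivity)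
  have hwr : w ^ r = m := by
    rw [hw, one_div, Real.rpow_inv_natCast_pow (by positivity) (by omega)]
  set X := A * (w * Real.log m) with hX
  have hx0 : 0 < x := (Real.exp_pos 1).trans_le hx
  have hlx : 1 ≤ Real.log x := (Real.le_log_iff_exp_le hx0).2 hx
  have h1 := Real.log_div_self_antitoneOn (Set.mem_Ici.2 hx) (Set.mem_Ici.2 (hx.trans h)) h
  have hX0 : 0 < X := hx0.trans_le h
  have hwX : w ≤ X := by
    rw [hX]
    have : 1 ≤ A * Real.log m := by nlinarith
    nlinarith
  have h2 : Real.log m / r ≤ Real.log X := by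
    have h3 := Real.log_le_log (by linarith) hwX
    rwa [hw, Real.log_rpow (by linarith), one_div, inv_mul_eq_div] at h3
  have h3 : x / Real.log x ≤ A * r * w := by
    have h4 : Real.log m / r / X ≤ Real.log x / x := (div_le_div_of_nonneg_right h2 hX0.le).trans h1
    rw [div_le_iff₀ (by linarith)]
    rw [div_le_div_iff₀ hX0 hx0, hX, div_mul_eq_mul_div, div_le_iff₀ hr0] at h4
    have h5 : Real.log m * x ≤ Real.log m * (A * r * w * Real.log x) := by linarith
    exact le_of_mul_le_mul_left h5 (by linarith)
  calc (x / Real.log x) ^ r ≤ (A * r * w) ^ r :=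
        pow_le_pow_left₀ (div_nonneg hx0.le (by linarith)) h3 r
    _ = (A * r) ^ r * m := by rw [mul_pow, hwr]

theorem le_primeSize (r : ℕ) (S : Finset ℕ) (m : ℕ) : m ≤ primeSize r S m := by
  rw [primeSize]; omega

/-- The lower bound for a modulus with at least two odd prime factors. -/
theorem frequently_le_time_of_primes {M r K a : ℕ} {S : Finset ℕ} {T : ℕ → ℕ} {ε : ℝ}
    (hε : 0 < ε) (hM : 0 < M) (hr : 2 ≤ r) (hS : ∀ p ∈ S, p.Prime ∧ p ∣ M)
    (h : ∃ᶠ m : ℕ in atTop, (2 : ℝ) ^ (ε * (m : ℝ)) <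
      ((K * (primeBound M r m + 1) ^ a + T (primeSize r S m) : ℕ) : ℝ)) :
    ∃ᶠ n : ℕ in atTop, Real.exp (ε * Real.log 2 / (2 * (5 * M * r) ^ r) *
      (Real.log n / Real.log (Real.log n)) ^ r) ≤ T n := by
  have h2 := Real.log_pos (by norm_num : (1 : ℝ) < 2)
  have hM1 : (1 : ℝ) ≤ M := by exact_mod_cast hM
  have hsize : Tendsto (primeSize r S) atTop atTop :=
    tendsto_atTop_mono (le_primeSize r S) tendsto_id
  have hloglim : Tendsto (fun m : ℕ => Real.log m) atTop atTop :=
    Real.tendsto_log_atTop.comp tendsto_natCast_atTop_atTop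
  refine hsize.frequently ((h.and_eventually
    ((eventually_mul_primeBound_pow_le hM hr K a hε).and
    ((eventually_log_primeBound_le hM (by omega : 1 ≤ r)).and
    ((hloglim.eventually_ge_atTop (Real.log (S.card + 1) + Real.exp 1 + 1)).and
    ((tendsto_natCast_atTop_atTop (R := ℝ)).eventually_ge_atTop (2 / (ε * Real.log 2) + 2)))))).mono
      ?_)
  rintro m ⟨h3, h4, h5, h6, h7⟩
  have h0 : 0 ≤ Real.log ((S.card : ℝ) + 1) := Real.log_nonneg (by
    linarith [Nat.cast_nonneg (α := ℝ) S.card])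
  have he := Real.exp_pos 1
  have hm2 : (2 : ℝ) ≤ m := by
    have : 0 < 2 / (ε * Real.log 2) := by positivity
    linarith
  have hm : 2 ≤ m := by exact_mod_cast hm2
  have hn : (m : ℝ) ≤ primeSize r S m := by exact_mod_cast le_primeSize r S m
  have hx : Real.exp 1 ≤ Real.log (primeSize r S m) := by
    have := Real.log_le_log (by linarith) hn
    linarith
  have hw : (1 : ℝ) ≤ (m : ℝ) ^ (1 / r : ℝ) := Real.one_le_rpow (by linarith) (by positivity)
  have hB : 0 < primeBound M r m := by
    have := le_primeBound hM (by omega : 1 ≤ r) m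
    omega
  -- The constant 5M is 4M from `primeBound` plus M for the number of primes, whose contribution is
  -- below log m.
  have hlog : Real.log (primeSize r S m) ≤ 5 * M * ((m : ℝ) ^ (1 / r : ℝ) * Real.log m) := by
    have h8 : ((primeSize r S m : ℕ) : ℝ) ≤ ((S.card : ℝ) + 1) * primeBound M r m := by
      exact_mod_cast primeSize_le hM (by omega) hS m
    have h9 := Real.log_le_log (by linarith) h8
    rw [Real.log_mul (by positivity) (by positivity)] at h9
    have h10 : Real.log m ≤ M * ((m : ℝ) ^ (1 / r : ℝ) * Real.log m) := by
      have : 1 * (1 * Real.log m) ≤ M * ((m : ℝ) ^ (1 / r : ℝ) * Real.log m) := by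
        gcongr
      linarith
    linarith
  have h8 := log_div_log_log_pow_le (by omega : 1 ≤ r) hm (by linarith) hx hlog (by linarith)
  have h9 : (2 : ℝ) ^ (ε * (m : ℝ)) / 2 ≤ T (primeSize r S m) := by
    rw [Nat.cast_add] at h3
    linarith
  refine le_trans ?_ h9
  have hr0 : (0 : ℝ) < r := by exact_mod_cast (by omega : 0 < r)
  have h10 : ε * Real.log 2 / (2 * (5 * M * r) ^ r) *
      (Real.log (primeSize r S m) / Real.log (Real.log (primeSize r S m))) ^ r ≤
      ε * Real.log 2 / 2 * m := by
    calc _ ≤ ε * Real.log 2 / (2 * (5 * M * r) ^ r) * ((5 * M * r) ^ r * m) := by gcongr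
      _ = ε * Real.log 2 / 2 * m := by field_simp
  refine (Real.exp_le_exp.2 h10).trans ?_
  rw [le_div_iff₀ (by norm_num), Real.rpow_def_of_pos (by norm_num)]
  have h11 : (2 : ℝ) ≤ Real.exp (ε * Real.log 2 / 2 * m) := by
    have h12 : 1 ≤ ε * Real.log 2 / 2 * m := by
      have h13 : 2 / (ε * Real.log 2) ≤ m := by linarith
      rw [div_le_iff₀ (by positivity)] at h13
      linarith
    linarith [Real.add_one_le_exp (ε * Real.log 2 / 2 * m)]
  calc Real.exp (ε * Real.log 2 / 2 * m) * 2
      ≤ Real.exp (ε * Real.log 2 / 2 * m) * Real.exp (ε * Real.log 2 / 2 * m) := by gcongr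
    _ = Real.exp (Real.log 2 * (ε * m)) := by rw [← Real.exp_add]; ring_nf

/-- The lower bound for a modulus with one odd prime factor. -/
theorem exp_log_div_log_log_le_time {M : ℕ} (hM : 2 ≤ M) {P : Prog} {T : ℕ → ℕ}
    (hP : SolvesLin2Mod P (fun _ => M) T) : ∃ᶠ n : ℕ in atTop,
      Real.exp (1 * (Real.log n / Real.log (Real.log n)) ^ 1) ≤ T n := by
  have hlim : Tendsto (fun n : ℕ => Real.log (Real.log n)) atTop atTop :=
    Real.tendsto_log_atTop.comp (Real.tendsto_log_atTop.comp tendsto_natCast_atTop_atTop)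
  refine Eventually.frequently ?_
  filter_upwards [hlim.eventually_ge_atTop 1, eventually_ge_atTop 1] with n hn hn1
  -- For r = 1 the claim is at most n once log log n ≥ 1, so reading the input suffices.
  have h1 : (n : ℝ) ≤ T n := by exact_mod_cast hP.le_time hn1 hM
  refine le_trans ?_ h1
  rw [one_mul, pow_one, ← Real.le_log_iff_exp_le (by exact_mod_cast hn1)]
  exact div_le_self (Real.log_natCast_nonneg _) hn

/-! ## The linear map that realises a polynomial -/

section Parity

variable {M n : ℕ}

/-- The parity of the variables in `S`, with values in `{-1, 1}`. -/
def parity (M : ℕ) {n : ℕ} (S : Finset (Fin n)) : (Fin n → ZMod 2) → ZMod M :=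
  fun y => 1 - 2 * ((∑ v ∈ S, y v).val : ZMod M)

/-- The combinations of parities of at most `k` variables. -/
def paritySpan (M n k : ℕ) : Submodule (ZMod M) ((Fin n → ZMod 2) → ZMod M) :=
  Submodule.span (ZMod M)
    (Set.range fun S : {S : Finset (Fin n) // S.card ≤ k} => parity M S.1)

theorem one_sub_two_mul_val_add (a b : ZMod 2) :
    (1 - 2 * ((a + b).val : ZMod M)) =
      (1 - 2 * (a.val : ZMod M)) * (1 - 2 * (b.val : ZMod M)) := by
  have h : (a + b).val + 2 * (a.val * b.val) = a.val + b.val := by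
    revert a b; decide
  have h' := congrArg (Nat.cast : ℕ → ZMod M) h
  push_cast at h'
  linear_combination (-2) * h'

/-- Common variables cancel in characteristic 2. -/
theorem parity_mul (S T : Finset (Fin n)) :
    parity M S * parity M T = parity M (symmDiff S T) := by
  funext y
  have h : ∑ v ∈ S, y v + ∑ v ∈ T, y v = ∑ v ∈ symmDiff S T, y v := by
    have h2 : ∀ S : Finset (Fin n), ∑ v ∈ S, y v = ∑ v, if v ∈ S then y v else 0 := fun S => by
      simp
    rw [h2 S, h2 T, h2, ← Finset.sum_add_distrib]
    refine Finset.sum_congr rfl fun v _ => ?_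
    by_cases h3 : v ∈ S <;> by_cases h4 : v ∈ T <;>
      simp [Finset.mem_symmDiff, h3, h4, CharTwo.add_self_eq_zero]
  rw [Pi.mul_apply, parity, parity, parity, ← one_sub_two_mul_val_add, h]

theorem parity_mem {k : ℕ} {S : Finset (Fin n)} (h : S.card ≤ k) :
    parity M S ∈ paritySpan M n k := Submodule.subset_span ⟨⟨S, h⟩, rfl⟩

theorem paritySpan_mono {j k : ℕ} (h : j ≤ k) : paritySpan M n j ≤ paritySpan M n k :=
  Submodule.span_le.2 fun _ ⟨S, hS⟩ => hS ▸ parity_mem (S.2.trans h)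

theorem one_mem_paritySpan (k : ℕ) : 1 ∈ paritySpan M n k := by
  have : (1 : (Fin n → ZMod 2) → ZMod M) = parity M ∅ := by funext y; simp [parity]
  rw [this]
  exact parity_mem (Nat.zero_le _)

/-- The symmetric difference has at most |S| + |T| elements, so degrees add as for polynomials. -/
theorem mul_mem_paritySpan {j k : ℕ} {f g : (Fin n → ZMod 2) → ZMod M}
    (hf : f ∈ paritySpan M n j) (hg : g ∈ paritySpan M n k) : f * g ∈ paritySpan M n (j + k) := by
  have h := Submodule.mul_mem_mul hf hg
  rw [paritySpan, paritySpan, Submodule.span_mul_span] at h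
  refine Submodule.span_le.2 ?_ h
  rintro _ ⟨_, ⟨S, rfl⟩, _, ⟨T, rfl⟩, rfl⟩
  simp only [parity_mul]
  refine parity_mem ((Finset.card_union_le _ _).trans (Nat.add_le_add ?_ ?_))
  · exact (Finset.card_le_card Finset.sdiff_subset).trans S.2
  · exact (Finset.card_le_card Finset.sdiff_subset).trans T.2

theorem prod_mem_paritySpan (s : Finset ι) (k : ι → ℕ) (f : ι → (Fin n → ZMod 2) → ZMod M)
    (h : ∀ i ∈ s, f i ∈ paritySpan M n (k i)) :
    ∏ i ∈ s, f i ∈ paritySpan M n (∑ i ∈ s, k i) := by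
  classical
  induction s using Finset.induction_on with
  | empty => exact one_mem_paritySpan _
  | insert i s hi ih =>
    rw [Finset.prod_insert hi, Finset.sum_insert hi]
    exact mul_mem_paritySpan (h i (Finset.mem_insert_self _ _))
      (ih fun j hj => h j (Finset.mem_insert_of_mem hj))

theorem pow_mem_paritySpan {k : ℕ} {f : (Fin n → ZMod 2) → ZMod M} (h : f ∈ paritySpan M n k)
    (e : ℕ) : f ^ e ∈ paritySpan M n (e * k) := by
  have := prod_mem_paritySpan (Finset.range e) (fun _ => k) (fun _ => f) fun _ _ => h
  simpa using this

theorem isUnit_two (hM : Odd M) : IsUnit (2 : ZMod M) := by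
  have := (ZMod.isUnit_iff_coprime 2 M).2 hM.coprime_two_left
  simpa using this

/-- Falsity of a literal is (1 ± (-1)^(y v))/2; oddness of M is needed for the division by 2. -/
theorem literal_mem_paritySpan (hM : Odd M) (v : Fin n) (b : Bool) :
    (fun y => if decide (y v = 1) = b then 0 else 1) ∈ paritySpan M n 1 := by
  obtain ⟨c, hc⟩ := (isUnit_two hM).exists_left_inv
  have h : (fun y : Fin n → ZMod 2 => (if decide (y v = 1) = b then 0 else 1 : ZMod M)) =
      c • (1 + (if b then 1 else -1 : ZMod M) • parity M {v}) := by
    funext y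
    simp only [Pi.smul_apply, Pi.add_apply, Pi.one_apply, parity, Finset.sum_singleton,
      smul_eq_mul]
    generalize y v = a
    have ha : a = 0 ∨ a = 1 := by revert a; decide
    have h1 : (1 : ZMod 2).val = 1 := rfl
    rcases ha with rfl | rfl <;> cases b <;>
      simp only [zero_ne_one, decide_false, decide_true, reduceIte, ZMod.val_zero, h1,
        Nat.cast_zero, Nat.cast_one, Bool.false_eq_true, Bool.true_eq_false] <;>
      first | ring1 | linear_combination -hc
  rw [h]
  exact Submodule.smul_mem _ _ (Submodule.add_mem _ (one_mem_paritySpan 1)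
    (Submodule.smul_mem _ _ (parity_mem (by simp))))

/-- The clause value is 1 - 2 times the product of the falsities of its three literals. -/
theorem clauseValue_mem_paritySpan (hM : Odd M) {m : ℕ} (φ : ThreeCNF m) (i : Fin m) :
    (fun y => (φ.clauseValue (fun v => decide (y v = 1)) i : ZMod M)) ∈
      paritySpan M (3 * m) 3 := by
  have h := prod_mem_paritySpan Finset.univ (fun _ : Fin 3 => 1) _ fun j _ =>
    literal_mem_paritySpan hM (φ i j).1 (φ i j).2
  have h2 : (fun y : Fin (3 * m) → ZMod 2 =>
      (φ.clauseValue (fun v => decide (y v = 1)) i : ZMod M)) = 1 - (2 : ZMod M) •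
        ∏ j : Fin 3, fun y => if decide (y (φ i j).1 = 1) = (φ i j).2 then 0 else 1 := by
    funext y
    simp only [Pi.sub_apply, Pi.one_apply, Pi.smul_apply, Finset.prod_apply, smul_eq_mul]
    rw [ThreeCNF.clauseValue]
    split_ifs with hs
    · obtain ⟨j, hj⟩ := hs
      rw [Finset.prod_eq_zero (M₀ := ZMod M) (Finset.mem_univ j) (if_pos hj)]
      simp
    · rw [Finset.prod_congr rfl fun j _ => if_neg fun hj => hs ⟨j, hj⟩]
      simp
      norm_num
  rw [h2]
  exact Submodule.sub_mem _ (one_mem_paritySpan 3) (Submodule.smul_mem _ _ (by simpa using h))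

theorem eval_clauseValue_mem_paritySpan (hM : Odd M) {m : ℕ} (φ : ThreeCNF m)
    (p : MvPolynomial (Fin m) ℤ) :
    (fun y => ((MvPolynomial.eval (φ.clauseValue fun v => decide (y v = 1)) p : ℤ) : ZMod M)) ∈
      paritySpan M (3 * m) (3 * p.totalDegree) := by
  have h : (fun y : Fin (3 * m) → ZMod 2 =>
      ((MvPolynomial.eval (φ.clauseValue fun v => decide (y v = 1)) p : ℤ) : ZMod M)) =
      ∑ μ ∈ p.support, ((p.coeff μ : ℤ) : ZMod M) • ∏ i ∈ μ.support,
        (fun y => (φ.clauseValue (fun v => decide (y v = 1)) i : ZMod M)) ^ μ i := by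
    funext y
    simp only [Finset.sum_apply, Pi.smul_apply, Finset.prod_apply, Pi.pow_apply, smul_eq_mul]
    rw [MvPolynomial.eval_eq]
    push_cast
    rfl
  rw [h]
  refine Submodule.sum_mem _ fun μ hμ => Submodule.smul_mem _ _ ?_
  refine paritySpan_mono ?_ (prod_mem_paritySpan _ (fun i => μ i * 3) _
    fun i _ => pow_mem_paritySpan (clauseValue_mem_paritySpan hM φ i) _)
  rw [← Finset.sum_mul, mul_comm]
  exact Nat.mul_le_mul_left _ (MvPolynomial.le_totalDegree hμ)

/-- The image of a linear map is cut out by as many equations as the target has coordinates. -/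
theorem exists_matrix_range {N : ℕ} (u : (Fin n → ZMod 2) →ₗ[ZMod 2] (Fin N → ZMod 2)) :
    ∃ A : Fin N → Fin N → ZMod 2, ∀ x, x ∈ Set.range u ↔ ∀ e, ∑ j, A e j * x j = 0 := by
  obtain ⟨g, hg⟩ := (LinearMap.range u).subtype.exists_leftInverse_of_injective
    (Submodule.ker_subtype _)
  -- Over a field the range has a projection g onto it; the kernel of 1 - g is the range.
  let A := LinearMap.id - (LinearMap.range u).subtype.comp g
  refine ⟨LinearMap.toMatrix' A, fun x => ?_⟩
  have h1 : (∀ e, ∑ j, LinearMap.toMatrix' A e j * x j = 0) ↔ A x = 0 := by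
    rw [← LinearMap.toMatrix'_mulVec A x, funext_iff]
    rfl
  rw [h1]
  constructor
  · intro hx
    have h2 := congrArg Subtype.val (LinearMap.congr_fun hg ⟨x, hx⟩)
    simp only [LinearMap.comp_apply, Submodule.subtype_apply, LinearMap.id_apply] at h2
    simp only [A, LinearMap.sub_apply, LinearMap.comp_apply, Submodule.subtype_apply,
      LinearMap.id_apply, h2, sub_self]
  · intro hx
    have h2 : x = (g x : Fin N → ZMod 2) := sub_eq_zero.1 hx
    rw [h2]
    exact (g x).2

/-- The reduction from the conjunction of clauses to one instance. -/
theorem exists_linearMap_instance {m : ℕ} (p : MvPolynomial (Fin m) ℤ) (φ : ThreeCNF m)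
    (hM : Odd M) (hp : RepresentsOR M m p) :
    ∃ N : ℕ, N ≤ ∑ i ∈ Finset.range (3 * p.totalDegree + 1), (3 * m).choose i ∧
      ∃ (I : Lin2Mod M N) (u : (Fin (3 * m) → ZMod 2) →ₗ[ZMod 2] (Fin N → ZMod 2)),
        I.solutions = Set.range u ∧
        (∀ y : Fin (3 * m) → ZMod 2,
          ∑ j, I.wt j * (1 - 2 * ((u y j).val : ZMod M)) =
            ((MvPolynomial.eval (φ.clauseValue fun v => decide (y v = 1)) p : ℤ) : ZMod M)) ∧
        (I.Satisfiable ↔ φ.Satisfiable) := by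
  -- One variable for each set of at most 3Δ variables: its value under u is the parity of the set,
  -- and its weight is the coefficient of that parity.
  let X := {S : Finset (Fin (3 * m)) // S.card ≤ 3 * p.totalDegree}
  let e := Fintype.equivFin X
  obtain ⟨c, hc⟩ := (Submodule.mem_span_range_iff_exists_fun _).1
    (eval_clauseValue_mem_paritySpan hM φ p)
  let u : (Fin (3 * m) → ZMod 2) →ₗ[ZMod 2] (Fin (Fintype.card X) → ZMod 2) :=
    LinearMap.pi fun j => ∑ v ∈ (e.symm j).1, LinearMap.proj v
  obtain ⟨A, hA⟩ := exists_matrix_range u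
  -- h is the inverse of 2: the condition ∑ c (1 - 2x) = 0 is equivalent to ∑ c x = (∑ c)/2.
  obtain ⟨h, hh⟩ := (isUnit_two hM).exists_left_inv
  let I : Lin2Mod M (Fintype.card X) :=
    { numEq := Fintype.card X
      numEq_le := le_rfl
      mat := A
      rhs := 0
      wt := fun j => c (e.symm j)
      target := h * ∑ j, c (e.symm j) }
  have hI : I.solutions = Set.range u := Set.ext fun x => (hA x).symm
  have hu : ∀ y : Fin (3 * m) → ZMod 2, ∑ j, I.wt j * (1 - 2 * ((u y j).val : ZMod M)) =
      ((MvPolynomial.eval (φ.clauseValue fun v => decide (y v = 1)) p : ℤ) : ZMod M) := by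
    intro y
    have h1 := congrFun hc y
    simp only [Finset.sum_apply, Pi.smul_apply, smul_eq_mul] at h1
    rw [← h1, ← e.symm.sum_comp]
    refine Finset.sum_congr rfl fun j _ => ?_
    simp only [I, u, parity, LinearMap.pi_apply, LinearMap.sum_apply, LinearMap.proj_apply]
  refine ⟨Fintype.card X, ?_, I, u, hI, hu, ?_⟩
  · rw [Fintype.card_subtype]
    exact card_filter_card_le _ _
  have h1 : ∀ y, ∑ j, I.wt j * ((u y j).val : ZMod M) = I.target ↔
      ∀ i, φ.ClauseSat (fun v => decide (y v = 1)) i := by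
    intro y
    rw [← hp.clauseValue_iff, ← hu y]
    have h2 : ∑ j, I.wt j * (1 - 2 * ((u y j).val : ZMod M)) =
        ∑ j, c (e.symm j) - 2 * ∑ j, I.wt j * ((u y j).val : ZMod M) := by
      rw [Finset.mul_sum, ← Finset.sum_sub_distrib]
      exact Finset.sum_congr rfl fun j _ => by ring
    rw [h2]
    constructor
    · intro h3
      rw [h3]
      linear_combination (-∑ j, c (e.symm j)) * hh
    · intro h3
      linear_combination (-h) * h3 - (∑ j, I.wt j * ((u y j).val : ZMod M)) * hh
  constructor
  · rintro ⟨x, hx, hxt⟩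
    rw [hI] at hx
    obtain ⟨y, rfl⟩ := hx
    exact ⟨_, (h1 y).1 hxt⟩
  · rintro ⟨x, hx⟩
    refine ⟨u fun v => if x v then 1 else 0, hI ▸ ⟨_, rfl⟩, (h1 _).2 ?_⟩
    convert hx using 3
    cases x _ <;> simp

end Parity

end ModCSP

/-! ### Assembly of the reductions and the lower bounds -/

theorem mainTheorem10 :
    -- the reduction: affine subspace and weights realising the values of the polynomial
    (∀ (M m : ℕ) (p : MvPolynomial (Fin m) ℤ) (φ : ThreeCNF m), Odd M → RepresentsOR M m p →
      ∃ N : ℕ, N ≤ ∑ i ∈ Finset.range (3 * p.totalDegree + 1), (3 * m).choose i ∧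
      ∃ (I : Lin2Mod M N) (u : (Fin (3 * m) → ZMod 2) →ₗ[ZMod 2] (Fin N → ZMod 2)),
        I.solutions = Set.range u ∧
        (∀ y : Fin (3 * m) → ZMod 2,
          ∑ j, I.wt j * (1 - 2 * ((u y j).val : ZMod M)) =
            ((MvPolynomial.eval (φ.clauseValue fun v => decide (y v = 1)) p : ℤ) : ZMod M)) ∧
        (I.Satisfiable ↔ φ.Satisfiable)) ∧
    -- lower bounds under the exponential time hypothesis
    (ETH →
      (∃ δ C : ℝ, 0 < δ ∧ 0 < C ∧ ∀ k : ℕ, ∃ a : ℕ, ∀ (M : ℕ) (f : ℕ → ℕ), Odd M →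
        EfficientOR M f k → ∃ K : ℕ, ∀ (P : Prog) (T : ℕ → ℕ), SolvesLin2Mod P (fun _ => M) T →
          ∃ᶠ m : ℕ in Filter.atTop, ∃ n : ℕ, m ≤ n ∧
            Real.log n ≤ C * ((f m : ℝ) * Real.log (Real.exp 1 * (m : ℝ) / (f m : ℝ))) ∧
            (2 : ℝ) ^ (δ * (m : ℝ)) - (K : ℝ) * (n : ℝ) ^ a ≤ (T n : ℝ)) ∧
      (∃ c δ : ℝ, 0 < c ∧ c < 1 ∧ 0 < δ ∧
        (∀ M : ℕ, Odd M → 3 ≤ M → ∀ (P : Prog) (T : ℕ → ℕ), SolvesLin2Mod P (fun _ => M) T →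
          ∃ᶠ n : ℕ in Filter.atTop,
            (n : ℝ) ^ (δ * ((M : ℝ) / Real.log (M : ℝ))) ≤ (T n : ℝ)) ∧
        (∀ μ : ℕ → ℕ, GrowingModulus c μ → ∀ (P : Prog) (T : ℕ → ℕ), SolvesLin2Mod P μ T →
          ∃ᶠ n : ℕ in Filter.atTop,
            (n : ℝ) ^ (δ * ((μ n : ℝ) / Real.log (μ n : ℝ))) ≤ (T n : ℝ))) ∧
      (∀ M r : ℕ, 2 ≤ M → 1 ≤ r → (M.primeFactors.erase 2).card = r →
        ∃ δ : ℝ, 0 < δ ∧ ∀ (P : Prog) (T : ℕ → ℕ), SolvesLin2Mod P (fun _ => M) T →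
          ∃ᶠ n : ℕ in Filter.atTop,
            Real.exp (δ * (Real.log n / Real.log (Real.log n)) ^ r) ≤ (T n : ℝ))) ∧
    -- the same under the little-o form of the hypothesis, algorithm by algorithm
    (ETHLittleO →
      (∃ C : ℝ, 0 < C ∧ ∀ k : ℕ, ∃ a : ℕ, ∀ (M : ℕ) (f : ℕ → ℕ), Odd M →
        EfficientOR M f k → ∃ K : ℕ, ∀ (P : Prog) (T : ℕ → ℕ), SolvesLin2Mod P (fun _ => M) T →
          ∃ δ : ℝ, 0 < δ ∧ ∃ᶠ m : ℕ in Filter.atTop, ∃ n : ℕ, m ≤ n ∧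
            Real.log n ≤ C * ((f m : ℝ) * Real.log (Real.exp 1 * (m : ℝ) / (f m : ℝ))) ∧
            (2 : ℝ) ^ (δ * (m : ℝ)) - (K : ℝ) * (n : ℝ) ^ a ≤ (T n : ℝ)) ∧
      (∃ c : ℝ, 0 < c ∧ c < 1 ∧
        ∀ μ : ℕ → ℕ, GrowingModulus c μ → ∀ (P : Prog) (T : ℕ → ℕ), SolvesLin2Mod P μ T →
          ∃ δ : ℝ, 0 < δ ∧ ∃ᶠ n : ℕ in Filter.atTop,
            (n : ℝ) ^ (δ * ((μ n : ℝ) / Real.log (μ n : ℝ))) ≤ (T n : ℝ)) ∧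
      (∀ M r : ℕ, 2 ≤ M → 1 ≤ r → (M.primeFactors.erase 2).card = r →
        ∀ (P : Prog) (T : ℕ → ℕ), SolvesLin2Mod P (fun _ => M) T →
          ∃ δ : ℝ, 0 < δ ∧ ∃ᶠ n : ℕ in Filter.atTop,
            Real.exp (δ * (Real.log n / Real.log (Real.log n)) ^ r) ≤ (T n : ℝ))) := by
  refine ⟨fun M m p φ hM hp => exists_linearMap_instance p φ hM hp, fun h => ?_, fun h => ?_⟩
  · obtain ⟨ε, hε, h⟩ := h.exists_frequently
    have h2 := Real.log_pos (by norm_num : (1 : ℝ) < 2)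
    refine ⟨⟨ε, 4, hε, by norm_num, fun k => ?_⟩, ?_, fun M r hM hr hcard => ?_⟩
    · obtain ⟨a, ha⟩ := exists_polyReduction k
      refine ⟨a, fun M f hM hf => ?_⟩
      obtain ⟨n, R, K, hR, hn⟩ := ha M f hM hf
      exact ⟨K, fun P T hP => frequently_exists_of_reduction hn (h _ _ (hR P T hP))⟩
    · obtain ⟨a, ha⟩ := exists_blockReduction
      have hle : ε * Real.log 2 / (50 * (a + 1)) ≤ ε * Real.log 2 / 50 := by
        refine div_le_div_of_nonneg_left (by positivity) (by norm_num) ?_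
        linarith [Nat.cast_nonneg (α := ℝ) a]
      refine ⟨1 / 100, ε * Real.log 2 / (50 * (a + 1)), by norm_num, by norm_num, by positivity,
        fun M hM h3 P T hP => ?_, fun μ hμ P T hP => ?_⟩
      · obtain ⟨R, K, hR⟩ := ha M hM h3
        exact frequently_le_time_of_blocks hε h3 hP (h _ _ (hR P T hP))
      · obtain ⟨n, b, R, K, hR, hn, hlog⟩ := hμ.exists_reduction le_rfl
        refine ((hμ.frequently_le_time hε hn hlog (h _ _ (hR P T hP))).and_eventually
          (eventually_ge_atTop 1)).mono ?_
        rintro n ⟨hT, hn⟩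
        refine (Real.rpow_le_rpow_of_exponent_le (by exact_mod_cast hn)
          (mul_le_mul_of_nonneg_right hle ?_)).trans hT
        exact div_nonneg (Nat.cast_nonneg _) (Real.log_natCast_nonneg _)
    -- A single odd prime needs no hypothesis: the bound follows from reading the input.
    · rcases hr.eq_or_lt with rfl | hr
      · exact ⟨1, one_pos, fun P T hP => exp_log_div_log_log_le_time hM hP⟩
      · have hS : ∀ p ∈ M.primeFactors.erase 2, p.Prime ∧ p ∣ M := fun p hp =>
          ⟨Nat.prime_of_mem_primeFactors (Finset.mem_of_mem_erase hp),
            Nat.dvd_of_mem_primeFactors (Finset.mem_of_mem_erase hp)⟩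
        obtain ⟨a, R, K, hR⟩ := exists_primeReduction (by omega : 0 < M) hr.le hS
          (Finset.notMem_erase 2 _) hcard
        refine ⟨ε * Real.log 2 / (2 * (5 * M * r) ^ r), ?_, fun P T hP =>
          frequently_le_time_of_primes hε (by omega) hr hS (h _ _ (hR P T hP))⟩
        have : (0 : ℝ) < M := by exact_mod_cast (by omega : 0 < M)
        have : (0 : ℝ) < r := by exact_mod_cast (by omega : 0 < r)
        positivity
  · have h2 := Real.log_pos (by norm_num : (1 : ℝ) < 2)
    refine ⟨⟨4, by norm_num, fun k => ?_⟩, ⟨1 / 100, by norm_num, by norm_num,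
      fun μ hμ P T hP => ?_⟩, fun M r hM hr hcard P T hP => ?_⟩
    · obtain ⟨a, ha⟩ := exists_polyReduction k
      refine ⟨a, fun M f hM hf => ?_⟩
      obtain ⟨n, R, K, hR, hn⟩ := ha M f hM hf
      refine ⟨K, fun P T hP => ?_⟩
      obtain ⟨ε, hε, h⟩ := h.exists_frequently (hR P T hP)
      exact ⟨ε, hε, frequently_exists_of_reduction hn h⟩
    · obtain ⟨n, b, R, K, hR, hn, hlog⟩ := hμ.exists_reduction le_rfl
      obtain ⟨ε, hε, h⟩ := h.exists_frequently (hR P T hP)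
      exact ⟨ε * Real.log 2 / 50, by positivity, hμ.frequently_le_time hε hn hlog h⟩
    · rcases hr.eq_or_lt with rfl | hr
      · exact ⟨1, one_pos, exp_log_div_log_log_le_time hM hP⟩
      · have hS : ∀ p ∈ M.primeFactors.erase 2, p.Prime ∧ p ∣ M := fun p hp =>
          ⟨Nat.prime_of_mem_primeFactors (Finset.mem_of_mem_erase hp),
            Nat.dvd_of_mem_primeFactors (Finset.mem_of_mem_erase hp)⟩
        obtain ⟨a, R, K, hR⟩ := exists_primeReduction (by omega : 0 < M) hr.le hS
          (Finset.notMem_erase 2 _) hcard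
        obtain ⟨ε, hε, h⟩ := h.exists_frequently (hR P T hP)
        refine ⟨ε * Real.log 2 / (2 * (5 * M * r) ^ r), ?_,
          frequently_le_time_of_primes hε (by omega) hr hS h⟩
        have : (0 : ℝ) < M := by exact_mod_cast (by omega : 0 < M)
        have : (0 : ℝ) < r := by exact_mod_cast (by omega : 0 < r)
        positivity
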